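/- Let $k\ge 1$ and let $\Lambda$ be a row-finite, locally convex $k$-graph: a countable small category with a degree functor $d:\Lambda\to\mathbb N^k$ having the unique factorisation property, such that every vertex $v$ receives finitely many edges, and such that for $i<j$ and edges $\mu\in v\Lambda^{e_i}$, $\nu\in v\Lambda^{e_j}$ the sets $s(\mu)\Lambda^{e_j}$ and $s(\nu)\Lambda^{e_i}$ are nonempty. Here $v\Lambda^{e_i}$ is the set of edges of colour $i$ with range $v$. *Modules.* An $\mathcal A_\Lambda$-module is a complex Hilbert space $H$ with bounded operators $A_\lambda$ ($\lambda\in\Lambda$) such that the $A_v$ ($v$ a vertex) are mutually orthogonal projections with $\sum_v A_v=1$ strongly, $A_\mu A_\nu=A_{\nu\circ\mu}$ for composable $\nu,\mu$, and $\sum_{\lambda\in v\Lambda^{e_i}}A_\lambda^*A_\lambda=A_v$ whenever $v\Lambda^{e_i}\neq\emptyset$; put $H_v=A_vH$. Morphisms are bounded operators intertwining the $A_\lambda$, and isomorphisms are the invertible ones. A submodule is a closed subspace invariant under all $A_\lambda$; a module is irreducible if it is nonzero and its only submodules are $0$ and itself; a subspace is residual if it contains no nonzero submodule; a module is decomposable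 if the orthogonal complement of some nonzero submodule contains a nonzero submodule, and indecomposable otherwise. Trees at a vertex $v$ are the finite sets of paths obtained from $\{v\}$ by repeatedly replacing an element $\mu$ by all $\mu\circ e$ with $e\in s(\mu)\Lambda^{e_i}$, for some $i$ with $s(\mu)\Lambda^{e_i}\ne\emptyset$. A submodule $H'\subset H$ is complete if for all $\varepsilon>0$, all vertices $v$ and all $\xi\in H_v$ there are a tree $t$ at $v$ and vectors $\eta_\mu\in H'$ ($\mu\in t$) with $\sum_{\mu\in t}\|A_\mu\xi-\eta_\mu\|^2<\varepsilon^2$. *Representations.* A representation of $\mathcal O_\Lambda$ is a complex Hilbert space $L$ with bounded operators $X_\lambda$ such that the $X_v$ are mutually orthogonal projections with $\sum_vX_v=1$ strongly, $X_\lambda^*X_\lambda=X_{s(\lambda)}$, $X_v=\sum_{\lambda\in v\Lambda^{e_i}}X_\lambda X_\lambda^*$ whenever $v\Lambda^{e_i}\ne\emptyset$, and $X_\lambda X_\mu=X_{\lambda\circ\mu}$ for composable $\lambda,\mu$. Isomorphisms are invertible bounded operators intertwining the $X_\lambda$ and the $X_\lambda^*$, and irreducibility refers to closed subspaces invariant under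 all $X_\lambda$ and $X_\lambda^*$. The module $UL$ is $L$ with $A_\lambda=X_\lambda^*$. For a module $H$, $\Pi(H)$ is the representation on the Hilbert space spanned by vectors $[\lambda,\xi]$ ($\lambda\in\Lambda$, $\xi\in H_{s(\lambda)}$), linear in $\xi$, with $[\lambda,\xi]=\sum_{\mu\in s(\lambda)\Lambda^{e_i}}[\lambda\mu,A_\mu\xi]$ if $s(\lambda)\Lambda^{e_i}\neq\emptyset$, with $\langle[\lambda,\xi],[\lambda,\eta]\rangle=\langle\xi,\eta\rangle$, with $[\lambda,\xi]\perp[\mu,\eta]$ if $\lambda,\mu$ have no common extension, and with $X_\mu[\lambda,\xi]=[\mu\lambda,\xi]$ if $s(\mu)=r(\lambda)$, and $0$ otherwise. Let $J:H\to U\Pi(H)$ be the isometric morphism with $J\xi=[v,\xi]$ for $\xi\in H_v$. A module $H$ has finite Pythagorean dimension if $\Pi(H)\cong\Pi(K)$ for some finite-dimensional module $K$. **Statement.** Let $H$ be a nonzero $\mathcal A_\Lambda$-module of finite Pythagorean dimension. 1. There are $n\ge1$, irreducible finite-dimensional submodules $H_1,\dots,H_n$ of $H$ and a residual subspace $Z\subset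 H$ with an orthogonal decomposition $H=H_1\oplus\cdots\oplus H_n\oplus Z$, and $H_s:=H_1\oplus\cdots\oplus H_n$ is a complete submodule. In every orthogonal decomposition of $H$ into finitely many irreducible submodules and a residual subspace, the number of irreducible submodules is at least $1$ and they are finite-dimensional. If $H$ is isomorphic to a module with an orthogonal decomposition $K_1\oplus\cdots\oplus K_m\oplus Y$ with each $K_j$ an irreducible submodule and $Y$ residual, then $n=m$ and there is a permutation $\varphi$ with $H_i\cong K_{\varphi(i)}$ for all $i$. 2. For every decomposition as in (1), $H_s$ is the smallest complete submodule of $H$: it is complete and is contained in every complete submodule. 3. If $K$ is a module of finite Pythagorean dimension, then $K$ has a smallest complete submodule $K_s$, and $\theta(H_s)\subset K_s$ for every morphism $\theta:H\to K$. 4. $J(H_s)$ is the smallest complete submodule of $U\Pi(H)$. 5. For $K$ and $K_s$ as in (3), $\Pi(H)\cong\Pi(K)$ if and only if $H_s\cong K_s$. 6. $\Pi(H)$ is irreducible if and only if $n=1$ in (1), that is, if and only if $H=H_1\oplus Z$ orthogonally with $H_1$ an irreducible submodule and $Z$ residual; equivalently, $H$ is indecomposable. 7. $\Pi(H)\cong\Pi(H_1)\oplus\cdots\oplus\Pi(H_n)$,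 each $\Pi(H_i)$ is irreducible, and $\Pi(H_i)\cong\Pi(H_j)$ if and only if $H_i\cong H_j$. -/

import Mathlib

open CategoryTheory
open scoped InnerProductSpace

universe u w

/-- A `k`-graph: a countable small category with a degree functor to `ℕ ^ k` that has the
factorisation property. A path `f : a ⟶ b` has source `a` and range `b`, so that the
composition `λ ∘ μ` (first `μ`, then `λ`) is `μ ≫ λ`. -/
structure KGraph (k : ℕ) where
  Vertex : Type u
  [cat : SmallCategory Vertex]
  countable_vertex : Countable Vertex
  countable_path : ∀ a b : Vertex, Countable (a ⟶ b)
  deg : ∀ {a b : Vertex}, (a ⟶ b) → (Fin k → ℕ)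
  deg_id : ∀ a : Vertex, deg (𝟙 a) = 0
  deg_comp : ∀ {a b c : Vertex} (g : a ⟶ b) (f : b ⟶ c), deg (g ≫ f) = deg f + deg g
  factorisation : ∀ {a c : Vertex} (f : a ⟶ c) (m n : Fin k → ℕ), deg f = m + n →
    ∃! p : Σ b : Vertex, (a ⟶ b) × (b ⟶ c),
      p.2.1 ≫ p.2.2 = f ∧ deg p.2.2 = m ∧ deg p.2.1 = n

attribute [instance] KGraph.cat

namespace KGraph

variable {k : ℕ} (Λ : KGraph.{u} k)

/-- `Λ.In v` is the set `vΛ` of paths with range `v`; the source of `μ : Λ.In v` is `μ.1`. -/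
abbrev In (v : Λ.Vertex) : Type u := Σ a : Λ.Vertex, (a ⟶ v)

/-- The set `vΛ^{e_i}` of edges of colour `i` with range `v`. -/
def edgeSet (v : Λ.Vertex) (i : Fin k) : Set (Λ.In v) := {e | Λ.deg e.2 = Pi.single i 1}

/-- Every vertex receives finitely many edges. -/
class RowFinite : Prop where
  finite : ∀ (v : Λ.Vertex) (i : Fin k), (Λ.edgeSet v i).Finite

class LocallyConvex : Prop where
  nonempty : ∀ (v : Λ.Vertex) (i j : Fin k), i < j →
    ∀ e ∈ Λ.edgeSet v i, ∀ f ∈ Λ.edgeSet v j,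
      (Λ.edgeSet e.1 j).Nonempty ∧ (Λ.edgeSet f.1 i).Nonempty

variable {Λ}

/-- The vertex `v` as a path with range `v`. -/
abbrev root (v : Λ.Vertex) : Λ.In v := ⟨v, 𝟙 v⟩

/-- The composition `μ ∘ α` of a path `μ` with a path `α` whose range is the source of `μ`. -/
abbrev ext {v : Λ.Vertex} (μ : Λ.In v) (α : Λ.In μ.1) : Λ.In v := ⟨α.1, α.2 ≫ μ.2⟩

theorem deg_ext {v : Λ.Vertex} (μ : Λ.In v) (α : Λ.In μ.1) :
    Λ.deg (ext μ α).2 = Λ.deg μ.2 + Λ.deg α.2 := Λ.deg_comp _ _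

theorem deg_root (v : Λ.Vertex) : Λ.deg (root v).2 = 0 := Λ.deg_id v

theorem ext_root {v : Λ.Vertex} (μ : Λ.In v) : ext μ (root μ.1) = μ := by
  simp [ext, root]

theorem root_ext {v : Λ.Vertex} (α : Λ.In v) : ext (root v) α = α := by
  obtain ⟨a, f⟩ := α
  exact congrArg (Sigma.mk a) (Category.comp_id f)

theorem ext_assoc {v : Λ.Vertex} (μ : Λ.In v) (α : Λ.In μ.1) (β : Λ.In α.1) :
    ext (ext μ α) β = ext μ (ext α β) := by
  simp [ext]

theorem ext_unique {v : Λ.Vertex} {μ ν : Λ.In v} {α : Λ.In μ.1} {β : Λ.In ν.1}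
    (h : ext μ α = ext ν β) (hd : Λ.deg μ.2 = Λ.deg ν.2) :
    (⟨μ, α⟩ : Σ μ : Λ.In v, Λ.In μ.1) = ⟨ν, β⟩ := by
  obtain ⟨a, f⟩ := μ
  obtain ⟨b, g⟩ := ν
  obtain ⟨c, p⟩ := α
  obtain ⟨c', q⟩ := β
  dsimp only at p q hd
  have hc : c = c' := congrArg Sigma.fst h
  subst hc
  have h2 : p ≫ f = q ≫ g := eq_of_heq (Sigma.mk.inj h).2
  have hdeg : Λ.deg (p ≫ f) = Λ.deg f + Λ.deg p := Λ.deg_comp _ _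
  have hpq : Λ.deg q = Λ.deg p := by
    have := Λ.deg_comp q g
    rw [← h2, hdeg, hd] at this
    exact (add_left_cancel this).symm
  have := (Λ.factorisation (p ≫ f) _ _ hdeg).unique
    (y₁ := ⟨a, p, f⟩) (y₂ := ⟨b, q, g⟩) ⟨rfl, rfl, rfl⟩ ⟨h2.symm, hd.symm, hpq⟩
  cases this
  rfl

theorem ext_injective {v : Λ.Vertex} (μ : Λ.In v) : Function.Injective (ext μ) := by
  intro α β h
  have := ext_unique h rfl
  simpa using this

theorem exists_ext {v : Λ.Vertex} (ν : Λ.In v) (m : Fin k → ℕ) (h : m ≤ Λ.deg ν.2) :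
    ∃ (μ : Λ.In v) (α : Λ.In μ.1), ext μ α = ν ∧ Λ.deg μ.2 = m := by
  obtain ⟨p, hp, -⟩ := Λ.factorisation ν.2 m (Λ.deg ν.2 - m) (by
    rw [add_tsub_cancel_of_le h])
  exact ⟨⟨p.1, p.2.2⟩, ⟨ν.1, p.2.1⟩, by simp [ext, hp.1], hp.2.1⟩

section Carets

variable [Λ.RowFinite]

noncomputable def edges (v : Λ.Vertex) (i : Fin k) : Finset (Λ.In v) :=
  (RowFinite.finite v i).toFinset

theorem mem_edges {v : Λ.Vertex} {i : Fin k} {e : Λ.In v} :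
    e ∈ edges v i ↔ Λ.deg e.2 = Pi.single i 1 := by
  simp [edges, edgeSet]

open Classical in
/-- The basic caret `vΛ^{≤ e_i}`: all edges of colour `i` with range `v`, or the trivial caret
`{v}` if there are none. -/
noncomputable def caret (v : Λ.Vertex) (i : Fin k) : Finset (Λ.In v) :=
  if (edges v i).Nonempty then edges v i else {root v}

open Classical in
/-- The trees with root `v`, given by their sets of leaves: the trivial tree is `{v}`, and a tree
may be enlarged by replacing a leaf `μ` by all `μ ∘ e`, with `e` in a basic caret at the source
of `μ`. -/
inductive IsTree (v : Λ.Vertex) : Finset (Λ.In v) → Prop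
  | root : IsTree v {root v}
  | graft (t : Finset (Λ.In v)) (μ : Λ.In v) (i : Fin k) : IsTree v t → μ ∈ t →
      IsTree v (t.erase μ ∪ (caret μ.1 i).image (ext μ))

/-- The set `vΛ^{≤ m}` of the paths of degree at most `m` with range `v` that cannot be extended
within degree `m`. -/
def cutSet (v : Λ.Vertex) (m : Fin k → ℕ) : Set (Λ.In v) :=
  {ν | Λ.deg ν.2 ≤ m ∧ ∀ i, Λ.deg ν.2 i < m i → ¬ (edges ν.1 i).Nonempty}

theorem mem_caret {v : Λ.Vertex} {i : Fin k} {e : Λ.In v} :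
    e ∈ caret v i ↔ e ∈ edges v i ∨ (¬ (edges v i).Nonempty ∧ e = root v) := by
  unfold caret
  split_ifs with h <;> simp [h]
  rw [Finset.not_nonempty_iff_eq_empty] at h
  simp [h]

theorem deg_edge_add {v : Λ.Vertex} {ν : Λ.In v} {i : Fin k} {e : Λ.In ν.1}
    (he : e ∈ edges ν.1 i) : Λ.deg (ext ν e).2 = Λ.deg ν.2 + Pi.single i 1 := by
  rw [deg_ext, mem_edges.1 he]

/-- Edges can be commuted: if `e` is an edge into `v` and the source of `e` receives an edge of
colour `j`, so does `v`. -/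
theorem edges_nonempty_of_ext {v : Λ.Vertex} (ν : Λ.In v) {j : Fin k}
    (h : (edges ν.1 j).Nonempty) : (edges v j).Nonempty := by
  obtain ⟨f, hf⟩ := h
  obtain ⟨μ, α, -, hμ⟩ := exists_ext (ext ν f) (Pi.single j 1) (by
    rw [deg_edge_add hf]; exact le_add_self)
  exact ⟨μ, mem_edges.2 hμ⟩

theorem edges_nonempty_source [Λ.LocallyConvex] {v : Λ.Vertex} {i j : Fin k} (hij : i ≠ j)
    {e : Λ.In v} (he : e ∈ edges v i) (h : (edges v j).Nonempty) : (edges e.1 j).Nonempty := by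
  obtain ⟨f, hf⟩ := h
  have he' : e ∈ Λ.edgeSet v i := mem_edges.1 he
  have hf' : f ∈ Λ.edgeSet v j := mem_edges.1 hf
  rcases lt_or_gt_of_ne hij with hlt | hlt
  · obtain ⟨g, hg⟩ := (LocallyConvex.nonempty v i j hlt e he' f hf').1
    exact ⟨g, mem_edges.2 hg⟩
  · obtain ⟨g, hg⟩ := (LocallyConvex.nonempty v j i hlt f hf' e he').2
    exact ⟨g, mem_edges.2 hg⟩

theorem degree_induction {P : (Fin k → ℕ) → Prop} (h0 : P 0)
    (hs : ∀ m i, P m → P (m + Pi.single i 1)) (m : Fin k → ℕ) : P m := by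
  induction hn : ∑ i, m i generalizing m with
  | zero =>
    have : m = 0 := by
      funext i
      have := (Finset.sum_eq_zero_iff.1 hn) i (Finset.mem_univ i)
      simpa using this
    rwa [this]
  | succ n ih =>
    obtain ⟨i, hi⟩ : ∃ i, m i ≠ 0 := by
      by_contra! h
      simp [h] at hn
    have hle : (Pi.single i 1 : Fin k → ℕ) ≤ m := by
      intro j
      by_cases hj : j = i
      · subst hj; simp; omega
      · simp [hj]
    have hm : m - Pi.single i 1 + Pi.single i 1 = m := tsub_add_cancel_of_le hle
    rw [← hm]
    refine hs _ _ (ih _ ?_)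
    rw [← hm] at hn
    simp only [Pi.add_apply, Finset.sum_add_distrib] at hn
    simpa using hn

/-- A path without edges of colour `i` ends at a vertex that receives an edge of colour `i`
if its range does. -/
theorem edges_nonempty_of_deg_zero [Λ.LocallyConvex] {i : Fin k} (m : Fin k → ℕ) (hm : m i = 0) :
    ∀ {v : Λ.Vertex} (ν : Λ.In v), Λ.deg ν.2 = m → (edges v i).Nonempty →
      (edges ν.1 i).Nonempty := by
  induction m using degree_induction with
  | h0 =>
    intro v ν hν h
    have := ext_unique (μ := ν) (ν := root v) (α := root ν.1) (β := ν)
      (by rw [ext_root, root_ext]) (by rw [hν, deg_root])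
    obtain rfl : ν = root v := congrArg Sigma.fst this
    exact h
  | hs m j ih =>
    intro v ν hν h
    have hj : j ≠ i := by
      rintro rfl
      simp at hm
    obtain ⟨μ, α, rfl, hμ⟩ := exists_ext ν (Pi.single j 1) (by rw [hν]; exact le_add_self)
    have hα : Λ.deg α.2 = m := by
      rw [deg_ext, hμ, add_comm] at hν
      exact add_right_cancel hν
    exact ih (by simpa [hj.symm] using hm) α hα
      (edges_nonempty_source hj (mem_edges.2 hμ) h)

theorem ext_mem_cutSet [Λ.LocallyConvex] {v : Λ.Vertex} {m : Fin k → ℕ} {i : Fin k} {ν : Λ.In v}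
    (hν : ν ∈ cutSet v m) {e : Λ.In ν.1} (he : e ∈ caret ν.1 i) :
    ext ν e ∈ cutSet v (m + Pi.single i 1) := by
  rcases mem_caret.1 he with he | ⟨hn, rfl⟩
  · have hd := deg_edge_add he
    refine ⟨by rw [hd]; exact add_le_add_left hν.1 _, fun j hj hne => ?_⟩
    rw [hd] at hj
    have hj' : Λ.deg ν.2 j < m j := by simpa using hj
    exact hν.2 j hj' (edges_nonempty_of_ext e hne)
  · rw [ext_root]
    refine ⟨hν.1.trans le_self_add, fun j hj => ?_⟩
    by_cases hji : j = i
    · subst hji; exact hn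
    · exact hν.2 j (by simpa [hji] using hj)

theorem exists_of_mem_cutSet [Λ.LocallyConvex] {v : Λ.Vertex} {m : Fin k → ℕ} {i : Fin k}
    {ν : Λ.In v} (hν : ν ∈ cutSet v (m + Pi.single i 1)) :
    ∃ μ ∈ cutSet v m, ∃ e ∈ caret μ.1 i, ext μ e = ν := by
  by_cases hi : Λ.deg ν.2 i ≤ m i
  · have hn : ¬ (edges ν.1 i).Nonempty := hν.2 i (by simp; omega)
    refine ⟨ν, ⟨fun j => ?_, fun j hj => hν.2 j ?_⟩, root ν.1, mem_caret.2 (Or.inr ⟨hn, rfl⟩),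
      ext_root ν⟩
    · by_cases hji : j = i
      · subst hji; exact hi
      · simpa [hji] using hν.1 j
    · exact hj.trans_le (by simp)
  · have hi' : Λ.deg ν.2 i = m i + 1 := by
      have := hν.1 i
      simp at this
      omega
    have hle : (Pi.single i 1 : Fin k → ℕ) ≤ Λ.deg ν.2 := by
      intro j
      by_cases hji : j = i
      · subst hji; simp; omega
      · simp [hji]
    obtain ⟨μ, e, rfl, hμ⟩ := exists_ext ν (Λ.deg ν.2 - Pi.single i 1) tsub_le_self
    have he : e ∈ edges μ.1 i := by
      rw [mem_edges]
      have := deg_ext μ e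
      rw [hμ] at this
      nth_rewrite 1 [← tsub_add_cancel_of_le hle] at this
      exact (add_left_cancel this).symm
    have hd := deg_edge_add he
    refine ⟨μ, ⟨fun j => ?_, fun j hj hne => ?_⟩, e, mem_caret.2 (Or.inl he), rfl⟩
    · have := hν.1 j
      rw [hd] at this
      simpa using this
    · by_cases hji : j = i
      · subst hji
        rw [hd] at hi'
        simp at hi'
        omega
      · have hne' : (edges e.1 j).Nonempty := edges_nonempty_source (Ne.symm hji) he hne
        refine hν.2 j ?_ hne'
        rw [hd]
        simpa [hji] using hj

/-- Distinct elements of `vΛ^{≤ m}` have no common extension. -/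
theorem cutSet_ext_unique {v : Λ.Vertex} {m : Fin k → ℕ} {i : Fin k} {μ ν : Λ.In v}
    (hμ : μ ∈ cutSet v m) (hν : ν ∈ cutSet v m) {e : Λ.In μ.1} {f : Λ.In ν.1}
    (h : ext μ e = ext ν f) (he : e ∈ caret μ.1 i) (hf : f ∈ caret ν.1 i) :
    (⟨μ, e⟩ : Σ μ : Λ.In v, Λ.In μ.1) = ⟨ν, f⟩ := by
  refine ext_unique h ?_
  have hd : Λ.deg μ.2 + Λ.deg e.2 = Λ.deg ν.2 + Λ.deg f.2 := by
    rw [← deg_ext, ← deg_ext, h]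
  have key : ∀ {μ ν : Λ.In v}, μ ∈ cutSet v m → ν ∈ cutSet v m → ∀ {e : Λ.In μ.1} {f : Λ.In ν.1},
      e ∈ edges μ.1 i → f = root ν.1 → ¬ (Λ.deg μ.2 + Λ.deg e.2 = Λ.deg ν.2 + Λ.deg f.2) := by
    intro μ ν hμ hν e f he hf hd
    subst hf
    rw [mem_edges.1 he, deg_root, add_zero] at hd
    have h1 : ¬ Λ.deg μ.2 i < m i := fun hlt => hμ.2 i hlt ⟨e, he⟩
    have h2 := hν.1 i
    rw [← hd] at h2
    simp at h2
    omega
  rcases mem_caret.1 he with he | ⟨-, he⟩ <;> rcases mem_caret.1 hf with hf | ⟨-, hf⟩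
  · rw [mem_edges.1 he, mem_edges.1 hf] at hd
    exact add_right_cancel hd
  · exact absurd hd (key hμ hν he hf)
  · exact absurd hd.symm (key hν hμ hf he)
  · subst he; subst hf
    simpa [Λ.deg_id] using hd

theorem cutSet_finite [Λ.LocallyConvex] (v : Λ.Vertex) (m : Fin k → ℕ) : (cutSet v m).Finite := by
  induction m using degree_induction with
  | h0 =>
    refine (Set.finite_singleton (root v)).subset fun ν hν => ?_
    have hd : Λ.deg ν.2 = 0 := le_antisymm hν.1 bot_le
    have := ext_unique (μ := ν) (ν := root v) (α := root ν.1) (β := ν)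
      (by rw [ext_root, root_ext]) (by rw [hd, deg_root])
    exact congrArg Sigma.fst this
  | hs m i ih =>
    refine (ih.biUnion fun μ _ => ((caret μ.1 i).finite_toSet.image (ext μ))).subset ?_
    intro ν hν
    obtain ⟨μ, hμ, e, he, rfl⟩ := exists_of_mem_cutSet hν
    exact Set.mem_biUnion hμ ⟨e, he, rfl⟩

noncomputable def cut [Λ.LocallyConvex] (v : Λ.Vertex) (m : Fin k → ℕ) : Finset (Λ.In v) :=
  (cutSet_finite v m).toFinset

theorem mem_cut [Λ.LocallyConvex] {v : Λ.Vertex} {m : Fin k → ℕ} {ν : Λ.In v} :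
    ν ∈ cut v m ↔ ν ∈ cutSet v m := by simp [cut]

theorem sum_cut [Λ.LocallyConvex] {E : Type*} [AddCommMonoid E] (v : Λ.Vertex) (m : Fin k → ℕ)
    (i : Fin k) (F : Λ.In v → E) :
    ∑ ν ∈ cut v (m + Pi.single i 1), F ν = ∑ ν ∈ cut v m, ∑ e ∈ caret ν.1 i, F (ext ν e) := by
  rw [Finset.sum_sigma']
  symm
  refine Finset.sum_bij (fun p _ => ext p.1 p.2) ?_ ?_ ?_ ?_
  · rintro ⟨μ, e⟩ hp
    rw [Finset.mem_sigma, mem_cut] at hp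
    exact mem_cut.2 (ext_mem_cutSet hp.1 hp.2)
  · rintro ⟨μ, e⟩ hp ⟨ν, f⟩ hq h
    rw [Finset.mem_sigma, mem_cut] at hp hq
    exact cutSet_ext_unique hp.1 hq.1 h hp.2 hq.2
  · intro ν hν
    obtain ⟨μ, hμ, e, he, rfl⟩ := exists_of_mem_cutSet (mem_cut.1 hν)
    exact ⟨⟨μ, e⟩, Finset.mem_sigma.2 ⟨mem_cut.2 hμ, he⟩, rfl⟩
  · intros; rfl

end Carets

end KGraph

open KGraph

section Modules

variable {k : ℕ}

/-- A (nondegenerate) module over the non-self-adjoint algebra of a row-finite `k`-graph,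
given by the action `op f` of the generators `a_f`, one for each path `f`. -/
structure AMod (Λ : KGraph.{u} k) [Λ.RowFinite] where
  carrier : Type w
  [normedAddCommGroup : NormedAddCommGroup carrier]
  [innerProductSpace : InnerProductSpace ℂ carrier]
  [completeSpace : CompleteSpace carrier]
  op : ∀ {a b : Λ.Vertex}, (a ⟶ b) → (carrier →L[ℂ] carrier)
  isStarProjection_op : ∀ a : Λ.Vertex, IsStarProjection (op (𝟙 a))
  op_orthogonal : ∀ a b : Λ.Vertex, a ≠ b → op (𝟙 a) ∘L op (𝟙 b) = 0
  op_comp : ∀ {a b c : Λ.Vertex} (g : a ⟶ b) (f : b ⟶ c), op (g ≫ f) = op g ∘L op f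
  pythagoras : ∀ (v : Λ.Vertex) (i : Fin k), (edges v i).Nonempty →
    ∑ e ∈ edges v i, ContinuousLinearMap.adjoint (op e.2) ∘L op e.2 = op (𝟙 v)
  nondegenerate : ∀ ξ : carrier, HasSum (fun v : Λ.Vertex => op (𝟙 v) ξ) ξ

attribute [instance] AMod.normedAddCommGroup AMod.innerProductSpace AMod.completeSpace

/-- A (nondegenerate) representation of the C*-algebra of a row-finite `k`-graph, given by the
action `op f` of the generators `x_f`, one for each path `f`. -/
structure ORep (Λ : KGraph.{u} k) [Λ.RowFinite] where
  carrier : Type w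
  [normedAddCommGroup : NormedAddCommGroup carrier]
  [innerProductSpace : InnerProductSpace ℂ carrier]
  [completeSpace : CompleteSpace carrier]
  op : ∀ {a b : Λ.Vertex}, (a ⟶ b) → (carrier →L[ℂ] carrier)
  isStarProjection_op : ∀ a : Λ.Vertex, IsStarProjection (op (𝟙 a))
  op_orthogonal : ∀ a b : Λ.Vertex, a ≠ b → op (𝟙 a) ∘L op (𝟙 b) = 0
  adjoint_op_comp_op : ∀ {a b : Λ.Vertex} (f : a ⟶ b),
    ContinuousLinearMap.adjoint (op f) ∘L op f = op (𝟙 a)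
  sum_op_comp_adjoint : ∀ (v : Λ.Vertex) (i : Fin k), (edges v i).Nonempty →
    ∑ e ∈ edges v i, op e.2 ∘L ContinuousLinearMap.adjoint (op e.2) = op (𝟙 v)
  op_comp : ∀ {a b c : Λ.Vertex} (g : a ⟶ b) (f : b ⟶ c), op (g ≫ f) = op f ∘L op g
  nondegenerate : ∀ ξ : carrier, HasSum (fun v : Λ.Vertex => op (𝟙 v) ξ) ξ

attribute [instance] ORep.normedAddCommGroup ORep.innerProductSpace ORep.completeSpace

variable {Λ : KGraph.{u} k} [Λ.RowFinite]

instance : CoeSort (AMod.{u, w} Λ) (Type w) := ⟨AMod.carrier⟩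
instance : CoeSort (ORep.{u, w} Λ) (Type w) := ⟨ORep.carrier⟩

namespace AMod

variable (M : AMod.{u, w} Λ)

theorem op_id_comp {a b : Λ.Vertex} (f : a ⟶ b) (ξ : M) : M.op (𝟙 a) (M.op f ξ) = M.op f ξ := by
  have := M.op_comp (𝟙 a) f
  rw [Category.id_comp] at this
  exact (congrArg (fun T => T ξ) this).symm

theorem op_comp_id {a b : Λ.Vertex} (f : a ⟶ b) (ξ : M) : M.op f (M.op (𝟙 b) ξ) = M.op f ξ := by
  have := M.op_comp f (𝟙 b)
  rw [Category.comp_id] at this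
  exact (congrArg (fun T => T ξ) this).symm

theorem inner_op_id (v : Λ.Vertex) (ξ η : M) :
    ⟪M.op (𝟙 v) ξ, η⟫_ℂ = ⟪ξ, M.op (𝟙 v) η⟫_ℂ := by
  have h : ContinuousLinearMap.adjoint (M.op (𝟙 v)) = M.op (𝟙 v) :=
    (M.isStarProjection_op v).isSelfAdjoint
  conv_rhs => rw [← h]
  rw [ContinuousLinearMap.adjoint_inner_right]

theorem sum_caret_inner (v : Λ.Vertex) (i : Fin k) (ξ η : M) :
    ∑ e ∈ caret v i, ⟪M.op e.2 ξ, M.op e.2 η⟫_ℂ = ⟪M.op (𝟙 v) ξ, M.op (𝟙 v) η⟫_ℂ := by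
  unfold caret
  split_ifs with h
  · rw [M.inner_op_id, M.op_id_comp]
    conv_rhs => rw [← M.pythagoras v i h]
    simp [ContinuousLinearMap.adjoint_inner_right]
  · simp [root]

theorem hasSum_norm_sq (ξ : M) : HasSum (fun v => ‖M.op (𝟙 v) ξ‖ ^ 2) (‖ξ‖ ^ 2) := by
  have h := (M.nondegenerate ξ).mapL (innerSL ℂ ξ)
  have h2 := h.mapL Complex.reCLM
  have e1 : Complex.reCLM (innerSL ℂ ξ ξ) = ‖ξ‖ ^ 2 := by
    change RCLike.re ⟪ξ, ξ⟫_ℂ = _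
    rw [← norm_sq_eq_re_inner]
  rw [e1] at h2
  convert h2 using 2 with v
  change _ = RCLike.re ⟪ξ, M.op (𝟙 v) ξ⟫_ℂ
  rw [norm_sq_eq_re_inner (𝕜 := ℂ), inner_op_id, op_id_comp]

open Classical in
/-- `M.transfer μ ν` is `A_α` if `ν = μ ∘ α`, and `0` if `ν` does not extend `μ`. -/
noncomputable def transfer {v : Λ.Vertex} (μ ν : Λ.In v) : M →L[ℂ] M :=
  if h : ∃ α : Λ.In μ.1, ext μ α = ν then M.op h.choose.2 else 0

theorem transfer_ext {v : Λ.Vertex} (μ : Λ.In v) (α : Λ.In μ.1) :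
    M.transfer μ (ext μ α) = M.op α.2 := by
  have h : ∃ β : Λ.In μ.1, ext μ β = ext μ α := ⟨α, rfl⟩
  have h2 : h.choose = α := ext_injective μ h.choose_spec
  rw [transfer, dif_pos h]
  exact congrArg (fun γ : Λ.In μ.1 => M.op γ.2) h2

theorem transfer_eq_zero {v : Λ.Vertex} {μ ν : Λ.In v} (h : ∀ α : Λ.In μ.1, ext μ α ≠ ν) :
    M.transfer μ ν = 0 := by
  rw [transfer, dif_neg]
  rintro ⟨α, hα⟩
  exact h α hα

theorem op_id_transfer {v : Λ.Vertex} (μ ν : Λ.In v) (ξ : M) :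
    M.op (𝟙 ν.1) (M.transfer μ ν ξ) = M.transfer μ ν ξ := by
  by_cases h : ∃ α : Λ.In μ.1, ext μ α = ν
  · obtain ⟨α, rfl⟩ := h
    rw [transfer_ext]
    exact M.op_id_comp α.2 ξ
  · rw [M.transfer_eq_zero (fun α hα => h ⟨α, hα⟩)]
    simp

/-- The formal linear combinations of the decorated paths `(μ, ξ)`, with `μ` a path with range
`v`; a pair `(μ, ξ)` with arbitrary `ξ` stands for `(μ, A_{s(μ)} ξ)`. -/
def Formal (M : AMod.{u, w} Λ) (v : Λ.Vertex) : Type (max u w) := Λ.In v →₀ M.carrier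

namespace Formal

variable {M} {v : Λ.Vertex}

noncomputable instance : AddCommGroup (M.Formal v) := inferInstanceAs (AddCommGroup (Λ.In v →₀ M))
noncomputable instance : Module ℂ (M.Formal v) := inferInstanceAs (Module ℂ (Λ.In v →₀ M))

/-- The decorated path `(μ, ξ)`. -/
noncomputable def single (μ : Λ.In v) : M →ₗ[ℂ] M.Formal v := Finsupp.lsingle μ

/-- The component at `ν` of a formal linear combination after all decorated paths have been
moved up to `ν`: `x = ∑ (μ, ξ_μ)` is sent to the sum of the `A_α ξ_μ` with `ν = μ ∘ α`. -/
noncomputable def val (ν : Λ.In v) : M.Formal v →ₗ[ℂ] M :=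
  Finsupp.lsum ℂ (fun μ => (M.transfer μ ν : M →ₗ[ℂ] M))

/-- The coefficients of a formal linear combination. -/
def coeff (x : M.Formal v) : Λ.In v →₀ M.carrier := x

/-- The supremum of the degrees of the paths that occur in `x`. -/
noncomputable def height (x : M.Formal v) : Fin k → ℕ :=
  Finset.sup (coeff x).support (fun μ => Λ.deg μ.2)

theorem val_single (μ ν : Λ.In v) (ξ : M) : val ν (single μ ξ) = M.transfer μ ν ξ := by
  exact Finsupp.sum_single_index (map_zero _)

theorem val_apply (ν : Λ.In v) (x : M.Formal v) :
    val ν x = ∑ μ ∈ (coeff x).support, M.transfer μ ν (coeff x μ) := rfl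

theorem deg_le_height {x : M.Formal v} {μ : Λ.In v} (h : μ ∈ (coeff x).support) :
    Λ.deg μ.2 ≤ height x := Finset.le_sup (f := fun μ : Λ.In v => Λ.deg μ.2) h

open Classical in
theorem height_add_le (x y : M.Formal v) : height (x + y) ≤ height x ⊔ height y := by
  refine Finset.sup_le fun μ hμ => ?_
  have := Finsupp.support_add (g₁ := coeff x) (g₂ := coeff y) hμ
  rcases Finset.mem_union.1 this with h | h
  · exact (deg_le_height h).trans le_sup_left
  · exact (deg_le_height h).trans le_sup_right

theorem height_smul_le (c : ℂ) (x : M.Formal v) : height (c • x) ≤ height x :=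
  Finset.sup_mono (Finsupp.support_smul (b := c) (g := coeff x))

theorem height_single_le (μ : Λ.In v) (ξ : M) : height (single μ ξ) ≤ Λ.deg μ.2 := by
  refine Finset.sup_le fun ν hν => ?_
  have : ν ∈ ({μ} : Finset (Λ.In v)) := Finsupp.support_single_subset hν
  rw [Finset.mem_singleton.1 this]

theorem op_id_val (ν : Λ.In v) (x : M.Formal v) : M.op (𝟙 ν.1) (val ν x) = val ν x := by
  simp only [val_apply, map_sum, M.op_id_transfer]

theorem induction {P : M.Formal v → Prop} (h0 : P 0) (hs : ∀ μ ξ, P (single μ ξ))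
    (ha : ∀ x y, P x → P y → P (x + y)) (x : M.Formal v) : P x :=
  Finsupp.induction_linear (motive := P) x h0 (fun x y hx hy => ha x y hx hy) hs

/-- Moving up along a caret commutes with taking components, above the degrees that occur. -/
theorem val_ext {x : M.Formal v} {m : Fin k → ℕ} (hx : height x ≤ m) {ν : Λ.In v}
    (hν : ν ∈ cutSet v m) {i : Fin k} {e : Λ.In ν.1} (he : e ∈ caret ν.1 i) :
    val (ext ν e) x = M.op e.2 (val ν x) := by
  simp only [val_apply, map_sum]
  refine Finset.sum_congr rfl fun μ hμ => ?_
  have hμm : Λ.deg μ.2 ≤ m := (deg_le_height hμ).trans hx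
  by_cases h : ∃ α : Λ.In μ.1, ext μ α = ν
  · obtain ⟨α, rfl⟩ := h
    have h1 : ext (ext μ α) e = ext μ (ext α e) := ext_assoc μ α e
    rw [h1, transfer_ext, transfer_ext]
    exact DFunLike.congr_fun (M.op_comp e.2 α.2) _
  · rw [M.transfer_eq_zero (fun α hα => h ⟨α, hα⟩), M.transfer_eq_zero]
    · simp
    · intro α hα
      apply h
      have hle : Λ.deg μ.2 ≤ Λ.deg ν.2 := by
        have hd : Λ.deg μ.2 ≤ Λ.deg (ext ν e).2 := by
          rw [← hα, deg_ext]; exact le_self_add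
        rcases mem_caret.1 he with he | ⟨-, rfl⟩
        · intro j
          by_cases hj : j = i
          · subst hj
            have : ¬ Λ.deg ν.2 j < m j := fun hlt => hν.2 j hlt ⟨e, he⟩
            exact (hμm j).trans (not_lt.1 this)
          · have := hd j
            rw [deg_edge_add he] at this
            simpa [hj] using this
        · rwa [ext_root] at hd
      obtain ⟨μ', β, rfl, hμ'⟩ := exists_ext ν _ hle
      have h1 : ext μ α = ext μ' (ext β e) := hα.trans (ext_assoc μ' β e)
      obtain rfl : μ = μ' := congrArg Sigma.fst (ext_unique h1 hμ'.symm)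
      exact ⟨β, rfl⟩

/-- Prolonging all paths by `F`: the decorated path `(μ, ξ)` is sent to `(F ∘ μ, ξ)`. -/
noncomputable def shift (F : Λ.In v) : M.Formal F.1 →ₗ[ℂ] M.Formal v :=
  Finsupp.lmapDomain M ℂ (ext F)

theorem shift_single (F : Λ.In v) (μ : Λ.In F.1) (ξ : M) :
    shift F (single μ ξ) = single (ext F μ) ξ :=
  Finsupp.mapDomain_single

theorem val_ext_shift (F : Λ.In v) (ν : Λ.In F.1) (x : M.Formal F.1) :
    val (ext F ν) (shift F x) = val ν x := by
  induction x using Formal.induction with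
  | h0 => simp
  | ha x y hx hy => simp [hx, hy]
  | hs μ ξ =>
    rw [shift_single, val_single, val_single]
    by_cases h : ∃ α : Λ.In μ.1, ext μ α = ν
    · obtain ⟨α, rfl⟩ := h
      have h1 : ext F (ext μ α) = ext (ext F μ) α := (ext_assoc F μ α).symm
      rw [h1, transfer_ext, transfer_ext]
    · rw [M.transfer_eq_zero (fun α hα => h ⟨α, hα⟩), M.transfer_eq_zero]
      intro α hα
      have h1 : ext F (ext μ α) = ext F ν := (ext_assoc F μ α).symm.trans hα
      exact h ⟨α, ext_injective F h1⟩

theorem val_shift_eq_zero (F : Λ.In v) {ν : Λ.In v} (h : ∀ α : Λ.In F.1, ext F α ≠ ν)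
    (x : M.Formal F.1) : val ν (shift F x) = 0 := by
  induction x using Formal.induction with
  | h0 => simp
  | ha x y hx hy => simp [hx, hy]
  | hs μ ξ =>
    rw [shift_single, val_single, M.transfer_eq_zero]
    · simp
    · intro α hα
      exact h (ext μ α) ((ext_assoc F μ α).symm.trans hα)

open Classical in
theorem height_shift_le (F : Λ.In v) (x : M.Formal F.1) :
    height (shift F x) ≤ Λ.deg F.2 + height x := by
  refine Finset.sup_le fun ν hν => ?_
  have : ν ∈ (coeff x).support.image (ext F) := Finsupp.mapDomain_support hν
  obtain ⟨μ, hμ, rfl⟩ := Finset.mem_image.1 this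
  rw [deg_ext]
  exact add_le_add_right (deg_le_height hμ) _

variable [Λ.LocallyConvex]

/-- The inner product of the components of `x` and `y` in `vΛ^{≤ m}`. -/
noncomputable def levelForm (m : Fin k → ℕ) (x y : M.Formal v) : ℂ :=
  ∑ ν ∈ cut v m, ⟪val ν x, val ν y⟫_ℂ

theorem levelForm_succ {m : Fin k → ℕ} {x y : M.Formal v} (hx : height x ≤ m) (hy : height y ≤ m)
    (i : Fin k) : levelForm (m + Pi.single i 1) x y = levelForm m x y := by
  unfold levelForm
  rw [sum_cut]
  refine Finset.sum_congr rfl fun ν hν => ?_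
  rw [mem_cut] at hν
  rw [Finset.sum_congr rfl fun e he => by rw [val_ext hx hν he, val_ext hy hν he],
    M.sum_caret_inner, op_id_val, op_id_val]

theorem levelForm_mono {m n : Fin k → ℕ} (hmn : m ≤ n) {x y : M.Formal v} (hx : height x ≤ m)
    (hy : height y ≤ m) : levelForm n x y = levelForm m x y := by
  obtain ⟨p, rfl⟩ := exists_add_of_le hmn
  clear hmn
  induction p using degree_induction with
  | h0 => simp
  | hs p i ih =>
    rw [← add_assoc, levelForm_succ (hx.trans le_self_add) (hy.trans le_self_add), ih]

/-- The sesquilinear form: by the caret relations `x` and `y` are carried to a common level `m`,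
where decorated paths with different paths are orthogonal and those with the same path have the
inner product of their decorations. This does not depend on the level (`form_eq`). -/
noncomputable def form (x y : M.Formal v) : ℂ := levelForm (height x ⊔ height y) x y

theorem form_eq {m : Fin k → ℕ} {x y : M.Formal v} (hx : height x ≤ m) (hy : height y ≤ m) :
    form x y = levelForm m x y :=
  (levelForm_mono (sup_le hx hy) le_sup_left le_sup_right).symm

noncomputable instance core : PreInnerProductSpace.Core ℂ (M.Formal v) where
  inner := form
  conj_inner_symm x y := by
    rw [form_eq (m := height x ⊔ height y) le_sup_right le_sup_left,
      form_eq (m := height x ⊔ height y) le_sup_left le_sup_right]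
    simp [levelForm, map_sum]
  re_inner_nonneg x := by
    simp only [form, levelForm, map_sum]
    exact Finset.sum_nonneg fun ν _ => inner_self_nonneg
  add_left x y z := by
    have h := height_add_le x y
    change form _ _ = form _ _ + form _ _
    rw [form_eq (m := height x ⊔ height y ⊔ height z) (h.trans le_sup_left) le_sup_right,
      form_eq (m := height x ⊔ height y ⊔ height z) (le_sup_left.trans le_sup_left) le_sup_right,
      form_eq (m := height x ⊔ height y ⊔ height z) (le_sup_right.trans le_sup_left) le_sup_right]
    simp only [levelForm, map_add, inner_add_left, Finset.sum_add_distrib]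
  smul_left x y c := by
    change form _ _ = _ * form _ _
    rw [form_eq (m := height x ⊔ height y) ((height_smul_le c x).trans le_sup_left) le_sup_right,
      form_eq (m := height x ⊔ height y) le_sup_left le_sup_right]
    simp only [levelForm, map_smul, inner_smul_left, Finset.mul_sum]

noncomputable instance : SeminormedAddCommGroup (M.Formal v) :=
  InnerProductSpace.Core.toSeminormedAddCommGroup (𝕜 := ℂ)

noncomputable instance : InnerProductSpace ℂ (M.Formal v) := InnerProductSpace.ofCore core

theorem inner_def (x y : M.Formal v) : ⟪x, y⟫_ℂ = form x y := rfl

open Classical in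
theorem inner_shift_shift (F : Λ.In v) (x y : M.Formal F.1) :
    ⟪shift F x, shift F y⟫_ℂ = ⟪x, y⟫_ℂ := by
  set m := height x ⊔ height y
  have hx : height (shift F x) ≤ Λ.deg F.2 + m :=
    (height_shift_le F x).trans (add_le_add_right le_sup_left _)
  have hy : height (shift F y) ≤ Λ.deg F.2 + m :=
    (height_shift_le F y).trans (add_le_add_right le_sup_right _)
  rw [inner_def, inner_def, form_eq hx hy, form_eq (m := m) le_sup_left le_sup_right]
  unfold levelForm
  have hsub : (cut F.1 m).image (ext F) ⊆ cut v (Λ.deg F.2 + m) := by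
    intro ν hν
    obtain ⟨α, hα, rfl⟩ := Finset.mem_image.1 hν
    rw [mem_cut] at hα ⊢
    refine ⟨by rw [deg_ext]; exact add_le_add_right hα.1 _, fun i hi => hα.2 i ?_⟩
    rw [deg_ext] at hi
    simpa using hi
  rw [← Finset.sum_subset hsub, Finset.sum_image fun α _ β _ h => ext_injective F h]
  · simp only [val_ext_shift]
  · intro ν hν hn
    rw [val_shift_eq_zero F, inner_zero_left]
    rintro α rfl
    apply hn
    refine Finset.mem_image_of_mem _ ?_
    rw [mem_cut] at hν ⊢
    refine ⟨?_, fun i hi => hν.2 i ?_⟩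
    · have := hν.1
      rw [deg_ext] at this
      exact le_of_add_le_add_left this
    · rw [deg_ext]
      simpa using hi

theorem inner_shift_shift_of_ne {e f : Λ.In v} (hd : Λ.deg e.2 = Λ.deg f.2) (hef : e ≠ f)
    (x : M.Formal e.1) (y : M.Formal f.1) : ⟪shift e x, shift f y⟫_ℂ = 0 := by
  rw [inner_def]
  refine Finset.sum_eq_zero fun ν _ => ?_
  by_cases h : ∃ α : Λ.In e.1, ext e α = ν
  · obtain ⟨α, rfl⟩ := h
    rw [val_shift_eq_zero f, inner_zero_right]
    intro β hβ
    exact hef (congrArg Sigma.fst (ext_unique hβ.symm hd))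
  · rw [val_shift_eq_zero e (fun α hα => h ⟨α, hα⟩), inner_zero_left]

/-- Prolonging by `F`, as an isometry. -/
noncomputable def shiftIsometry (F : Λ.In v) : M.Formal F.1 →ₗᵢ[ℂ] M.Formal v :=
  (shift F).isometryOfInner (inner_shift_shift F)

theorem caret_relation (μ : Λ.In v) (i : Fin k) (ξ : M) :
    ‖single μ ξ - ∑ e ∈ caret μ.1 i, single (ext μ e) (M.op e.2 ξ)‖ = 0 := by
  set m : Fin k → ℕ := Λ.deg μ.2 + Pi.single i 1
  set z := single μ ξ - ∑ e ∈ caret μ.1 i, single (ext μ e) (M.op e.2 ξ) with hz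
  suffices h : ⟪z, z⟫_ℂ = 0 by
    rw [inner_self_eq_norm_sq_to_K] at h
    simpa using h
  rw [inner_def, form_eq (m := m ⊔ height z) le_sup_right le_sup_right]
  refine Finset.sum_eq_zero fun ν hν => ?_
  rw [mem_cut] at hν
  have hm : m ≤ m ⊔ height z := le_sup_left
  generalize m ⊔ height z = n at hν hm
  suffices h : val ν z = 0 by rw [h, inner_zero_left]
  simp only [hz, map_sub, map_sum, val_single, sub_eq_zero]
  by_cases h : ∃ α : Λ.In μ.1, ext μ α = ν
  · obtain ⟨α, rfl⟩ := h
    obtain ⟨e, he, β, rfl⟩ : ∃ e ∈ caret μ.1 i, ∃ β : Λ.In e.1, ext e β = α := by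
      by_cases hne : (edges μ.1 i).Nonempty
      · have hle : (Pi.single i 1 : Fin k → ℕ) ≤ Λ.deg α.2 := by
          intro j
          by_cases hj : j = i
          · subst hj
            by_contra hlt
            have h0 : Λ.deg α.2 j = 0 := by simpa using hlt
            refine hν.2 j ?_ (edges_nonempty_of_deg_zero _ h0 α rfl hne)
            have := hm j
            rw [deg_ext]
            simp only [m, Pi.add_apply, Pi.single_eq_same] at this ⊢
            omega
          · simp [hj]
        obtain ⟨e, β, h1, h2⟩ := exists_ext α _ hle
        exact ⟨e, mem_caret.2 (Or.inl (mem_edges.2 h2)), β, h1⟩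
      · exact ⟨root μ.1, mem_caret.2 (Or.inr ⟨hne, rfl⟩), α, root_ext α⟩
    rw [Finset.sum_eq_single_of_mem e he]
    · have h1 : ext μ (ext e β) = ext (ext μ e) β := (ext_assoc μ e β).symm
      conv_rhs => rw [h1, transfer_ext]
      rw [transfer_ext]
      exact DFunLike.congr_fun (M.op_comp β.2 e.2) ξ
    · intro f hf hfe
      rw [M.transfer_eq_zero]
      · simp
      · intro γ hγ
        have h1 : ext μ (ext f γ) = ext μ (ext e β) := (ext_assoc μ f γ).symm.trans hγ
        have h2 := ext_injective μ h1
        refine hfe (congrArg Sigma.fst (ext_unique h2 ?_))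
        rcases mem_caret.1 he with he | ⟨hn, rfl⟩ <;> rcases mem_caret.1 hf with hf | ⟨hn', rfl⟩
        · rw [mem_edges.1 he, mem_edges.1 hf]
        · exact absurd ⟨e, he⟩ hn'
        · exact absurd ⟨f, hf⟩ hn
        · rfl
  · rw [M.transfer_eq_zero (fun α hα => h ⟨α, hα⟩)]
    refine (Finset.sum_eq_zero fun e _ => ?_).symm
    rw [M.transfer_eq_zero]
    · simp
    · intro γ hγ
      exact h ⟨ext e γ, (ext_assoc μ e γ).symm.trans hγ⟩

theorem inner_single_single (μ : Λ.In v) (ξ η : M) :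
    ⟪single μ ξ, single μ η⟫_ℂ = ⟪M.op (𝟙 μ.1) ξ, M.op (𝟙 μ.1) η⟫_ℂ := by
  have h : ∀ ζ : M, single μ ζ = shift μ (single (root μ.1) ζ) := fun ζ => by
    rw [shift_single, ext_root]
  rw [h, h, inner_shift_shift, inner_def]
  have hr : ∀ ζ : M, height (single (root μ.1) ζ) ≤ 0 := fun ζ =>
    (height_single_le _ _).trans (deg_root _).le
  rw [form_eq (hr ξ) (hr η), levelForm]
  have hc : cut μ.1 (0 : Fin k → ℕ) = {root μ.1} := by
    ext ν
    rw [mem_cut, Finset.mem_singleton]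
    refine ⟨fun hν => ?_, ?_⟩
    · have hd : Λ.deg ν.2 = 0 := le_antisymm hν.1 bot_le
      exact congrArg Sigma.fst (ext_unique (μ := ν) (ν := root μ.1) (α := root ν.1) (β := ν)
        (by rw [ext_root, root_ext]) (by rw [hd, deg_root]))
    · rintro rfl
      exact ⟨(deg_root _).le, fun i hi => absurd hi (by simp)⟩
  rw [hc, Finset.sum_singleton, val_single, val_single]
  have ht : M.transfer (root μ.1) (root μ.1) = M.op (𝟙 μ.1) := by
    have := M.transfer_ext (root μ.1) (root μ.1)
    have h1 : ext (root μ.1) (root μ.1) = root μ.1 := root_ext _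
    rwa [h1] at this
  rw [ht]

end Formal

variable [Λ.LocallyConvex]

/-- The Hilbert space spanned by the vectors `[μ, ξ]` with `μ` a path with range `v`. -/
abbrev Fiber (v : Λ.Vertex) : Type (max u w) := UniformSpace.Completion (M.Formal v)

variable {M}

/-- The vector `[μ, ξ]`; for arbitrary `ξ` this is `[μ, A_{s(μ)} ξ]`. -/
noncomputable def vec {v : Λ.Vertex} (μ : Λ.In v) : M →ₗ[ℂ] M.Fiber v :=
  (UniformSpace.Completion.toComplₗᵢ (𝕜 := ℂ)).toLinearMap ∘ₗ Formal.single μ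

noncomputable def fiberShift {v : Λ.Vertex} (F : Λ.In v) : M.Fiber F.1 →L[ℂ] M.Fiber v :=
  (Formal.shiftIsometry F).toContinuousLinearMap.completion

theorem fiberShift_coe {v : Λ.Vertex} (F : Λ.In v) (x : M.Formal F.1) :
    fiberShift F (x : M.Fiber F.1) = ((Formal.shift F x : M.Formal v) : M.Fiber v) :=
  ContinuousLinearMap.completion_apply_coe _ _

theorem fiberShift_vec {v : Λ.Vertex} (F : Λ.In v) (μ : Λ.In F.1) (ξ : M) :
    fiberShift F (vec μ ξ) = vec (ext F μ) ξ := by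
  change fiberShift F ((Formal.single μ ξ : M.Formal F.1) : M.Fiber F.1) = _
  rw [fiberShift_coe, Formal.shift_single]
  rfl

theorem fiber_induction {v : Λ.Vertex} {E : Type*} [NormedAddCommGroup E] [NormedSpace ℂ E]
    {S T : M.Fiber v →L[ℂ] E} (h : ∀ μ ξ, S (vec μ ξ) = T (vec μ ξ)) : S = T := by
  ext x
  induction x using UniformSpace.Completion.induction_on with
  | hp => exact isClosed_eq S.continuous T.continuous
  | ih x =>
    induction x using Formal.induction with
    | h0 => rw [UniformSpace.Completion.coe_zero, map_zero, map_zero]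
    | hs μ ξ => exact h μ ξ
    | ha x y hx hy => rw [UniformSpace.Completion.coe_add, map_add, map_add, hx, hy]

theorem inner_fiberShift {v : Λ.Vertex} (F : Λ.In v) (x y : M.Fiber F.1) :
    ⟪fiberShift F x, fiberShift F y⟫_ℂ = ⟪x, y⟫_ℂ := by
  induction x, y using UniformSpace.Completion.induction_on₂ with
  | hp => exact isClosed_eq (by fun_prop) (by fun_prop)
  | ih x y =>
    rw [fiberShift_coe, fiberShift_coe, UniformSpace.Completion.inner_coe,
      UniformSpace.Completion.inner_coe, Formal.inner_shift_shift]

theorem inner_fiberShift_of_ne {v : Λ.Vertex} {e f : Λ.In v} (hd : Λ.deg e.2 = Λ.deg f.2)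
    (hef : e ≠ f) (x : M.Fiber e.1) (y : M.Fiber f.1) :
    ⟪fiberShift e x, fiberShift f y⟫_ℂ = 0 := by
  induction x, y using UniformSpace.Completion.induction_on₂ with
  | hp => exact isClosed_eq (by fun_prop) (by fun_prop)
  | ih x y =>
    rw [fiberShift_coe, fiberShift_coe, UniformSpace.Completion.inner_coe,
      Formal.inner_shift_shift_of_ne hd hef]

theorem fiberShift_root (v : Λ.Vertex) :
    fiberShift (M := M) (root v) = ContinuousLinearMap.id ℂ (M.Fiber v) := by
  refine fiber_induction fun μ ξ => ?_
  have h : ext (root v) μ = μ := root_ext μ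
  rw [fiberShift_vec, h]
  rfl

theorem fiberShift_ext {v : Λ.Vertex} (F : Λ.In v) (G : Λ.In F.1) :
    fiberShift (M := M) (ext F G) = fiberShift F ∘L fiberShift G := by
  refine fiber_induction fun μ ξ => ?_
  rw [fiberShift_vec, ContinuousLinearMap.comp_apply]
  erw [fiberShift_vec, fiberShift_vec]
  exact congrArg (fun ν => vec ν ξ) (ext_assoc F G μ)

theorem vec_caret {v : Λ.Vertex} (μ : Λ.In v) (i : Fin k) (ξ : M) :
    vec μ ξ = ∑ e ∈ caret μ.1 i, vec (ext μ e) (M.op e.2 ξ) := by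
  have h := Formal.caret_relation μ i ξ
  rw [← UniformSpace.Completion.norm_coe, norm_eq_zero,
    UniformSpace.Completion.coe_sub, sub_eq_zero] at h
  refine h.trans ?_
  exact map_sum (UniformSpace.Completion.toComplₗᵢ (𝕜 := ℂ) (E := M.Formal v)) _ _

theorem adjoint_fiberShift {v : Λ.Vertex} (F : Λ.In v) (x : M.Fiber F.1) :
    ContinuousLinearMap.adjoint (fiberShift F) (fiberShift F x) = x := by
  refine ext_inner_left ℂ fun y => ?_
  rw [ContinuousLinearMap.adjoint_inner_right, inner_fiberShift]

theorem adjoint_fiberShift_of_ne {v : Λ.Vertex} {e f : Λ.In v} (hd : Λ.deg e.2 = Λ.deg f.2)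
    (hef : e ≠ f) (y : M.Fiber f.1) :
    ContinuousLinearMap.adjoint (fiberShift e) (fiberShift f y) = 0 := by
  refine ext_inner_left ℂ fun x => ?_
  rw [ContinuousLinearMap.adjoint_inner_right, inner_fiberShift_of_ne hd hef, inner_zero_right]

theorem sum_fiberShift (v : Λ.Vertex) (i : Fin k) (hne : (edges v i).Nonempty) :
    ∑ e ∈ edges v i, fiberShift (M := M) e ∘L ContinuousLinearMap.adjoint (fiberShift e) =
      ContinuousLinearMap.id ℂ (M.Fiber v) := by
  set T : M.Fiber v →L[ℂ] M.Fiber v :=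
    ∑ e ∈ edges v i, fiberShift (M := M) e ∘L ContinuousLinearMap.adjoint (fiberShift e) with hT
  have key : ∀ e ∈ edges v i, ∀ x : M.Fiber e.1, T (fiberShift e x) = fiberShift e x := by
    intro e he x
    have : T (fiberShift e x) = ∑ f ∈ edges v i, fiberShift f
        (ContinuousLinearMap.adjoint (fiberShift f) (fiberShift e x)) := by
      simp [hT]
    rw [this, Finset.sum_eq_single_of_mem e he, adjoint_fiberShift]
    intro f hf hfe
    rw [adjoint_fiberShift_of_ne _ hfe, map_zero]
    rw [mem_edges.1 he, mem_edges.1 hf]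
  have long : ∀ (μ : Λ.In v) (ξ : M), Λ.deg μ.2 i ≠ 0 → T (vec μ ξ) = vec μ ξ := by
    intro μ ξ hμ
    have hle : (Pi.single i 1 : Fin k → ℕ) ≤ Λ.deg μ.2 := by
      intro j
      by_cases hj : j = i
      · subst hj; simp; omega
      · simp [hj]
    obtain ⟨e, α, rfl, he⟩ := exists_ext μ _ hle
    rw [← fiberShift_vec]
    exact key e (mem_edges.2 he) _
  refine fiber_induction fun μ ξ => ?_
  by_cases hμ : Λ.deg μ.2 i = 0
  · have hne' : (edges μ.1 i).Nonempty := edges_nonempty_of_deg_zero _ hμ μ rfl hne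
    rw [vec_caret μ i ξ, map_sum, map_sum]
    refine Finset.sum_congr rfl fun e he => long _ _ ?_
    rcases mem_caret.1 he with he | ⟨hn, -⟩
    · rw [deg_edge_add he]; simp
    · exact absurd hne' hn
  · exact long μ ξ hμ

variable (M)

/-- The carrier of the dilation `Π(M)`: the Hilbert direct sum over all vertices `v` of the
closed spans of the `[μ, ξ]` with `μ` of range `v`. -/
abbrev Dilation : Type (max u w) := lp (fun v : Λ.Vertex => M.Fiber v) 2

open Classical in
noncomputable def incl (v : Λ.Vertex) : M.Fiber v →L[ℂ] M.Dilation :=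
  lp.singleContinuousLinearMap ℂ (fun v : Λ.Vertex => M.Fiber v) 2 v

noncomputable def proj (v : Λ.Vertex) : M.Dilation →L[ℂ] M.Fiber v :=
  lp.evalCLM ℂ (fun v : Λ.Vertex => M.Fiber v) 2 v

/-- The operator `X_f` with `X_f [μ, ξ] = [f ∘ μ, ξ]` if the range of `μ` is the source of `f`,
and `X_f [μ, ξ] = 0` otherwise. -/
noncomputable def dilOp {a b : Λ.Vertex} (f : a ⟶ b) : M.Dilation →L[ℂ] M.Dilation :=
  M.incl b ∘L fiberShift (⟨a, f⟩ : Λ.In b) ∘L M.proj a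

theorem proj_incl (v : Λ.Vertex) (x : M.Fiber v) : M.proj v (M.incl v x) = x := by
  classical
  exact lp.single_apply_self 2 v x

theorem proj_incl_of_ne {v w : Λ.Vertex} (h : w ≠ v) (x : M.Fiber v) :
    M.proj w (M.incl v x) = 0 := by
  classical
  exact lp.single_apply_ne 2 v x h

theorem adjoint_incl (v : Λ.Vertex) : ContinuousLinearMap.adjoint (M.incl v) = M.proj v := by
  classical
  refine ((ContinuousLinearMap.eq_adjoint_iff _ _).2 fun x y => ?_).symm
  exact (lp.inner_single_right v y x).symm

theorem adjoint_proj (v : Λ.Vertex) : ContinuousLinearMap.adjoint (M.proj v) = M.incl v := by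
  rw [← adjoint_incl, ContinuousLinearMap.adjoint_adjoint]

theorem adjoint_dilOp {a b : Λ.Vertex} (f : a ⟶ b) :
    ContinuousLinearMap.adjoint (M.dilOp f) =
      M.incl a ∘L ContinuousLinearMap.adjoint (fiberShift (⟨a, f⟩ : Λ.In b)) ∘L M.proj b := by
  rw [dilOp, ContinuousLinearMap.adjoint_comp, ContinuousLinearMap.adjoint_comp, adjoint_incl,
    adjoint_proj, ContinuousLinearMap.comp_assoc]

theorem dilOp_id (v : Λ.Vertex) : M.dilOp (𝟙 v) = M.incl v ∘L M.proj v := by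
  have h : fiberShift (M := M) (⟨v, 𝟙 v⟩ : Λ.In v) = ContinuousLinearMap.id ℂ _ :=
    fiberShift_root v
  rw [dilOp, h, ContinuousLinearMap.id_comp]

/-- The representation `Π(M)` of the C*-algebra of the `k`-graph. -/
noncomputable def dilation : ORep.{u, max u w} Λ where
  carrier := M.Dilation
  op := fun f => M.dilOp f
  isStarProjection_op v := by
    constructor
    · rw [dilOp_id]
      ext1 x
      simp [proj_incl]
    · rw [dilOp_id]
      change ContinuousLinearMap.adjoint _ = _
      rw [ContinuousLinearMap.adjoint_comp, adjoint_incl, adjoint_proj]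
  op_orthogonal a b hab := by
    rw [dilOp_id, dilOp_id]
    ext1 x
    simp [proj_incl_of_ne M hab]
  adjoint_op_comp_op f := by
    rw [adjoint_dilOp, dilOp, dilOp_id]
    ext1 x
    simp only [ContinuousLinearMap.comp_apply, proj_incl]
    exact congrArg (M.incl _) (adjoint_fiberShift (⟨_, f⟩ : Λ.In _) _)
  sum_op_comp_adjoint v i hne := by
    rw [dilOp_id]
    ext1 x
    have h := DFunLike.congr_fun (sum_fiberShift (M := M) v i hne) (M.proj v x)
    have h2 := congrArg (M.incl v) h
    simp only [sum_apply, map_sum, ContinuousLinearMap.comp_apply,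
      ContinuousLinearMap.id_apply] at h2 ⊢
    rw [← h2]
    refine Finset.sum_congr rfl fun e _ => ?_
    rw [adjoint_dilOp, dilOp]
    simp only [ContinuousLinearMap.comp_apply, proj_incl]
  op_comp g f := by
    ext1 x
    have h : fiberShift (M := M) (⟨_, g ≫ f⟩ : Λ.In _) =
        fiberShift (⟨_, f⟩ : Λ.In _) ∘L fiberShift (⟨_, g⟩ : Λ.In _) :=
      fiberShift_ext ⟨_, f⟩ ⟨_, g⟩
    simp only [dilOp, ContinuousLinearMap.comp_apply, proj_incl, h]
  nondegenerate x := by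
    classical
    have h := lp.hasSum_single (p := 2) (by simp) x
    convert h using 2 with v
    rw [dilOp_id]
    rfl

/-- The vector `[μ, ξ]` of `Π(M)`. -/
noncomputable def dilVec {v : Λ.Vertex} (μ : Λ.In v) (ξ : M) : M.dilation :=
  M.incl v (vec μ ξ)

theorem dilOp_dilVec {a b : Λ.Vertex} (f : a ⟶ b) (μ : Λ.In a) (ξ : M) :
    M.dilation.op f (M.dilVec μ ξ) = M.dilVec (ext (⟨a, f⟩ : Λ.In b) μ) ξ := by
  change M.incl b (fiberShift (⟨a, f⟩ : Λ.In b) (M.proj a (M.incl a (vec μ ξ)))) = _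
  rw [proj_incl]
  exact congrArg (M.incl b) (fiberShift_vec (⟨a, f⟩ : Λ.In b) μ ξ)

theorem norm_vec_root (v : Λ.Vertex) (ξ : M) : ‖vec (root v) ξ‖ = ‖M.op (𝟙 v) ξ‖ := by
  have h := Formal.inner_single_single (root v) ξ ξ
  rw [← UniformSpace.Completion.inner_coe] at h
  change ⟪vec (root v) ξ, vec (root v) ξ⟫_ℂ = _ at h
  rw [inner_self_eq_norm_sq_to_K, inner_self_eq_norm_sq_to_K] at h
  have h2 : ‖vec (root v) ξ‖ ^ 2 = ‖M.op (𝟙 v) ξ‖ ^ 2 := by exact_mod_cast h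
  exact (sq_eq_sq₀ (norm_nonneg _) (norm_nonneg _)).1 h2

/-- The element of the Hilbert direct sum with the components `[v, ξ]`. -/
noncomputable def rootVec (ξ : M) : M.Dilation :=
  ⟨fun v => vec (root v) ξ, by
    refine memℓp_gen ?_
    simpa [norm_vec_root] using (M.hasSum_norm_sq ξ).summable⟩

theorem norm_rootVec (ξ : M) : ‖M.rootVec ξ‖ = ‖ξ‖ := by
  refine (sq_eq_sq₀ (norm_nonneg _) (norm_nonneg _)).1 ?_
  rw [← (M.hasSum_norm_sq ξ).tsum_eq]
  have h := lp.norm_rpow_eq_tsum (p := 2) (by simp) (M.rootVec ξ)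
  simpa [rootVec, norm_vec_root] using h

/-- The canonical isometry `J : M → Π(M)`, `J ξ = [v, ξ]` for `ξ` in the range of `A_v`. -/
noncomputable def toDilation : M →ₗᵢ[ℂ] M.dilation where
  toFun ξ := M.rootVec ξ
  map_add' ξ η := lp.ext (funext fun v => map_add (vec (root v)) ξ η)
  map_smul' c ξ := lp.ext (funext fun v => map_smul (vec (root v)) c ξ)
  norm_map' ξ := M.norm_rootVec ξ

theorem toDilation_apply (v : Λ.Vertex) (ξ : M) (hξ : M.op (𝟙 v) ξ = ξ) :
    M.toDilation ξ = M.dilVec (root v) ξ := by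
  classical
  refine lp.ext (funext fun w => ?_)
  by_cases h : w = v
  · subst h
    exact (M.proj_incl w _).symm
  · refine Eq.trans ?_ (M.proj_incl_of_ne h _).symm
    change vec (root w) ξ = 0
    rw [← norm_eq_zero, norm_vec_root, ← hξ]
    have := DFunLike.congr_fun (M.op_orthogonal w v h) ξ
    simpa using this

end AMod

/-! ### Modules from representations, submodules and direct sums -/

/-- The forgetful functor: a representation is a module through `a_f ↦ x_f^*`. -/
noncomputable def ORep.toAMod (L : ORep.{u, w} Λ) : AMod.{u, w} Λ where
  carrier := L.carrier
  op f := ContinuousLinearMap.adjoint (L.op f)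
  isStarProjection_op v := by
    have h : ContinuousLinearMap.adjoint (L.op (𝟙 v)) = L.op (𝟙 v) :=
      (L.isStarProjection_op v).isSelfAdjoint
    rw [h]
    exact L.isStarProjection_op v
  op_orthogonal a b hab := by
    rw [← ContinuousLinearMap.adjoint_comp, L.op_orthogonal b a hab.symm, map_zero]
  op_comp g f := by
    rw [L.op_comp, ContinuousLinearMap.adjoint_comp]
  pythagoras v i hne := by
    have h : ContinuousLinearMap.adjoint (L.op (𝟙 v)) = L.op (𝟙 v) :=
      (L.isStarProjection_op v).isSelfAdjoint
    simp only [ContinuousLinearMap.adjoint_adjoint]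
    rw [h, L.sum_op_comp_adjoint v i hne]
  nondegenerate ξ := by
    have h : ∀ v, ContinuousLinearMap.adjoint (L.op (𝟙 v)) = L.op (𝟙 v) := fun v =>
      (L.isStarProjection_op v).isSelfAdjoint
    simp only [h]
    exact L.nondegenerate ξ

namespace AMod

variable (M : AMod.{u, w} Λ)

/-- The submodules: closed subspaces that are invariant under all `A_f`. -/
structure IsSubmodule (S : Submodule ℂ M) : Prop where
  isClosed : IsClosed (S : Set M)
  op_mem : ∀ {a b : Λ.Vertex} (f : a ⟶ b), ∀ ξ ∈ S, M.op f ξ ∈ S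

/-- A submodule as a module. -/
noncomputable def restrict (S : Submodule ℂ M) (hS : M.IsSubmodule S) : AMod.{u, w} Λ :=
  haveI : CompleteSpace S := hS.isClosed.completeSpace_coe
  { carrier := S
    op := fun f => ((M.op f).comp S.subtypeL).codRestrict S fun ξ => hS.op_mem f ξ ξ.2
    isStarProjection_op := fun v => by
      constructor
      · ext ξ
        exact M.op_id_comp (𝟙 v) (ξ : M)
      · refine ((ContinuousLinearMap.eq_adjoint_iff _ _).2 fun ξ η => ?_).symm
        exact M.inner_op_id v ξ η
    op_orthogonal := fun a b hab => by
      ext ξ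
      exact DFunLike.congr_fun (M.op_orthogonal a b hab) (ξ : M)
    op_comp := fun g f => by
      ext ξ
      exact DFunLike.congr_fun (M.op_comp g f) (ξ : M)
    pythagoras := fun v i hne => by
      ext1 ξ
      refine ext_inner_left ℂ fun η => ?_
      have h := congrArg (fun T => ⟪(η : M), T (ξ : M)⟫_ℂ) (M.pythagoras v i hne)
      simp only [sum_apply, inner_sum, ContinuousLinearMap.comp_apply,
        ContinuousLinearMap.adjoint_inner_right] at h ⊢
      exact h
    nondegenerate := fun ξ => by
      exact (Topology.IsInducing.hasSum_iff (g := S.subtype) Topology.IsInducing.subtypeVal _ _).1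
        (M.nondegenerate (ξ : M)) }

end AMod

/-- The direct sum of finitely many representations. -/
noncomputable def ORep.directSum {n : ℕ} (L : Fin n → ORep.{u, w} Λ) : ORep.{u, w} Λ :=
  let D : (∀ i, L i →L[ℂ] L i) → (PiLp 2 (fun i => L i) →L[ℂ] PiLp 2 (fun i => L i)) := fun T =>
    (PiLp.continuousLinearEquiv 2 ℂ (fun i => (L i).carrier)).symm.toContinuousLinearMap ∘L
      ContinuousLinearMap.piMap T ∘L
        (PiLp.continuousLinearEquiv 2 ℂ (fun i => (L i).carrier)).toContinuousLinearMap
  have hadj : ∀ T : ∀ i, L i →L[ℂ] L i, ContinuousLinearMap.adjoint (D T) =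
      D fun i => ContinuousLinearMap.adjoint (T i) := fun T => by
    refine ((ContinuousLinearMap.eq_adjoint_iff _ _).2 fun x y => ?_).symm
    simp [PiLp.inner_apply, D, ContinuousLinearMap.adjoint_inner_left]
  have hmul : ∀ S T : ∀ i, L i →L[ℂ] L i, D S ∘L D T = D fun i => S i ∘L T i := fun S T => by
    ext x i
    simp [D]
  { carrier := PiLp 2 (fun i => (L i).carrier)
    op := fun f => D fun i => (L i).op f
    isStarProjection_op := fun v => by
      constructor
      · refine (hmul _ _).trans ?_
        exact congrArg D (funext fun i => ((L i).isStarProjection_op v).isIdempotentElem)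
      · refine (hadj _).trans ?_
        exact congrArg D (funext fun i => ((L i).isStarProjection_op v).isSelfAdjoint)
    op_orthogonal := fun a b hab => by
      rw [hmul]
      simp only [(L _).op_orthogonal a b hab]
      ext x i
      simp [D]
    adjoint_op_comp_op := fun f => by
      rw [hadj, hmul]
      simp only [(L _).adjoint_op_comp_op]
    sum_op_comp_adjoint := fun v i hne => by
      simp only [hadj, hmul]
      ext x j
      have h := DFunLike.congr_fun ((L j).sum_op_comp_adjoint v i hne) (x j)
      simpa [D] using h
    op_comp := fun g f => by
      rw [hmul]
      simp only [(L _).op_comp]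
    nondegenerate := fun x => by
      rw [← (PiLp.continuousLinearEquiv 2 ℂ (fun i => (L i).carrier)).hasSum',
        Pi.hasSum]
      intro i
      exact (L i).nondegenerate (x i) }

/-! ### The notions of the theorem -/

namespace ORep

/-- Isomorphism of representations: an invertible bounded operator that intertwines the actions
of the generators and of their adjoints. -/
def Iso (L : ORep.{u, w} Λ) (L' : ORep.{u, w} Λ) : Prop :=
  ∃ θ : L ≃L[ℂ] L', ∀ {a b : Λ.Vertex} (f : a ⟶ b) (ξ : L),
    θ (L.op f ξ) = L'.op f (θ ξ) ∧
      θ (ContinuousLinearMap.adjoint (L.op f) ξ) = ContinuousLinearMap.adjoint (L'.op f) (θ ξ)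

/-- The subrepresentations: closed subspaces that are invariant under the generators and their
adjoints. -/
structure IsSubrep (L : ORep.{u, w} Λ) (S : Submodule ℂ L) : Prop where
  isClosed : IsClosed (S : Set L)
  op_mem : ∀ {a b : Λ.Vertex} (f : a ⟶ b), ∀ ξ ∈ S, L.op f ξ ∈ S
  adjoint_mem : ∀ {a b : Λ.Vertex} (f : a ⟶ b), ∀ ξ ∈ S,
    ContinuousLinearMap.adjoint (L.op f) ξ ∈ S

def IsIrreducible (L : ORep.{u, w} Λ) : Prop :=
  Nontrivial L ∧ ∀ S : Submodule ℂ L, L.IsSubrep S → S = ⊥ ∨ S = ⊤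

end ORep

namespace AMod

/-- Morphisms of modules: bounded operators that intertwine the `A_f` (but not necessarily their
adjoints). -/
def IsHom {M N : AMod.{u, w} Λ} (θ : M →L[ℂ] N) : Prop :=
  ∀ {a b : Λ.Vertex} (f : a ⟶ b) (ξ : M), θ (M.op f ξ) = N.op f (θ ξ)

def Iso (M N : AMod.{u, w} Λ) : Prop :=
  ∃ θ : M ≃L[ℂ] N, IsHom (θ : M →L[ℂ] N)

def IsIrreducible (M : AMod.{u, w} Λ) : Prop :=
  Nontrivial M ∧ ∀ S : Submodule ℂ M, M.IsSubmodule S → S = ⊥ ∨ S = ⊤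

variable (M : AMod.{u, w} Λ)

/-- A subspace is residual if it contains no nonzero submodule. -/
def IsResidual (Z : Submodule ℂ M) : Prop :=
  ∀ S : Submodule ℂ M, M.IsSubmodule S → S ≤ Z → S = ⊥

/-- Complete submodules: along a suitable tree every vector `ξ` in the range of some `A_v` comes
arbitrarily close to the submodule. -/
structure IsComplete (S : Submodule ℂ M) : Prop where
  isSubmodule : M.IsSubmodule S
  approx : ∀ ε : ℝ, 0 < ε → ∀ (v : Λ.Vertex) (ξ : M), M.op (𝟙 v) ξ = ξ →
    ∃ t : Finset (Λ.In v), IsTree v t ∧ ∃ η : Λ.In v → M, (∀ μ ∈ t, η μ ∈ S) ∧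
      ∑ μ ∈ t, ‖M.op μ.2 ξ - η μ‖ ^ 2 < ε ^ 2

/-- The smallest complete submodule. -/
def IsSmallestComplete (S : Submodule ℂ M) : Prop := IsLeast {T | M.IsComplete T} S

/-- The module is decomposable if the orthogonal complement of some nonzero submodule contains a
nonzero submodule. -/
def IsDecomposable : Prop :=
  ∃ S T : Submodule ℂ M, M.IsSubmodule S ∧ M.IsSubmodule T ∧ S ≠ ⊥ ∧ T ≠ ⊥ ∧ T ≤ Sᗮ

/-- An orthogonal decomposition `M = S_1 ⊕ ⋯ ⊕ S_n ⊕ Z` into irreducible submodules `S_i` and a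
residual subspace `Z`. -/
structure Decomposition (n : ℕ) where
  summand : Fin n → Submodule ℂ M
  residue : Submodule ℂ M
  isSubmodule : ∀ i, M.IsSubmodule (summand i)
  isIrreducible : ∀ i, (M.restrict (summand i) (isSubmodule i)).IsIrreducible
  isResidual : M.IsResidual residue
  orthogonal : ∀ i j, i ≠ j → summand i ⟂ summand j
  orthogonal_residue : ∀ i, summand i ⟂ residue
  sup_eq_top : (⨆ i, summand i) ⊔ residue = ⊤

variable {M}

/-- The `i`-th irreducible summand as a module. -/
noncomputable def Decomposition.mod {n : ℕ} (D : M.Decomposition n) (i : Fin n) : AMod.{u, w} Λ :=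
  M.restrict (D.summand i) (D.isSubmodule i)

/-- The subspace `S_1 ⊕ ⋯ ⊕ S_n`. -/
def Decomposition.sum {n : ℕ} (D : M.Decomposition n) : Submodule ℂ M := ⨆ i, D.summand i

variable (M)

/-- Finite Pythagorean dimension: there is a finite-dimensional module with an isomorphic
dilation. -/
def FinitePDim [Λ.LocallyConvex] : Prop :=
  ∃ K : AMod.{u, w} Λ, FiniteDimensional ℂ K ∧ M.dilation.Iso K.dilation

end AMod

end Modules

/-! Along a tree the operators of a module satisfy Pythagoras: the `‖A_μ ξ‖ ^ 2` sum to `‖A_v ξ‖ ^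
2`. So the squared distance of the family `A_μ ξ` to a submodule `S`, its `defect`, is at most `‖ξ‖
^ 2`, and completeness means that the infimum over trees is zero. Two facts about the defect carry
the proof.

(a) If two submodules meet in zero and one of them is finite-dimensional, they enclose a positive
angle. On the first one the defect of the second then stays above `c * ‖ξ‖ ^ 2`, so the second is
not complete (`IsComplete.inf_ne_bot`). Hence a simple submodule lies in every complete submodule as
soon as one of the two is finite-dimensional (`IsComplete.le_of_isSimpleSubmodule`).

(b) Inside a finite-dimensional submodule, if the complement of `S` is residual, compactness of the
unit sphere gives trees that reduce the defect by a uniform factor `c < 1`. Grafting iterates this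
contraction (`exists_defect_lt_of_isResidual`).

Suppose that there is a finite-dimensional complete submodule `F`. A maximal orthogonal family of
simple submodules of `F` has residual complement by (a). The sum of the simple summands of any
decomposition is complete by (b) and transitivity, and it is the smallest complete submodule by (a).
Morphisms respect it, since images of finite-dimensional simple submodules are zero or simple.
Uniqueness of the summands follows by counting dimensions of spaces of morphisms.

The passage to `Π` uses its universal property: a morphism into a representation lifts to the
dilation, and inner products of lifts depend only on inner products of the morphisms
(`inner_lift_congr`). The image of `J` is complete, and a subrepresentation containing a complete
submodule is everything. So `Π` does not distinguish a module from a complete submodule, while an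
isomorphism of dilations carries smallest complete submodules to each other. The same principle
produces `F`: the image of a finite-dimensional `K` is complete in `UΠ(K) ≅ UΠ(H)`, and the smallest
complete submodule found there lies in `J(H)`. -/

/-! ### Grafting of trees, and Pythagoras along a tree -/

section Trees

variable {k : ℕ} {Λ : KGraph.{u} k}

namespace KGraph

theorem eq_root_of_deg_eq_zero {v : Λ.Vertex} {ν : Λ.In v} (h : Λ.deg ν.2 = 0) : ν = root v :=
  congrArg Sigma.fst (ext_unique (μ := ν) (ν := root v) (α := root ν.1) (β := ν)
    (by rw [ext_root, root_ext]) (by rw [h, deg_root]))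

variable [Λ.RowFinite]

theorem caret_ext_unique {v : Λ.Vertex} {i : Fin k} {e f : Λ.In v} (he : e ∈ caret v i)
    (hf : f ∈ caret v i) {α : Λ.In e.1} {β : Λ.In f.1} (h : ext e α = ext f β) : e = f := by
  refine congrArg Sigma.fst (ext_unique h ?_)
  rcases mem_caret.1 he with he | ⟨hn, rfl⟩ <;> rcases mem_caret.1 hf with hf | ⟨hn', rfl⟩
  · rw [mem_edges.1 he, mem_edges.1 hf]
  · exact absurd ⟨e, he⟩ hn'
  · exact absurd ⟨f, hf⟩ hn
  · rfl

/-- Distinct leaves of a tree have no common extension. -/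
theorem IsTree.ext_unique {v : Λ.Vertex} {t : Finset (Λ.In v)} (ht : IsTree v t) :
    ∀ {μ ν : Λ.In v}, μ ∈ t → ν ∈ t → ∀ {α : Λ.In μ.1} {β : Λ.In ν.1},
      ext μ α = ext ν β → μ = ν := by
  classical
  induction ht with
  | root =>
    intro μ ν hμ hν α β _
    rw [Finset.mem_singleton.1 hμ, Finset.mem_singleton.1 hν]
  | graft t κ i _ hκ ih =>
    intro μ ν hμ hν α β h
    rw [Finset.mem_union, Finset.mem_erase, Finset.mem_image] at hμ hν
    rcases hμ with ⟨hne, hμ⟩ | ⟨e, he, rfl⟩ <;> rcases hν with ⟨hne', hν⟩ | ⟨f, hf, rfl⟩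
    · exact ih hμ hν h
    · exact absurd (ih hμ hκ (h.trans (ext_assoc κ f β))) hne
    · exact absurd (ih hν hκ (h.symm.trans (ext_assoc κ e α))) hne'
    · have h1 : ext κ (ext e α) = ext κ (ext f β) :=
        (ext_assoc κ e α).symm.trans (h.trans (ext_assoc κ f β))
      rw [caret_ext_unique he hf (ext_injective κ h1)]

theorem IsTree.eq_of_ext_eq {v : Λ.Vertex} {t : Finset (Λ.In v)} (ht : IsTree v t)
    {μ ν : Λ.In v} (hμ : μ ∈ t) (hν : ν ∈ t) {α : Λ.In μ.1} (h : ext μ α = ν) : μ = ν :=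
  ht.ext_unique hμ hν (h.trans (ext_root ν).symm)

open Classical in
/-- A tree may be grafted onto a leaf of a tree. -/
theorem IsTree.graft_tree {v : Λ.Vertex} {t : Finset (Λ.In v)} (ht : IsTree v t) {μ : Λ.In v}
    (hμ : μ ∈ t) {s : Finset (Λ.In μ.1)} (hs : IsTree μ.1 s) :
    IsTree v (t.erase μ ∪ s.image (ext μ)) := by
  induction hs with
  | root =>
    have h : ext μ (KGraph.root μ.1) = μ := ext_root μ
    rw [Finset.image_singleton, h]
    convert ht using 1
    ext ν
    by_cases hν : ν = μ <;> simp [hν, hμ]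
  | graft s α i _ hα ih =>
    have key := ih.graft _ (ext μ α) i
      (Finset.mem_union_right _ (Finset.mem_image_of_mem _ hα))
    convert key using 1
    ext ν
    simp only [Finset.mem_union, Finset.mem_erase, Finset.mem_image]
    constructor
    · rintro (⟨h1, h2⟩ | ⟨β, ⟨h1, h2⟩ | ⟨e, he, rfl⟩, rfl⟩)
      -- A leaf of `t` other than `μ` cannot extend `μ`, so erasing `μ ∘ α` does not remove it.
      · refine Or.inl ⟨?_, Or.inl ⟨h1, h2⟩⟩
        rintro rfl
        exact h1 (ht.eq_of_ext_eq hμ h2 rfl).symm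
      · exact Or.inl ⟨fun h => h1 (ext_injective μ h), Or.inr ⟨β, h2, rfl⟩⟩
      · exact Or.inr ⟨e, he, ext_assoc μ α e⟩
    · rintro (⟨h1, ⟨h2, h3⟩ | ⟨β, hβ, rfl⟩⟩ | ⟨e, he, rfl⟩)
      · exact Or.inl ⟨h2, h3⟩
      · exact Or.inr ⟨β, Or.inl ⟨fun h => h1 (congrArg _ h), hβ⟩, rfl⟩
      · exact Or.inr ⟨ext α e, Or.inr ⟨e, he, rfl⟩, (ext_assoc μ α e).symm⟩

open Classical in
/-- The set of leaves after trees have been grafted onto all leaves. -/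
noncomputable def graftAll {v : Λ.Vertex} (t : Finset (Λ.In v))
    (s : ∀ μ : Λ.In v, Finset (Λ.In μ.1)) : Finset (Λ.In v) :=
  t.biUnion fun μ => (s μ).image (ext μ)

-- Leaves are treated one at a time; the induction runs over the set `u` of leaves already replaced.
-- The others remain leaves because no leaf extends another.
open Classical in
theorem IsTree.graftAll {v : Λ.Vertex} {t : Finset (Λ.In v)} (ht : IsTree v t)
    {s : ∀ μ : Λ.In v, Finset (Λ.In μ.1)} (hs : ∀ μ ∈ t, IsTree μ.1 (s μ)) :
    IsTree v (KGraph.graftAll t s) := by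
  suffices h : ∀ u ⊆ t, IsTree v ((t \ u) ∪ u.biUnion fun μ => (s μ).image (ext μ)) by
    simpa [KGraph.graftAll] using h t subset_rfl
  intro u
  induction u using Finset.induction_on with
  | empty => intro _; simpa using ht
  | insert μ u hμu ih =>
    intro hu
    have hμ : μ ∈ t := hu (Finset.mem_insert_self _ _)
    have hut : u ⊆ t := fun ν hν => hu (Finset.mem_insert_of_mem hν)
    have key := (ih hut).graft_tree
      (Finset.mem_union_left _ (Finset.mem_sdiff.2 ⟨hμ, hμu⟩)) (hs μ hμ)
    convert key using 1
    ext ν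
    simp only [Finset.mem_union, Finset.mem_sdiff, Finset.mem_insert, Finset.mem_biUnion,
      Finset.mem_erase, Finset.mem_image, not_or]
    constructor
    · rintro (⟨h1, h2, h3⟩ | ⟨κ, rfl | hκ, α, hα, rfl⟩)
      · exact Or.inl ⟨h2, Or.inl ⟨h1, h3⟩⟩
      · exact Or.inr ⟨α, hα, rfl⟩
      · refine Or.inl ⟨?_, Or.inr ⟨κ, hκ, α, hα, rfl⟩⟩
        intro h
        exact hμu (ht.eq_of_ext_eq (hut hκ) hμ h ▸ hκ)
    · rintro (⟨h1, ⟨h2, h3⟩ | ⟨κ, hκ, α, hα, rfl⟩⟩ | ⟨α, hα, rfl⟩)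
      · exact Or.inl ⟨h2, h1, h3⟩
      · exact Or.inr ⟨κ, Or.inr hκ, α, hα, rfl⟩
      · exact Or.inr ⟨μ, Or.inl rfl, α, hα, rfl⟩

theorem IsTree.sum_graftAll {E : Type*} [AddCommMonoid E] {v : Λ.Vertex} {t : Finset (Λ.In v)}
    (ht : IsTree v t) (s : ∀ μ : Λ.In v, Finset (Λ.In μ.1)) (F : Λ.In v → E) :
    ∑ ν ∈ KGraph.graftAll t s, F ν = ∑ μ ∈ t, ∑ α ∈ s μ, F (ext μ α) := by
  classical
  rw [KGraph.graftAll, Finset.sum_biUnion]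
  · exact Finset.sum_congr rfl fun μ _ => Finset.sum_image fun α _ β _ h => ext_injective μ h
  · intro μ hμ ν hν hne
    refine Finset.disjoint_left.2 fun κ h1 h2 => ?_
    obtain ⟨α, -, rfl⟩ := Finset.mem_image.1 h1
    obtain ⟨β, -, h⟩ := Finset.mem_image.1 h2
    exact hne (ht.ext_unique hμ hν h.symm)

theorem isTree_caret (v : Λ.Vertex) (i : Fin k) : IsTree v (caret v i) := by
  classical
  have h := IsTree.root.graft _ (root v) i (Finset.mem_singleton_self (root v))
  have h2 : (caret v i).image (ext (root v)) = caret v i :=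
    (Finset.image_congr fun α _ => root_ext α).trans Finset.image_id
  convert h using 1
  rw [Finset.erase_singleton, Finset.empty_union]
  convert h2.symm

/-- Split off the edge at the source of the path: a tree with the shorter path as a leaf can be
enlarged there by the caret containing that edge. This allows identities for trees to be read off at
a single path. -/
theorem exists_isTree_mem {v : Λ.Vertex} (ν : Λ.In v) : ∃ t, IsTree v t ∧ ν ∈ t := by
  classical
  induction hm : Λ.deg ν.2 using degree_induction generalizing v ν with
  | h0 => exact ⟨_, IsTree.root, by rw [eq_root_of_deg_eq_zero hm]; simp⟩
  | hs m i ih =>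
    obtain ⟨μ, e, rfl, hμ⟩ := exists_ext ν m (by rw [hm]; exact le_self_add)
    obtain ⟨t, ht, hμt⟩ := ih μ hμ
    refine ⟨_, ht.graft _ μ i hμt, Finset.mem_union_right _ (Finset.mem_image_of_mem _ ?_)⟩
    refine mem_caret.2 (Or.inl (mem_edges.2 ?_))
    rw [deg_ext, hμ] at hm
    exact add_left_cancel hm

variable [Λ.LocallyConvex]

/-- Raising `m` by one in the direction `i` grafts a caret of colour `i` onto every leaf; local
convexity enters through this description. The cuts are the trees on which formal combinations of
bounded height are compared. -/
theorem isTree_cut (v : Λ.Vertex) (m : Fin k → ℕ) : IsTree v (cut v m) := by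
  classical
  induction m using degree_induction with
  | h0 =>
    convert (IsTree.root : IsTree v _) using 1
    ext ν
    rw [mem_cut, Finset.mem_singleton]
    refine ⟨fun hν => eq_root_of_deg_eq_zero (le_antisymm hν.1 bot_le), ?_⟩
    rintro rfl
    exact ⟨(deg_root _).le, fun i hi => absurd hi (by simp)⟩
  | hs m i ih =>
    convert ih.graftAll (s := fun μ => caret μ.1 i) (fun μ _ => isTree_caret μ.1 i) using 1
    ext ν
    simp only [KGraph.graftAll, mem_cut, Finset.mem_biUnion, Finset.mem_image]
    constructor
    · intro hν
      obtain ⟨μ, hμ, e, he, rfl⟩ := exists_of_mem_cutSet hν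
      exact ⟨μ, hμ, e, he, rfl⟩
    · rintro ⟨μ, hμ, e, he, rfl⟩
      exact ext_mem_cutSet hμ he

theorem ext_mem_cut {v : Λ.Vertex} {m : Fin k → ℕ} {μ : Λ.In v} {α : Λ.In μ.1} :
    ext μ α ∈ cut v (Λ.deg μ.2 + m) ↔ α ∈ cut μ.1 m := by
  rw [mem_cut, mem_cut]
  constructor
  · intro h
    refine ⟨?_, fun i hi => h.2 i ?_⟩
    · have := h.1
      rw [deg_ext] at this
      exact le_of_add_le_add_left this
    · rw [deg_ext]
      simpa using hi
  · intro h
    refine ⟨by rw [deg_ext]; exact add_le_add_right h.1 _, fun i hi => h.2 i ?_⟩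
    rw [deg_ext] at hi
    simpa using hi

end KGraph

namespace AMod

variable [Λ.RowFinite] (M : AMod.{u, w} Λ)

theorem op_ext {v : Λ.Vertex} (μ : Λ.In v) (α : Λ.In μ.1) (ξ : M) :
    M.op (ext μ α).2 ξ = M.op α.2 (M.op μ.2 ξ) :=
  DFunLike.congr_fun (M.op_comp α.2 μ.2) ξ

/-- A graft replaces one term by the sum over a caret, which has the same value by the Pythagorean
relation. -/
theorem sum_tree_inner {v : Λ.Vertex} {t : Finset (Λ.In v)} (ht : IsTree v t) (ξ η : M) :
    ∑ μ ∈ t, ⟪M.op μ.2 ξ, M.op μ.2 η⟫_ℂ = ⟪M.op (𝟙 v) ξ, M.op (𝟙 v) η⟫_ℂ := by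
  classical
  induction ht with
  | root => simp [root]
  | graft t μ i ht hμ ih =>
    rw [← ih, Finset.sum_union, Finset.sum_image fun α _ β _ h => ext_injective μ h,
      ← Finset.sum_erase_add _ _ hμ]
    · congr 1
      have h := M.sum_caret_inner μ.1 i (M.op μ.2 ξ) (M.op μ.2 η)
      rw [M.op_id_comp, M.op_id_comp] at h
      rw [← h]
      exact Finset.sum_congr rfl fun α _ => by rw [M.op_ext, M.op_ext]
    · refine Finset.disjoint_left.2 fun κ h1 h2 => ?_
      obtain ⟨α, -, rfl⟩ := Finset.mem_image.1 h2
      obtain ⟨h3, h4⟩ := Finset.mem_erase.1 h1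
      exact h3 (ht.eq_of_ext_eq hμ h4 rfl).symm

theorem sum_tree_norm_sq {v : Λ.Vertex} {t : Finset (Λ.In v)} (ht : IsTree v t) (ξ : M) :
    ∑ μ ∈ t, ‖M.op μ.2 ξ‖ ^ 2 = ‖M.op (𝟙 v) ξ‖ ^ 2 := by
  have h := M.sum_tree_inner ht ξ ξ
  simp only [inner_self_eq_norm_sq_to_K] at h
  exact_mod_cast h

end AMod

end Trees

/-! ### Submodules, the defect, and the angle between submodules -/

section CompleteSubmodules

variable {k : ℕ} {Λ : KGraph.{u} k} [Λ.RowFinite]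

namespace AMod

variable {M : AMod.{u, w} Λ}

theorem op_op_of_ne {a b c d : Λ.Vertex} (f : a ⟶ b) (g : c ⟶ d) (h : b ≠ c) (ξ : M) :
    M.op f (M.op g ξ) = 0 := by
  have := DFunLike.congr_fun (M.op_orthogonal b c h) (M.op g ξ)
  rw [← M.op_comp_id f, ← M.op_id_comp g]
  simp only [ContinuousLinearMap.comp_apply, zero_apply] at this
  rw [this, map_zero]

theorem eq_of_op_id_eq {v w : Λ.Vertex} {ξ : M} (hv : M.op (𝟙 v) ξ = ξ)
    (hw : M.op (𝟙 w) ξ ≠ 0) : v = w := by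
  by_contra h
  rw [← hv] at hw
  exact hw (op_op_of_ne _ _ (Ne.symm h) ξ)

theorem exists_op_id_ne_zero {ξ : M} (h : ξ ≠ 0) : ∃ v, M.op (𝟙 v) ξ ≠ 0 := by
  by_contra! h0
  have := M.nondegenerate ξ
  simp only [h0] at this
  exact h (this.unique hasSum_zero)

theorem isSubmodule_top : M.IsSubmodule ⊤ := ⟨isClosed_univ, fun _ _ _ => trivial⟩

theorem IsSubmodule.inf {S T : Submodule ℂ M} (hS : M.IsSubmodule S) (hT : M.IsSubmodule T) :
    M.IsSubmodule (S ⊓ T) :=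
  ⟨hS.isClosed.inter hT.isClosed, fun f ξ h => ⟨hS.op_mem f ξ h.1, hT.op_mem f ξ h.2⟩⟩

theorem isSubmodule_of_finiteDimensional {S : Submodule ℂ M} [FiniteDimensional ℂ S]
    (h : ∀ {a b : Λ.Vertex} (f : a ⟶ b), ∀ ξ ∈ S, M.op f ξ ∈ S) : M.IsSubmodule S :=
  ⟨S.closed_of_finiteDimensional, h⟩

theorem isSubmodule_iSup {n : ℕ} {S : Fin n → Submodule ℂ M}
    [∀ i, FiniteDimensional ℂ (S i)] (h : ∀ i, M.IsSubmodule (S i)) :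
    M.IsSubmodule (⨆ i, S i) := by
  refine isSubmodule_of_finiteDimensional fun f ξ hξ => ?_
  have : ⨆ i, S i ≤ (⨆ i, S i).comap (M.op f : M →ₗ[ℂ] M) :=
    iSup_le fun i η hη => Submodule.mem_iSup_of_mem i ((h i).op_mem f η hη)
  exact this hξ

theorem IsSubmodule.exists_op_id {S : Submodule ℂ M} (hS : M.IsSubmodule S) (h : S ≠ ⊥) :
    ∃ v, ∃ ξ ∈ S, ξ ≠ 0 ∧ M.op (𝟙 v) ξ = ξ := by
  obtain ⟨ξ, hξ, h0⟩ := S.exists_mem_ne_zero_of_ne_bot h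
  obtain ⟨v, hv⟩ := exists_op_id_ne_zero h0
  exact ⟨v, _, hS.op_mem _ ξ hξ, hv, M.op_id_comp _ _⟩

/-- The linear span of the orbit of a vector. -/
def orbit (v : Λ.Vertex) (ξ : M) : Submodule ℂ M :=
  Submodule.span ℂ (Set.range fun μ : Λ.In v => M.op μ.2 ξ)

theorem op_mem_orbit (v : Λ.Vertex) (ξ : M) {a b : Λ.Vertex} (f : a ⟶ b) {η : M}
    (hη : η ∈ orbit v ξ) : M.op f η ∈ orbit v ξ := by
  have : orbit v ξ ≤ (orbit v ξ).comap (M.op f : M →ₗ[ℂ] M) := by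
    refine Submodule.span_le.2 ?_
    rintro _ ⟨μ, rfl⟩
    change M.op f (M.op μ.2 ξ) ∈ orbit v ξ
    by_cases h : b = μ.1
    · subst h
      rw [← M.op_ext μ ⟨a, f⟩]
      exact Submodule.subset_span ⟨_, rfl⟩
    · rw [op_op_of_ne f μ.2 h]
      exact zero_mem _
  exact this hη

/-! ### The defect of a submodule along a tree -/

/-- The projection onto the orthogonal complement. -/
noncomputable def coproj (S : Submodule ℂ M) : M →L[ℂ] M := Sᗮ.starProjection

theorem coproj_mem (S : Submodule ℂ M) (ξ : M) : coproj S ξ ∈ Sᗮ := Sᗮ.starProjection_apply_mem ξ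

theorem coproj_of_mem {S : Submodule ℂ M} {ξ : M} (h : ξ ∈ S) : coproj S ξ = 0 :=
  (Submodule.starProjection_apply_eq_zero_iff _).2 (S.le_orthogonal_orthogonal h)

theorem coproj_of_mem_orthogonal {S : Submodule ℂ M} {ξ : M} (h : ξ ∈ Sᗮ) : coproj S ξ = ξ :=
  Submodule.starProjection_eq_self_iff.2 h

theorem sub_coproj_mem {S : Submodule ℂ M} (hS : IsClosed (S : Set M)) (ξ : M) :
    ξ - coproj S ξ ∈ S := by
  have : CompleteSpace S := hS.completeSpace_coe
  have h := Sᗮ.sub_starProjection_mem_orthogonal ξ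
  rwa [Submodule.orthogonal_orthogonal] at h

theorem mem_of_coproj_eq_zero {S : Submodule ℂ M} (hS : IsClosed (S : Set M)) {ξ : M}
    (h : coproj S ξ = 0) : ξ ∈ S := by
  simpa [h] using sub_coproj_mem hS ξ

theorem norm_coproj_le (S : Submodule ℂ M) (ξ : M) : ‖coproj S ξ‖ ≤ ‖ξ‖ :=
  Sᗮ.norm_starProjection_apply_le ξ

theorem norm_coproj_le_sub {S : Submodule ℂ M} (ξ : M) {η : M} (h : η ∈ S) :
    ‖coproj S ξ‖ ≤ ‖ξ - η‖ := by
  have := norm_coproj_le S (ξ - η)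
  rwa [map_sub, coproj_of_mem h, sub_zero] at this

theorem norm_sq_eq_coproj (S : Submodule ℂ M) (ξ : M) :
    ‖ξ‖ ^ 2 = ‖ξ - coproj S ξ‖ ^ 2 + ‖coproj S ξ‖ ^ 2 := by
  have h : ⟪ξ - coproj S ξ, coproj S ξ⟫_ℂ = 0 :=
    Submodule.inner_left_of_mem_orthogonal (coproj_mem S ξ)
      (Sᗮ.sub_starProjection_mem_orthogonal ξ)
  have := norm_add_sq_eq_norm_sq_add_norm_sq_of_inner_eq_zero _ _ h
  rw [sub_add_cancel] at this
  nlinarith [this]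

/-- The operators descend to the quotient by `S`, here identified with `Sᗮ`: the component in `S`
stays in `S` and is killed. -/
theorem IsSubmodule.coproj_op_coproj {S : Submodule ℂ M} (hS : M.IsSubmodule S) {a b : Λ.Vertex}
    (f : a ⟶ b) (ξ : M) : coproj S (M.op f (coproj S ξ)) = coproj S (M.op f ξ) := by
  have h := coproj_of_mem (hS.op_mem f _ (sub_coproj_mem hS.isClosed ξ))
  rw [map_sub, map_sub, sub_eq_zero] at h
  exact h.symm

theorem IsSubmodule.op_id_mem_orthogonal {S : Submodule ℂ M} (hS : M.IsSubmodule S)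
    (v : Λ.Vertex) {ξ : M} (h : ξ ∈ Sᗮ) : M.op (𝟙 v) ξ ∈ Sᗮ := by
  rw [Submodule.mem_orthogonal] at h ⊢
  intro η hη
  rw [← M.inner_op_id]
  exact h _ (hS.op_mem _ _ hη)

theorem IsSubmodule.op_id_coproj {S : Submodule ℂ M} (hS : M.IsSubmodule S) (v : Λ.Vertex)
    (ξ : M) : M.op (𝟙 v) (coproj S ξ) = coproj S (M.op (𝟙 v) ξ) := by
  rw [← hS.coproj_op_coproj]
  refine (coproj_of_mem_orthogonal ?_).symm
  exact hS.op_id_mem_orthogonal v (coproj_mem S ξ)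

/-- The squared distance to `S` of the family of the `A_μ ξ`, with `μ` a leaf of `t`. -/
noncomputable def defect (S : Submodule ℂ M) {v : Λ.Vertex} (t : Finset (Λ.In v)) (ξ : M) : ℝ :=
  ∑ μ ∈ t, ‖coproj S (M.op μ.2 ξ)‖ ^ 2

theorem defect_nonneg (S : Submodule ℂ M) {v : Λ.Vertex} (t : Finset (Λ.In v)) (ξ : M) :
    0 ≤ defect S t ξ := Finset.sum_nonneg fun _ _ => sq_nonneg _

theorem continuous_defect (S : Submodule ℂ M) {v : Λ.Vertex} (t : Finset (Λ.In v)) :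
    Continuous (defect S t) := by
  unfold defect
  fun_prop

theorem defect_smul (S : Submodule ℂ M) {v : Λ.Vertex} (t : Finset (Λ.In v)) (c : ℂ) (ξ : M) :
    defect S t (c • ξ) = ‖c‖ ^ 2 * defect S t ξ := by
  simp [defect, norm_smul, mul_pow, Finset.mul_sum]

theorem IsSubmodule.defect_coproj {S : Submodule ℂ M} (hS : M.IsSubmodule S) {v : Λ.Vertex}
    (t : Finset (Λ.In v)) (ξ : M) : defect S t (coproj S ξ) = defect S t ξ := by
  simp only [defect, hS.coproj_op_coproj]

/-- The leaves of a tree can be improved independently of each other, which is what permits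
iteration. -/
theorem defect_graftAll (S : Submodule ℂ M) {v : Λ.Vertex} {t : Finset (Λ.In v)}
    (ht : IsTree v t) (s : ∀ μ : Λ.In v, Finset (Λ.In μ.1)) (ξ : M) :
    defect S (graftAll t s) ξ = ∑ μ ∈ t, defect S (s μ) (M.op μ.2 ξ) := by
  unfold defect
  rw [ht.sum_graftAll]
  exact Finset.sum_congr rfl fun μ _ => Finset.sum_congr rfl fun α _ => by rw [M.op_ext]

theorem defect_le (S : Submodule ℂ M) {v : Λ.Vertex} {t : Finset (Λ.In v)}
    (ht : IsTree v t) (ξ : M) : defect S t ξ ≤ ‖ξ‖ ^ 2 := by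
  have h1 : defect S t ξ ≤ ‖M.op (𝟙 v) ξ‖ ^ 2 := by
    rw [← M.sum_tree_norm_sq ht]
    exact Finset.sum_le_sum fun μ _ =>
      pow_le_pow_left₀ (norm_nonneg _) (norm_coproj_le _ _) 2
  refine h1.trans ?_
  have := (M.hasSum_norm_sq ξ)
  exact this.summable.le_tsum v (fun _ _ => sq_nonneg _) |>.trans this.tsum_eq.le

/-- The best approximation of `A_μ ξ` in `S` is its projection, so only the defect matters. The `ε`
on the right plays the role of `ε ^ 2` in the definition. -/
theorem isComplete_iff {S : Submodule ℂ M} : M.IsComplete S ↔ M.IsSubmodule S ∧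
    ∀ (v : Λ.Vertex) (ξ : M), M.op (𝟙 v) ξ = ξ → ∀ ε : ℝ, 0 < ε →
      ∃ t, IsTree v t ∧ defect S t ξ < ε := by
  constructor
  · intro h
    refine ⟨h.isSubmodule, fun v ξ hξ ε hε => ?_⟩
    obtain ⟨t, ht, η, hη, hlt⟩ := h.approx (√ε) (Real.sqrt_pos.2 hε) v ξ hξ
    rw [Real.sq_sqrt hε.le] at hlt
    exact ⟨t, ht, (Finset.sum_le_sum fun μ hμ =>
      pow_le_pow_left₀ (norm_nonneg _) (norm_coproj_le_sub _ (hη μ hμ)) 2).trans_lt hlt⟩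
  · rintro ⟨hS, h⟩
    refine ⟨hS, fun ε hε v ξ hξ => ?_⟩
    obtain ⟨t, ht, hlt⟩ := h v ξ hξ (ε ^ 2) (by positivity)
    refine ⟨t, ht, fun μ => M.op μ.2 ξ - coproj S (M.op μ.2 ξ),
      fun μ _ => sub_coproj_mem hS.isClosed _, ?_⟩
    simpa [defect] using hlt

/-- Completeness is transitive. -/
theorem IsComplete.trans {S T : Submodule ℂ M} (hT : M.IsComplete T) (hS : M.IsSubmodule S)
    (h : ∀ (v : Λ.Vertex), ∀ ξ ∈ T, M.op (𝟙 v) ξ = ξ → ∀ ε : ℝ, 0 < ε →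
      ∃ t, IsTree v t ∧ defect S t ξ < ε) : M.IsComplete S := by
  refine isComplete_iff.2 ⟨hS, fun v ξ hξ ε hε => ?_⟩
  obtain ⟨hT1, hT2⟩ := isComplete_iff.1 hT
  -- Both parts of the error get `ε / 4`, as the inequality `‖a‖² ≤ 2‖a - b‖² + 2‖b‖²` doubles them.
  -- The part in `T` is shared out equally among the leaves.
  obtain ⟨t, ht, hlt⟩ := hT2 v ξ hξ (ε / 4) (by positivity)
  have hpos : (0 : ℝ) < t.card + 1 := by positivity
  have hex : ∀ μ : Λ.In v, ∃ s, IsTree μ.1 s ∧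
      defect S s (M.op μ.2 ξ - coproj T (M.op μ.2 ξ)) < ε / 4 / (t.card + 1) := by
    intro μ
    refine h μ.1 _ (sub_coproj_mem hT1.isClosed _) ?_ _ (by positivity)
    rw [map_sub, hT1.op_id_coproj, M.op_id_comp]
  choose s hs hs2 using hex
  refine ⟨graftAll t s, ht.graftAll fun μ _ => hs μ, ?_⟩
  rw [defect_graftAll S ht]
  have key : ∀ μ ∈ t, defect S (s μ) (M.op μ.2 ξ) ≤
      2 * (ε / 4 / (t.card + 1)) + 2 * ‖coproj T (M.op μ.2 ξ)‖ ^ 2 := by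
    intro μ _
    set x := M.op μ.2 ξ
    have h1 : defect S (s μ) x ≤
        2 * defect S (s μ) (x - coproj T x) + 2 * defect S (s μ) (coproj T x) := by
      unfold defect
      rw [Finset.mul_sum, Finset.mul_sum, ← Finset.sum_add_distrib]
      refine Finset.sum_le_sum fun α _ => ?_
      set a := coproj S (M.op α.2 x)
      set b := coproj S (M.op α.2 (coproj T x))
      have hab : coproj S (M.op α.2 (x - coproj T x)) = a - b := by simp [a, b]
      rw [hab]
      have h2 : ‖a‖ ≤ ‖a - b‖ + ‖b‖ := by simpa using norm_add_le (a - b) b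
      nlinarith [sq_nonneg (‖a - b‖ - ‖b‖), norm_nonneg a]
    -- The component outside `T` is already small, and no tree can enlarge it.
    have h2 := defect_le S (hs μ) (coproj T x)
    have h3 := (hs2 μ).le
    linarith
  calc ∑ μ ∈ t, defect S (s μ) (M.op μ.2 ξ)
      ≤ ∑ μ ∈ t, (2 * (ε / 4 / (t.card + 1)) + 2 * ‖coproj T (M.op μ.2 ξ)‖ ^ 2) :=
        Finset.sum_le_sum key
    _ = t.card * (2 * (ε / 4 / (t.card + 1))) + 2 * defect T t ξ := by
        rw [Finset.sum_add_distrib, Finset.sum_const, nsmul_eq_mul, ← Finset.mul_sum, defect]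
    _ < ε := by
        have : (t.card : ℝ) * (2 * (ε / 4 / (t.card + 1))) ≤ ε / 2 := by
          have h4 : (t.card : ℝ) * (2 * (ε / 4 / (t.card + 1))) =
              ε / 2 * (t.card / (t.card + 1)) := by field_simp; ring
          rw [h4]
          have h5 : (t.card : ℝ) / (t.card + 1) ≤ 1 := (div_le_one hpos).2 (by linarith)
          nlinarith
        linarith

/-! ### Intersections with complete submodules -/

/-- The projection to `Tᗮ` is injective on `S`, and an injective linear map on a finite-dimensional
space is bounded below. The bound `c ≤ 1` serves the mirrored version `exists_le_norm_coproj'`. -/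
theorem exists_le_norm_coproj {S T : Submodule ℂ M} [FiniteDimensional ℂ S]
    (hT : IsClosed (T : Set M)) (h : S ⊓ T = ⊥) :
    ∃ c : ℝ, 0 < c ∧ c ≤ 1 ∧ ∀ ξ ∈ S, c * ‖ξ‖ ^ 2 ≤ ‖coproj T ξ‖ ^ 2 := by
  set F : S →ₗ[ℂ] M := (coproj T : M →ₗ[ℂ] M) ∘ₗ S.subtype
  have hker : LinearMap.ker F = ⊥ := by
    refine LinearMap.ker_eq_bot'.2 fun ξ hξ => ?_
    have : (ξ : M) ∈ S ⊓ T := ⟨ξ.2, mem_of_coproj_eq_zero hT hξ⟩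
    rw [h, Submodule.mem_bot] at this
    exact Subtype.ext this
  obtain ⟨K, hK, hF⟩ := F.exists_antilipschitzWith hker
  have hK' : (0 : ℝ) < K := hK
  refine ⟨min ((K : ℝ) ^ 2)⁻¹ 1, lt_min (by positivity) one_pos, min_le_right _ _,
    fun ξ hξ => ?_⟩
  refine (mul_le_mul_of_nonneg_right (min_le_left _ _) (sq_nonneg _)).trans ?_
  have h2 : ‖ξ‖ ≤ K * ‖coproj T ξ‖ := by
    have := hF.le_mul_dist ⟨ξ, hξ⟩ 0
    rw [map_zero, dist_zero_right, dist_zero_right] at this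
    exact this
  have h3 := pow_le_pow_left₀ (norm_nonneg _) h2 2
  rw [mul_pow] at h3
  rwa [inv_mul_le_iff₀ (by positivity)]

/-- The angle between two closed subspaces is symmetric, so either may be the finite-dimensional
one. If `η` is the projection of `ξ` to `T` and `P η` that of `η` to `S`, then `‖η‖² = ⟪ξ, P η⟫ ≤
‖ξ‖ ‖P η‖` and `‖P η‖² ≤ (1 - c) ‖η‖²` give `‖η‖² ≤ (1 - c) ‖ξ‖²`, with the same constant. -/
theorem exists_le_norm_coproj' {S T : Submodule ℂ M} [FiniteDimensional ℂ T]
    (hS : IsClosed (S : Set M)) (h : S ⊓ T = ⊥) :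
    ∃ c : ℝ, 0 < c ∧ ∀ ξ ∈ S, c * ‖ξ‖ ^ 2 ≤ ‖coproj T ξ‖ ^ 2 := by
  obtain ⟨c, hc, hc1, hcS⟩ := exists_le_norm_coproj (S := T) (T := S) hS (by rwa [inf_comm])
  refine ⟨c, hc, fun ξ hξ => ?_⟩
  set η := ξ - coproj T ξ with hη
  have hηT : η ∈ T := sub_coproj_mem T.closed_of_finiteDimensional ξ
  have h1 := hcS η hηT
  have h2 := norm_sq_eq_coproj S η
  have h3 := norm_sq_eq_coproj T ξ
  have h4 : ‖η‖ ^ 2 ≤ ‖ξ‖ * ‖η - coproj S η‖ := by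
    have e1 : ⟪ξ, η⟫_ℂ = (‖η‖ : ℂ) ^ 2 := by
      have : ⟪coproj T ξ, η⟫_ℂ = 0 :=
        Submodule.inner_left_of_mem_orthogonal hηT (coproj_mem T ξ)
      have e : ξ = η + coproj T ξ := by simp [hη]
      conv_lhs => rw [e]
      rw [inner_add_left, this, add_zero, inner_self_eq_norm_sq_to_K]
      rfl
    have e2 : ⟪ξ, η⟫_ℂ = ⟪ξ, η - coproj S η⟫_ℂ := by
      rw [inner_sub_right ξ η, Submodule.inner_right_of_mem_orthogonal hξ (coproj_mem S η),
        sub_zero]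
    have e3 := norm_inner_le_norm (𝕜 := ℂ) ξ (η - coproj S η)
    rw [← e2, e1] at e3
    simpa using e3
  set a := ‖ξ‖
  set b := ‖η‖
  set d := ‖η - coproj S η‖
  have hd : d ^ 2 ≤ (1 - c) * b ^ 2 := by linarith
  have ha : 0 ≤ a := norm_nonneg _
  have hb : 0 ≤ b := norm_nonneg _
  rcases hb.eq_or_lt with hb0 | hb0
  · rw [← hb0] at h3
    nlinarith [sq_nonneg a]
  · have h5 : b ^ 4 ≤ a ^ 2 * ((1 - c) * b ^ 2) := by
      have := pow_le_pow_left₀ (by positivity) h4 2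
      nlinarith [sq_nonneg a]
    have h6 : b ^ 2 ≤ a ^ 2 * (1 - c) := by
      have hb2 : 0 < b ^ 2 := by positivity
      by_contra hlt
      push Not at hlt
      nlinarith
    nlinarith
end AMod
end CompleteSubmodules

/-! ### Contraction of the defect, simple submodules and decompositions -/

section SimpleSubmodules

variable {k : ℕ} {Λ : KGraph.{u} k} [Λ.RowFinite]

namespace AMod

variable {M : AMod.{u, w} Λ}

/-- A nonzero submodule meets a complete submodule if one of them is finite-dimensional. -/
theorem IsComplete.inf_ne_bot {S T : Submodule ℂ M} (hT : M.IsComplete T) (hS : M.IsSubmodule S)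
    (hne : S ≠ ⊥) (hfd : FiniteDimensional ℂ S ∨ FiniteDimensional ℂ T) : S ⊓ T ≠ ⊥ := by
  intro h
  obtain ⟨c, hc, hcS⟩ : ∃ c : ℝ, 0 < c ∧ ∀ ξ ∈ S, c * ‖ξ‖ ^ 2 ≤ ‖coproj T ξ‖ ^ 2 := by
    rcases hfd with hfd | hfd
    · obtain ⟨c, hc, -, hcS⟩ := exists_le_norm_coproj hT.isSubmodule.isClosed h
      exact ⟨c, hc, hcS⟩
    · exact exists_le_norm_coproj' hS.isClosed h
  obtain ⟨v, ξ, hξ, h0, hv⟩ := hS.exists_op_id hne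
  have hpos : 0 < ‖ξ‖ := norm_pos_iff.2 h0
  -- No tree can get below this threshold: all `A_μ ξ` stay in `S`, so the defect is at least `c`
  -- times the sum of the `‖A_μ ξ‖ ^ 2`, which is `‖ξ‖ ^ 2`.
  obtain ⟨t, ht, hlt⟩ := (isComplete_iff.1 hT).2 v ξ hv (c * ‖ξ‖ ^ 2) (by positivity)
  have h1 := M.sum_tree_norm_sq ht ξ
  rw [hv] at h1
  rw [← h1, Finset.mul_sum] at hlt
  exact absurd hlt (not_lt.2 (Finset.sum_le_sum fun μ _ => hcS _ (hS.op_mem _ _ hξ)))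

/-- If no tree lowered the defect, Pythagoras would put every `A_μ ξ` into `Sᗮ`, since every path is
a leaf of some tree. The orbit of `ξ` would then span a nonzero submodule of the residual space
`Sᗮ`; it is closed because it lies in `F`. -/
theorem exists_defect_lt {F S : Submodule ℂ M} [FiniteDimensional ℂ F] (hF : M.IsSubmodule F)
    (hres : M.IsResidual Sᗮ) {v : Λ.Vertex} {ξ : M} (hξ : ξ ∈ F) (h0 : ξ ≠ 0)
    (hv : M.op (𝟙 v) ξ = ξ) : ∃ t, IsTree v t ∧ defect S t ξ < ‖ξ‖ ^ 2 := by
  by_contra! h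
  have horb : ∀ μ : Λ.In v, M.op μ.2 ξ ∈ Sᗮ := by
    intro μ
    obtain ⟨t, ht, hμ⟩ := exists_isTree_mem μ
    have h1 := M.sum_tree_norm_sq ht ξ
    rw [hv] at h1
    have hle : ∀ ν ∈ t, ‖coproj S (M.op ν.2 ξ)‖ ^ 2 ≤ ‖M.op ν.2 ξ‖ ^ 2 := fun ν _ =>
      pow_le_pow_left₀ (norm_nonneg _) (norm_coproj_le _ _) 2
    have h2 : defect S t ξ = ∑ ν ∈ t, ‖M.op ν.2 ξ‖ ^ 2 :=
      le_antisymm (Finset.sum_le_sum hle) (h1.le.trans (h t ht))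
    have h3 := (Finset.sum_eq_sum_iff_of_le hle).1 h2 μ hμ
    have h4 := norm_sq_eq_coproj S (M.op μ.2 ξ)
    have h5 : ‖M.op μ.2 ξ - coproj S (M.op μ.2 ξ)‖ ^ 2 = 0 := by linarith
    have h6 : M.op μ.2 ξ - coproj S (M.op μ.2 ξ) = 0 := by simpa using h5
    rw [sub_eq_zero.1 h6]
    exact coproj_mem _ _
  have hle : orbit v ξ ≤ F := Submodule.span_le.2 (by
    rintro _ ⟨μ, rfl⟩
    exact hF.op_mem _ _ hξ)
  have : FiniteDimensional ℂ (orbit v ξ) := Submodule.finiteDimensional_of_le hle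
  have hbot := hres (orbit v ξ) (isSubmodule_of_finiteDimensional fun f η => op_mem_orbit v ξ f)
    (Submodule.span_le.2 (by rintro _ ⟨μ, rfl⟩; exact horb μ))
  have hmem : ξ ∈ orbit v ξ := Submodule.subset_span ⟨root v, hv⟩
  rw [hbot] at hmem
  exact h0 hmem

/-- For a fixed tree the defect is continuous, so the strict inequality of `exists_defect_lt`
persists nearby, and compactness of the unit sphere of `F` makes it uniform. -/
theorem exists_uniform_defect {F S : Submodule ℂ M} [FiniteDimensional ℂ F]
    (hF : M.IsSubmodule F) (hres : M.IsResidual Sᗮ) :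
    ∃ c : ℝ, 0 ≤ c ∧ c < 1 ∧ ∀ (v : Λ.Vertex), ∀ ξ ∈ F, M.op (𝟙 v) ξ = ξ →
      ∃ t, IsTree v t ∧ defect S t ξ ≤ c * ‖ξ‖ ^ 2 := by
  have : ProperSpace F := FiniteDimensional.proper ℂ F
  have hcomp : IsCompact (Subtype.val '' Metric.sphere (0 : F) 1) :=
    (isCompact_sphere (0 : F) 1).image continuous_subtype_val
  obtain ⟨c, hc0, hc, hcK⟩ : ∃ c : ℝ, 0 ≤ c ∧ c < 1 ∧
      ∀ ξ ∈ Subtype.val '' Metric.sphere (0 : F) 1, ∀ v : Λ.Vertex, M.op (𝟙 v) ξ = ξ →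
        ∃ t, IsTree v t ∧ defect S t ξ ≤ c := by
    refine hcomp.induction_on (p := fun s => ∃ c : ℝ, 0 ≤ c ∧ c < 1 ∧
      ∀ ξ ∈ s, ∀ v : Λ.Vertex, M.op (𝟙 v) ξ = ξ → ∃ t, IsTree v t ∧ defect S t ξ ≤ c)
      ?_ ?_ ?_ ?_
    · exact ⟨0, le_rfl, one_pos, fun _ h => absurd h (Set.notMem_empty _)⟩
    · rintro s s' hs ⟨c, hc0, hc, h⟩
      exact ⟨c, hc0, hc, fun ξ hξ => h ξ (hs hξ)⟩
    · rintro s s' ⟨c, hc0, hc, h⟩ ⟨c', hc0', hc', h'⟩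
      refine ⟨max c c', le_max_of_le_left hc0, max_lt hc hc', ?_⟩
      rintro ξ (hξ | hξ) v hv
      · obtain ⟨t, ht, hle⟩ := h ξ hξ v hv
        exact ⟨t, ht, hle.trans (le_max_left _ _)⟩
      · obtain ⟨t, ht, hle⟩ := h' ξ hξ v hv
        exact ⟨t, ht, hle.trans (le_max_right _ _)⟩
    · rintro _ ⟨⟨ξ, hξ⟩, h1, rfl⟩
      have hn : ‖ξ‖ = 1 := by simpa using h1
      have h0 : ξ ≠ 0 := norm_ne_zero_iff.1 (by rw [hn]; exact one_ne_zero)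
      obtain ⟨w, hw⟩ := exists_op_id_ne_zero h0
      -- Nearby vectors still have a component at `w`, so `w` is the only vertex at which they can
      -- be based.
      have hop : IsOpen {η : M | M.op (𝟙 w) η ≠ 0} := isOpen_ne_fun (by fun_prop) (by fun_prop)
      by_cases hvw : M.op (𝟙 w) ξ = ξ
      · obtain ⟨t, ht, hlt⟩ := exists_defect_lt hF hres hξ h0 hvw
        rw [hn, one_pow] at hlt
        obtain ⟨c, hc1, hc2⟩ := exists_between hlt
        have hop2 : IsOpen {η : M | defect S t η < c} :=
          isOpen_lt (continuous_defect S t) continuous_const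
        refine ⟨_, mem_nhdsWithin_of_mem_nhds ((hop.inter hop2).mem_nhds ⟨hw, hc1⟩), c,
          (defect_nonneg S t ξ).trans hc1.le, hc2, ?_⟩
        rintro η ⟨hη1, hη2⟩ v hv
        obtain rfl := eq_of_op_id_eq hv hη1
        exact ⟨t, ht, le_of_lt hη2⟩
      -- Here no nearby vector is based at a single vertex, so the condition is vacuous and the
      -- constant `0` will do.
      · have hop2 : IsOpen {η : M | M.op (𝟙 w) η ≠ η} := isOpen_ne_fun (by fun_prop) (by fun_prop)
        refine ⟨_, mem_nhdsWithin_of_mem_nhds ((hop.inter hop2).mem_nhds ⟨hw, hvw⟩), 0, le_rfl,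
          one_pos, ?_⟩
        rintro η ⟨hη1, hη2⟩ v hv
        obtain rfl := eq_of_op_id_eq hv hη1
        exact absurd hv hη2
  refine ⟨c, hc0, hc, fun v ξ hξ hv => ?_⟩
  by_cases h0 : ξ = 0
  · exact ⟨_, IsTree.root, by simp [h0, defect]⟩
  have hpos : 0 < ‖ξ‖ := norm_pos_iff.2 h0
  set a : ℂ := ((‖ξ‖⁻¹ : ℝ) : ℂ)
  have ha : ‖a‖ = ‖ξ‖⁻¹ := by simp [a]
  obtain ⟨t, ht, hle⟩ := hcK (a • ξ) ⟨⟨a • ξ, F.smul_mem a hξ⟩, by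
    simp [norm_smul, ha, hpos.ne'], rfl⟩ v (by rw [map_smul, hv])
  refine ⟨t, ht, ?_⟩
  rw [defect_smul, ha, inv_pow, inv_mul_le_iff₀ (by positivity)] at hle
  linarith

/-- A submodule of a finite-dimensional module is complete if its orthogonal complement is
residual. -/
theorem exists_defect_lt_of_isResidual {F S : Submodule ℂ M} [FiniteDimensional ℂ F]
    (hF : M.IsSubmodule F) (hS : M.IsSubmodule S) (hSF : S ≤ F) (hres : M.IsResidual Sᗮ)
    (v : Λ.Vertex) (ξ : M) (hξ : ξ ∈ F) (ε : ℝ) (hε : 0 < ε) :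
    ∃ t, IsTree v t ∧ defect S t ξ < ε := by
  obtain ⟨c, hc0, hc, h⟩ := exists_uniform_defect hF hres
  have key : ∀ n : ℕ, ∃ t, IsTree v t ∧ defect S t ξ ≤ c ^ n * ‖ξ‖ ^ 2 := by
    intro n
    induction n with
    | zero => exact ⟨_, IsTree.root, by simpa using defect_le S IsTree.root ξ⟩
    | succ n ih =>
      obtain ⟨t, ht, hle⟩ := ih
      -- The uniform bound is applied to the component of `A_μ ξ` in `Sᗮ`. It remains in `F` because
      -- `S ≤ F`, and it has the same defect as `A_μ ξ`, so each round of grafting gains a factor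
      -- `c`.
      have hex : ∀ μ : Λ.In v, ∃ s, IsTree μ.1 s ∧
          defect S s (coproj S (M.op μ.2 ξ)) ≤ c * ‖coproj S (M.op μ.2 ξ)‖ ^ 2 := by
        intro μ
        refine h μ.1 _ ?_ ?_
        · have h1 := hF.op_mem μ.2 ξ hξ
          have h2 := hSF (sub_coproj_mem hS.isClosed (M.op μ.2 ξ))
          simpa using F.sub_mem h1 h2
        · rw [hS.op_id_coproj, M.op_id_comp]
      choose s hs hs2 using hex
      refine ⟨graftAll t s, ht.graftAll fun μ _ => hs μ, ?_⟩
      rw [defect_graftAll S ht, pow_succ', mul_assoc]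
      refine le_trans ?_ (mul_le_mul_of_nonneg_left hle hc0)
      rw [defect, Finset.mul_sum]
      refine Finset.sum_le_sum fun μ _ => ?_
      rw [← hS.defect_coproj]
      exact hs2 μ
  have hlim := (tendsto_pow_atTop_nhds_zero_of_lt_one hc0 hc).mul_const (‖ξ‖ ^ 2)
  rw [zero_mul] at hlim
  obtain ⟨n, hn⟩ := (hlim.eventually_lt_const hε).exists
  obtain ⟨t, ht, hle⟩ := key n
  exact ⟨t, ht, hle.trans_lt hn⟩

/-- A submodule that is irreducible as a module. -/
structure IsSimpleSubmodule (S : Submodule ℂ M) : Prop where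
  isSubmodule : M.IsSubmodule S
  ne_bot : S ≠ ⊥
  eq_bot_or_eq : ∀ T, M.IsSubmodule T → T ≤ S → T = ⊥ ∨ T = S

theorem isIrreducible_iff : M.IsIrreducible ↔ M.IsSimpleSubmodule ⊤ := by
  constructor
  · rintro ⟨h1, h2⟩
    exact ⟨isSubmodule_top, top_ne_bot, fun T hT _ => h2 T hT⟩
  · intro h
    refine ⟨?_, fun T hT => h.eq_bot_or_eq T hT le_top⟩
    exact (Submodule.nontrivial_iff ℂ).1 ⟨⊤, ⊥, h.ne_bot⟩

theorem IsSimpleSubmodule.le_of_inf_ne_bot {S T : Submodule ℂ M} (hS : M.IsSimpleSubmodule S)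
    (hT : M.IsSubmodule T) (h : S ⊓ T ≠ ⊥) : S ≤ T :=
  inf_eq_left.1 ((hS.eq_bot_or_eq _ (hS.isSubmodule.inf hT) inf_le_left).resolve_left h)

/-- The two alternatives have different uses. With `S` finite-dimensional, known summands lie in an
arbitrary complete submodule. With `T` finite-dimensional, an arbitrary simple summand lies in a
known `T` and is therefore finite-dimensional. -/
theorem IsComplete.le_of_isSimpleSubmodule {S T : Submodule ℂ M} (hT : M.IsComplete T)
    (hS : M.IsSimpleSubmodule S) (hfd : FiniteDimensional ℂ S ∨ FiniteDimensional ℂ T) : S ≤ T :=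
  hS.le_of_inf_ne_bot hT.isSubmodule (hT.inf_ne_bot hS.isSubmodule hS.ne_bot hfd)

theorem exists_isSimpleSubmodule_le {S : Submodule ℂ M} [FiniteDimensional ℂ S]
    (hS : M.IsSubmodule S) (hne : S ≠ ⊥) : ∃ T ≤ S, M.IsSimpleSubmodule T := by
  induction hn : Module.finrank ℂ S using Nat.strong_induction_on generalizing S with
  | _ n ih =>
    by_cases h : M.IsSimpleSubmodule S
    · exact ⟨S, le_rfl, h⟩
    obtain ⟨T, hT, hTS, h1, h2⟩ : ∃ T, M.IsSubmodule T ∧ T ≤ S ∧ T ≠ ⊥ ∧ T ≠ S := by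
      by_contra! hcon
      refine h ⟨hS, hne, fun T hT hTS => ?_⟩
      by_contra! h3
      exact h3.2 (hcon T hT hTS h3.1)
    have : FiniteDimensional ℂ T := Submodule.finiteDimensional_of_le hTS
    obtain ⟨U, hU, hU2⟩ := ih _ (hn ▸ Submodule.finrank_lt_finrank_of_lt (hTS.lt_of_ne h2)) hT h1
      rfl
    exact ⟨U, hU.trans hTS, hU2⟩

/-! ### Isometric morphisms -/

section IsometricHom

universe w'

variable {N : AMod.{u, w'} Λ} (j : N →ₗᵢ[ℂ] M)

/-- Isometric morphisms of modules. -/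
def IsIsometricHom : Prop :=
  ∀ (a b : Λ.Vertex) (f : a ⟶ b) (ξ : N), j (N.op f ξ) = M.op f (j ξ)

variable {j}

theorem IsIsometricHom.isSubmodule_map (hj : IsIsometricHom j) {S : Submodule ℂ N}
    (hS : N.IsSubmodule S) : M.IsSubmodule (S.map j.toLinearMap) := by
  refine ⟨?_, ?_⟩
  · rw [Submodule.map_coe]
    exact j.isometry.isClosedEmbedding.isClosedMap _ hS.isClosed
  · rintro a b f _ ⟨ξ, hξ, rfl⟩
    exact ⟨N.op f ξ, hS.op_mem f ξ hξ, hj _ _ f ξ⟩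

theorem IsIsometricHom.isSubmodule_comap (hj : IsIsometricHom j) {S : Submodule ℂ M}
    (hS : M.IsSubmodule S) : N.IsSubmodule (S.comap j.toLinearMap) := by
  refine ⟨hS.isClosed.preimage j.continuous, fun f ξ hξ => ?_⟩
  change j (N.op f ξ) ∈ S
  rw [hj]
  exact hS.op_mem f _ hξ

theorem comap_map_isometry (S : Submodule ℂ N) :
    (S.map j.toLinearMap).comap j.toLinearMap = S :=
  Submodule.comap_map_eq_of_injective j.injective S

theorem map_eq_bot_isometry {S : Submodule ℂ N} : S.map j.toLinearMap = ⊥ ↔ S = ⊥ := by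
  refine ⟨fun h => ?_, fun h => by rw [h, Submodule.map_bot]⟩
  rw [← comap_map_isometry (j := j) S, h]
  exact LinearMap.ker_eq_bot.2 j.injective

theorem IsIsometricHom.isSimpleSubmodule_map_iff (hj : IsIsometricHom j) {S : Submodule ℂ N} :
    M.IsSimpleSubmodule (S.map j.toLinearMap) ↔ N.IsSimpleSubmodule S := by
  constructor
  · intro h
    refine ⟨?_, fun h0 => h.ne_bot (map_eq_bot_isometry.2 h0), fun T hT hTS => ?_⟩
    · rw [← comap_map_isometry (j := j) S]
      exact hj.isSubmodule_comap h.isSubmodule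
    · rcases h.eq_bot_or_eq _ (hj.isSubmodule_map hT) (Submodule.map_mono hTS) with h1 | h1
      · exact Or.inl (map_eq_bot_isometry.1 h1)
      · exact Or.inr (Submodule.map_injective_of_injective j.injective h1)
  · intro h
    refine ⟨hj.isSubmodule_map h.isSubmodule, fun h0 => h.ne_bot (map_eq_bot_isometry.1 h0),
      fun T hT hTS => ?_⟩
    have hr : (T.comap j.toLinearMap).map j.toLinearMap = T :=
      Submodule.map_comap_eq_self (hTS.trans LinearMap.map_le_range)
    have hle : T.comap j.toLinearMap ≤ S := by
      rw [← comap_map_isometry (j := j) S]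
      exact Submodule.comap_mono hTS
    rcases h.eq_bot_or_eq _ (hj.isSubmodule_comap hT) hle with h1 | h1
    · exact Or.inl (by rw [← hr, h1, Submodule.map_bot])
    · exact Or.inr (by rw [← hr, h1])

/-- The approximating vectors already lie in the range of `j` and can be pulled back. With `j = J`
this brings complete submodules of the dilation back to the module. -/
theorem IsIsometricHom.isComplete_comap (hj : IsIsometricHom j) {S : Submodule ℂ M}
    (hS : M.IsComplete S) (hle : S ≤ LinearMap.range j.toLinearMap) :
    N.IsComplete (S.comap j.toLinearMap) := by
  refine ⟨hj.isSubmodule_comap hS.isSubmodule, fun ε hε v ξ hξ => ?_⟩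
  obtain ⟨t, ht, η, hη, hlt⟩ := hS.approx ε hε v (j ξ) (by rw [← hj, hξ])
  have hex : ∀ μ : Λ.In v, ∃ ζ : N, μ ∈ t → j ζ = η μ := by
    intro μ
    by_cases hμ : μ ∈ t
    · obtain ⟨ζ, hζ⟩ := hle (hη μ hμ)
      exact ⟨ζ, fun _ => hζ⟩
    · exact ⟨0, fun h => absurd h hμ⟩
  choose ζ hζ using hex
  refine ⟨t, ht, ζ, fun μ hμ => ?_, ?_⟩
  · change j (ζ μ) ∈ S
    rw [hζ μ hμ]
    exact hη μ hμ
  · refine lt_of_eq_of_lt (Finset.sum_congr rfl fun μ hμ => ?_) hlt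
    rw [← j.norm_map, map_sub, hζ μ hμ, hj]

/-- Transitivity of completeness through the range of `j`. -/
theorem IsIsometricHom.isComplete_map (hj : IsIsometricHom j) {S : Submodule ℂ N}
    (hS : N.IsComplete S) (hr : M.IsComplete (LinearMap.range j.toLinearMap)) :
    M.IsComplete (S.map j.toLinearMap) := by
  refine hr.trans (hj.isSubmodule_map hS.isSubmodule) ?_
  rintro v _ ⟨ξ, rfl⟩ hv ε hε
  have hv' : N.op (𝟙 v) ξ = ξ := j.injective (by rw [hj]; exact hv)
  obtain ⟨t, ht, hlt⟩ := (isComplete_iff.1 hS).2 v ξ hv' ε hε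
  refine ⟨t, ht, lt_of_le_of_lt (Finset.sum_le_sum fun μ _ => ?_) hlt⟩
  refine pow_le_pow_left₀ (norm_nonneg _) ?_ 2
  have hmem := sub_coproj_mem hS.isSubmodule.isClosed (N.op μ.2 ξ)
  refine (norm_coproj_le_sub (S := S.map j.toLinearMap) (M.op μ.2 (j ξ))
    (Submodule.mem_map_of_mem hmem)).trans ?_
  change ‖M.op μ.2 (j ξ) - j (N.op μ.2 ξ - coproj S (N.op μ.2 ξ))‖ ≤ _
  rw [← hj, ← map_sub, j.norm_map, sub_sub_cancel]

end IsometricHom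

/-- The inclusion of a submodule. -/
noncomputable def inclusion (S : Submodule ℂ M) (hS : M.IsSubmodule S) :
    M.restrict S hS →ₗᵢ[ℂ] M := S.subtypeₗᵢ

theorem isIsometricHom_inclusion (S : Submodule ℂ M) (hS : M.IsSubmodule S) :
    IsIsometricHom (M.inclusion S hS) := fun _ _ _ _ => rfl

theorem inclusion_mem {S : Submodule ℂ M} (hS : M.IsSubmodule S) (ξ : M.restrict S hS) :
    M.inclusion S hS ξ ∈ S := Subtype.property (p := (· ∈ S)) ξ

theorem exists_inclusion_eq {S : Submodule ℂ M} (hS : M.IsSubmodule S) {ξ : M} (h : ξ ∈ S) :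
    ∃ η, M.inclusion S hS η = ξ := ⟨(⟨ξ, h⟩ : S), rfl⟩

theorem range_inclusion {S : Submodule ℂ M} (hS : M.IsSubmodule S) :
    LinearMap.range (M.inclusion S hS).toLinearMap = S := by
  refine le_antisymm ?_ fun ξ h => exists_inclusion_eq hS h
  rintro _ ⟨ξ, rfl⟩
  exact inclusion_mem hS ξ

theorem restrict_isIrreducible_iff {S : Submodule ℂ M} (hS : M.IsSubmodule S) :
    (M.restrict S hS).IsIrreducible ↔ M.IsSimpleSubmodule S := by
  rw [isIrreducible_iff, ← (isIsometricHom_inclusion S hS).isSimpleSubmodule_map_iff,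
    Submodule.map_top, range_inclusion]

/-! ### Decompositions -/

namespace Decomposition

variable {n : ℕ} (D : M.Decomposition n)

theorem isSimpleSubmodule (i : Fin n) : M.IsSimpleSubmodule (D.summand i) :=
  (restrict_isIrreducible_iff (D.isSubmodule i)).1 (D.isIrreducible i)

/-- In `x = d + z` the residual part `z` is orthogonal to the sum; so `d` is both in the sum and
orthogonal to it. No closedness of the two parts is needed. -/
theorem orthogonal_sum_le : D.sumᗮ ≤ D.residue := by
  intro x hx
  have hx' : x ∈ D.sum ⊔ D.residue := by
    have := D.sup_eq_top
    change D.sum ⊔ _ = ⊤ at this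
    rw [this]
    trivial
  obtain ⟨d, hd, z, hz, rfl⟩ := Submodule.mem_sup.1 hx'
  have hle : D.sum ≤ D.residueᗮ := iSup_le fun i => D.orthogonal_residue i
  have hzd : z ∈ D.sumᗮ := Submodule.IsOrtho.symm hle hz
  have : d ∈ D.sumᗮ := by simpa using D.sumᗮ.sub_mem hx hzd
  have h0 : ⟪d, d⟫_ℂ = 0 := Submodule.inner_right_of_mem_orthogonal hd this
  rw [inner_self_eq_zero.1 h0, zero_add]
  exact hz

theorem isResidual_orthogonal_sum : M.IsResidual D.sumᗮ := fun S hS h =>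
  D.isResidual S hS (h.trans D.orthogonal_sum_le)

/-- Without summands the residue would be the whole module, which is itself a nonzero submodule. -/
theorem one_le {n : ℕ} (D : M.Decomposition n) [Nontrivial M] : 1 ≤ n := by
  rcases Nat.eq_zero_or_pos n with rfl | h
  · have h := D.sup_eq_top
    rw [iSup_of_empty, bot_sup_eq] at h
    exact absurd (D.isResidual ⊤ isSubmodule_top h.ge) top_ne_bot
  · exact h

variable {F : Submodule ℂ M} [FiniteDimensional ℂ F]

theorem summand_le (hF : M.IsComplete F) (i : Fin n) : D.summand i ≤ F :=
  hF.le_of_isSimpleSubmodule (D.isSimpleSubmodule i) (Or.inr inferInstance)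

theorem finiteDimensional_summand (hF : M.IsComplete F) (i : Fin n) :
    FiniteDimensional ℂ (D.summand i) := Submodule.finiteDimensional_of_le (D.summand_le hF i)

/-- `F` contains all summands, and on `F` the defect of their sum can be made small because the
complement of the sum is residual; transitivity extends this to the module. Minimality holds summand
by summand. -/
theorem isSmallestComplete_sum (hF : M.IsComplete F) : M.IsSmallestComplete D.sum := by
  have hfd := D.finiteDimensional_summand hF
  have hsub : M.IsSubmodule D.sum := isSubmodule_iSup D.isSubmodule
  refine ⟨hF.trans hsub fun v ξ hξ _ => exists_defect_lt_of_isResidual hF.isSubmodule hsub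
    (iSup_le (D.summand_le hF)) D.isResidual_orthogonal_sum v ξ hξ, fun T hT => ?_⟩
  exact iSup_le fun i => IsComplete.le_of_isSimpleSubmodule hT (D.isSimpleSubmodule i)
    (Or.inl (hfd i))

end Decomposition

/-- Choose an orthogonal family of simple submodules of `F` that cannot be enlarged; its size is
bounded by the dimension of `F`. A nonzero submodule in the complement would meet `F`, because `F`
is complete, and so contain one more simple submodule. -/
theorem exists_decomposition {F : Submodule ℂ M} [FiniteDimensional ℂ F] (hF : M.IsComplete F) :
    ∃ n, Nonempty (M.Decomposition n) := by
  let P : ℕ → Prop := fun n => ∃ S : Fin n → Submodule ℂ M,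
    (∀ i, M.IsSimpleSubmodule (S i)) ∧ (∀ i, S i ≤ F) ∧ ∀ i j, i ≠ j → S i ⟂ S j
  have hP0 : P 0 := ⟨fun _ => ⊥, fun i => i.elim0, fun i => i.elim0, fun i => i.elim0⟩
  have hbound : ∀ n, P n → n ≤ Module.finrank ℂ F := by
    rintro n ⟨S, h1, h2, h3⟩
    choose x hx hx0 using fun i => (S i).exists_mem_ne_zero_of_ne_bot (h1 i).ne_bot
    have hli : LinearIndependent ℂ (fun i => (⟨x i, h2 i (hx i)⟩ : F)) :=
      linearIndependent_of_ne_zero_of_inner_eq_zero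
        (fun i h => hx0 i (congrArg Subtype.val h))
        (fun i j hij => (h3 i j hij).inner_eq (hx i) (hx j))
    simpa using hli.fintype_card_le_finrank
  obtain ⟨n, ⟨S, h1, h2, h3⟩, hn⟩ : ∃ n, P n ∧ ¬ P (n + 1) := by
    by_contra! h
    have : ∀ n, P n := fun n => Nat.rec hP0 h n
    exact absurd (hbound _ (this (Module.finrank ℂ F + 1))) (by omega)
  have hfd : ∀ i, FiniteDimensional ℂ (S i) := fun i => Submodule.finiteDimensional_of_le (h2 i)
  refine ⟨n, ⟨⟨S, (⨆ i, S i)ᗮ, fun i => (h1 i).isSubmodule,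
    fun i => (restrict_isIrreducible_iff _).2 (h1 i), fun N hN hle => ?_, h3,
    fun i => (le_iSup S i).trans (Submodule.le_orthogonal_orthogonal _),
    Submodule.sup_orthogonal_of_hasOrthogonalProjection⟩⟩⟩
  by_contra hne
  have hfd' : FiniteDimensional ℂ (N ⊓ F : Submodule ℂ M) :=
    Submodule.finiteDimensional_of_le inf_le_right
  obtain ⟨T, hT, hTs⟩ := exists_isSimpleSubmodule_le (hN.inf hF.isSubmodule)
    (hF.inf_ne_bot hN hne (Or.inr inferInstance))
  have hTS : ∀ i, T ⟂ S i := fun i =>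
    (hT.trans inf_le_left).trans (hle.trans (Submodule.orthogonal_le (le_iSup S i)))
  refine hn ⟨Fin.cons T S, ?_, ?_, ?_⟩
  · intro i
    cases i using Fin.cases with
    | zero => exact hTs
    | succ i => exact h1 i
  · intro i
    cases i using Fin.cases with
    | zero => exact hT.trans inf_le_right
    | succ i => exact h2 i
  · intro i j hij
    cases i using Fin.cases with
    | zero =>
      cases j using Fin.cases with
      | zero => exact absurd rfl hij
      | succ j => exact hTS j
    | succ i =>
      cases j using Fin.cases with
      | zero => exact (hTS i).symm
      | succ j => exact h3 i j fun h => hij (congrArg _ h)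

end AMod

end SimpleSubmodules

/-! ### Representations along trees, and images of simple submodules -/

section Representations

variable {k : ℕ} {Λ : KGraph.{u} k} [Λ.RowFinite]

namespace ORep

universe w'

variable {L : ORep.{u, w} Λ} {L' : ORep.{u, w'} Λ}

theorem adjoint_op_id (v : Λ.Vertex) : ContinuousLinearMap.adjoint (L.op (𝟙 v)) = L.op (𝟙 v) :=
  (L.isStarProjection_op v).isSelfAdjoint

theorem op_id_op {a b : Λ.Vertex} (f : a ⟶ b) (x : L) : L.op (𝟙 b) (L.op f x) = L.op f x := by
  have := L.op_comp f (𝟙 b)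
  rw [Category.comp_id] at this
  exact (DFunLike.congr_fun this x).symm

theorem op_op_id {a b : Λ.Vertex} (f : a ⟶ b) (x : L) : L.op f (L.op (𝟙 a) x) = L.op f x := by
  have := L.op_comp (𝟙 a) f
  rw [Category.id_comp] at this
  exact (DFunLike.congr_fun this x).symm

theorem adjoint_op_op {a b : Λ.Vertex} (f : a ⟶ b) (x : L) :
    ContinuousLinearMap.adjoint (L.op f) (L.op f x) = L.op (𝟙 a) x :=
  DFunLike.congr_fun (L.adjoint_op_comp_op f) x

theorem op_id_adjoint {a b : Λ.Vertex} (f : a ⟶ b) (x : L) :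
    L.op (𝟙 a) (ContinuousLinearMap.adjoint (L.op f) x) =
      ContinuousLinearMap.adjoint (L.op f) x := by
  have := L.toAMod.op_id_comp f x
  change ContinuousLinearMap.adjoint (L.op (𝟙 a)) _ = _ at this
  rwa [adjoint_op_id] at this

theorem adjoint_op_id_apply {a b : Λ.Vertex} (f : a ⟶ b) (x : L) :
    ContinuousLinearMap.adjoint (L.op f) (L.op (𝟙 b) x) =
      ContinuousLinearMap.adjoint (L.op f) x := by
  have := L.toAMod.op_comp_id f x
  change ContinuousLinearMap.adjoint (L.op f) (ContinuousLinearMap.adjoint (L.op (𝟙 b)) x) = _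
    at this
  rwa [adjoint_op_id] at this

theorem inner_op_op {a b : Λ.Vertex} (f : a ⟶ b) (x y : L) :
    ⟪L.op f x, L.op f y⟫_ℂ = ⟪x, L.op (𝟙 a) y⟫_ℂ := by
  rw [← ContinuousLinearMap.adjoint_inner_right, adjoint_op_op]

theorem norm_op {a b : Λ.Vertex} (f : a ⟶ b) (x : L) : ‖L.op f x‖ = ‖L.op (𝟙 a) x‖ := by
  have h : ⟪L.op f x, L.op f x⟫_ℂ = ⟪L.op (𝟙 a) x, L.op (𝟙 a) x⟫_ℂ := by
    rw [inner_op_op, inner_op_op]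
  rw [inner_self_eq_norm_sq_to_K, inner_self_eq_norm_sq_to_K] at h
  have h2 : ‖L.op f x‖ ^ 2 = ‖L.op (𝟙 a) x‖ ^ 2 := by exact_mod_cast h
  exact (sq_eq_sq₀ (norm_nonneg _) (norm_nonneg _)).1 h2

theorem norm_op_le {a b : Λ.Vertex} (f : a ⟶ b) (x : L) : ‖L.op f x‖ ≤ ‖x‖ := by
  rw [norm_op]
  have h := inner_op_op (L := L) (𝟙 a) x x
  have h2 := norm_inner_le_norm (𝕜 := ℂ) x (L.op (𝟙 a) x)
  rw [← h, inner_self_eq_norm_sq_to_K] at h2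
  have h3 : ‖L.op (𝟙 a) x‖ ^ 2 ≤ ‖x‖ * ‖L.op (𝟙 a) x‖ := by simpa using h2
  by_contra! hlt
  nlinarith [norm_nonneg x]

/-- Pythagoras writes `‖X_μ x‖ ^ 2` as a sum over the leaves, and the term of `μ` alone exhausts it;
so all other terms vanish. -/
theorem adjoint_op_tree {v : Λ.Vertex} {t : Finset (Λ.In v)} (ht : IsTree v t) {μ ν : Λ.In v}
    (hμ : μ ∈ t) (hν : ν ∈ t) (hne : ν ≠ μ) (x : L) :
    ContinuousLinearMap.adjoint (L.op ν.2) (L.op μ.2 x) = 0 := by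
  classical
  have h : ∑ κ ∈ t, ‖ContinuousLinearMap.adjoint (L.op κ.2) (L.op μ.2 x)‖ ^ 2 =
      ‖ContinuousLinearMap.adjoint (L.op (𝟙 v)) (L.op μ.2 x)‖ ^ 2 :=
    L.toAMod.sum_tree_norm_sq ht (L.op μ.2 x)
  rw [adjoint_op_id, op_id_op, norm_op, ← Finset.add_sum_erase _ _ hμ, adjoint_op_op,
    add_eq_left] at h
  have h2 := (Finset.sum_eq_zero_iff_of_nonneg fun _ _ => sq_nonneg _).1 h ν
    (Finset.mem_erase.2 ⟨hne, hν⟩)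
  simpa using h2

theorem inner_sum_tree {v : Λ.Vertex} {t : Finset (Λ.In v)} (ht : IsTree v t)
    (x y : Λ.In v → L) :
    ⟪∑ μ ∈ t, L.op μ.2 (x μ), ∑ μ ∈ t, L.op μ.2 (y μ)⟫_ℂ =
      ∑ μ ∈ t, ⟪x μ, L.op (𝟙 μ.1) (y μ)⟫_ℂ := by
  rw [sum_inner]
  refine Finset.sum_congr rfl fun μ hμ => ?_
  rw [inner_sum, Finset.sum_eq_single_of_mem μ hμ, inner_op_op]
  intro ν hν hne
  rw [← ContinuousLinearMap.adjoint_inner_right, adjoint_op_tree ht hν hμ hne.symm,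
    inner_zero_right]

theorem norm_sum_tree_sq_le {v : Λ.Vertex} {t : Finset (Λ.In v)} (ht : IsTree v t)
    (x : Λ.In v → L) : ‖∑ μ ∈ t, L.op μ.2 (x μ)‖ ^ 2 ≤ ∑ μ ∈ t, ‖x μ‖ ^ 2 := by
  rw [norm_sq_eq_re_inner (𝕜 := ℂ), inner_sum_tree ht, map_sum]
  refine Finset.sum_le_sum fun μ _ => ?_
  refine (re_inner_le_norm _ _).trans ?_
  rw [sq]
  exact mul_le_mul_of_nonneg_left (norm_op_le _ _) (norm_nonneg _)

theorem sum_tree_op_adjoint {v : Λ.Vertex} {t : Finset (Λ.In v)} (ht : IsTree v t) (x : L) :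
    ∑ μ ∈ t, L.op μ.2 (ContinuousLinearMap.adjoint (L.op μ.2) x) = L.op (𝟙 v) x := by
  refine ext_inner_left ℂ fun y => ?_
  have h : ∑ μ ∈ t, ⟪ContinuousLinearMap.adjoint (L.op μ.2) y,
      ContinuousLinearMap.adjoint (L.op μ.2) x⟫_ℂ =
      ⟪ContinuousLinearMap.adjoint (L.op (𝟙 v)) y,
        ContinuousLinearMap.adjoint (L.op (𝟙 v)) x⟫_ℂ := L.toAMod.sum_tree_inner ht y x
  rw [adjoint_op_id, inner_op_op] at h
  rw [inner_sum, ← h]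
  exact Finset.sum_congr rfl fun μ _ => (ContinuousLinearMap.adjoint_inner_left _ _ _).symm

/-- An operator that intertwines the generators intertwines their adjoints. -/
theorem intertwines_adjoint {T : L →L[ℂ] L'}
    (hT : ∀ (a b : Λ.Vertex) (f : a ⟶ b) (x : L), T (L.op f x) = L'.op f (T x))
    {a b : Λ.Vertex} (f : a ⟶ b) (x : L) :
    T (ContinuousLinearMap.adjoint (L.op f) x) = ContinuousLinearMap.adjoint (L'.op f) (T x) := by
  -- Resolve `x` along a tree that has `f` as a leaf. After `T`, the adjoint of `X_f` in `L'`
  -- annihilates the terms of all other leaves.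
  obtain ⟨t, ht, hμ⟩ := exists_isTree_mem (⟨a, f⟩ : Λ.In b)
  rw [← adjoint_op_id_apply f (T x), ← hT, ← sum_tree_op_adjoint ht, map_sum, map_sum,
    Finset.sum_eq_single_of_mem _ hμ]
  · rw [hT, adjoint_op_op, ← hT, op_id_adjoint]
  · intro ν hν hne
    rw [hT]
    exact adjoint_op_tree ht hν hμ hne.symm _

theorem Iso.symm {L L' : ORep.{u, w} Λ} : L.Iso L' → L'.Iso L := by
  rintro ⟨θ, hθ⟩
  refine ⟨θ.symm, fun f x => ⟨?_, ?_⟩⟩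
  · rw [ContinuousLinearEquiv.symm_apply_eq, (hθ f _).1, θ.apply_symm_apply]
  · rw [ContinuousLinearEquiv.symm_apply_eq, (hθ f _).2, θ.apply_symm_apply]

theorem Iso.trans {L₁ L₂ L₃ : ORep.{u, w} Λ} : L₁.Iso L₂ → L₂.Iso L₃ → L₁.Iso L₃ := by
  rintro ⟨θ, hθ⟩ ⟨τ, hτ⟩
  refine ⟨θ.trans τ, fun f x => ⟨?_, ?_⟩⟩
  · simp only [ContinuousLinearEquiv.trans_apply, (hθ f _).1, (hτ f _).1]
  · simp only [ContinuousLinearEquiv.trans_apply, (hθ f _).2, (hτ f _).2]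

/-- A bijective isometry that intertwines the generators is an isomorphism. -/
theorem iso_of_isometry {L L' : ORep.{u, w} Λ} (T : L →ₗᵢ[ℂ] L')
    (hT : ∀ (a b : Λ.Vertex) (f : a ⟶ b) (x : L), T (L.op f x) = L'.op f (T x))
    (hs : Function.Surjective T) : L.Iso L' :=
  ⟨(LinearIsometryEquiv.ofSurjective T hs).toContinuousLinearEquiv, fun f x =>
    ⟨hT _ _ f x, intertwines_adjoint (T := T.toContinuousLinearMap) hT f x⟩⟩

theorem IsSubrep.orthogonal {R : Submodule ℂ L} (hR : L.IsSubrep R) : L.IsSubrep Rᗮ := by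
  refine ⟨R.isClosed_orthogonal, fun f x hx => ?_, fun f x hx => ?_⟩
  · rw [Submodule.mem_orthogonal] at hx ⊢
    intro y hy
    rw [← ContinuousLinearMap.adjoint_inner_left]
    exact hx _ (hR.adjoint_mem f y hy)
  · rw [Submodule.mem_orthogonal] at hx ⊢
    intro y hy
    rw [ContinuousLinearMap.adjoint_inner_right]
    exact hx _ (hR.op_mem f y hy)

theorem isSubrep_range {T : L →ₗᵢ[ℂ] L'}
    (hT : ∀ (a b : Λ.Vertex) (f : a ⟶ b) (x : L), T (L.op f x) = L'.op f (T x)) :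
    L'.IsSubrep (LinearMap.range T.toLinearMap) := by
  refine ⟨?_, ?_, ?_⟩
  · rw [LinearMap.coe_range]
    exact T.isometry.isClosedEmbedding.isClosed_range
  · rintro a b f _ ⟨x, rfl⟩
    exact ⟨_, hT _ _ f x⟩
  · rintro a b f _ ⟨x, rfl⟩
    exact ⟨_, intertwines_adjoint (T := T.toContinuousLinearMap) hT f x⟩

/-- A subrepresentation that contains a complete submodule is everything. -/
theorem IsSubrep.eq_top {R : Submodule ℂ L} (hR : L.IsSubrep R) {S : Submodule ℂ L.toAMod}
    (hS : L.toAMod.IsComplete S) (hle : ∀ x : L, (x : L.toAMod) ∈ S → x ∈ R) : R = ⊤ := by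
  refine (Submodule.eq_top_iff').2 fun x => ?_
  suffices h : ∀ v, L.op (𝟙 v) x ∈ R from
    hR.isClosed.mem_of_tendsto (L.nondegenerate x)
      (Filter.Eventually.of_forall fun s => R.sum_mem fun v _ => h v)
  intro v
  rw [← SetLike.mem_coe, ← hR.isClosed.closure_eq, Metric.mem_closure_iff]
  intro ε hε
  obtain ⟨t, ht, (η : Λ.In v → L), hη, hlt⟩ := hS.approx ε hε v (L.op (𝟙 v) x) (by
    change ContinuousLinearMap.adjoint (L.op (𝟙 v)) _ = _
    rw [adjoint_op_id, op_id_op])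
  -- The sum lies in `R`, and `X_v x` is the sum of the `X_μ X_μ^* X_v x`. The error is controlled
  -- since distinct leaves have orthogonal ranges.
  refine ⟨∑ μ ∈ t, L.op μ.2 (η μ),
    R.sum_mem fun μ hμ => hR.op_mem _ _ (hle _ (hη μ hμ)), ?_⟩
  have h1 : L.op (𝟙 v) x - ∑ μ ∈ t, L.op μ.2 (η μ) = ∑ μ ∈ t,
      L.op μ.2 (ContinuousLinearMap.adjoint (L.op μ.2) (L.op (𝟙 v) x) - η μ) := by
    have := sum_tree_op_adjoint ht (L.op (𝟙 v) x)
    rw [op_id_op] at this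
    simp only [map_sub, Finset.sum_sub_distrib, this]
  rw [dist_eq_norm, h1]
  refine lt_of_pow_lt_pow_left₀ 2 hε.le ?_
  exact (norm_sum_tree_sq_le ht _).trans_lt hlt

/-- Invariance under the adjoints makes the complement invariant as well. -/
theorem IsSubrep.starProjection_op {R : Submodule ℂ L} [R.HasOrthogonalProjection]
    (hR : L.IsSubrep R) {a b : Λ.Vertex} (f : a ⟶ b) (x : L) :
    R.starProjection (L.op f x) = L.op f (R.starProjection x) := by
  refine Submodule.eq_starProjection_of_mem_of_inner_eq_zero
    (hR.op_mem f _ (R.starProjection_apply_mem x)) ?_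
  intro y hy
  rw [← map_sub, ← ContinuousLinearMap.adjoint_inner_right]
  exact R.starProjection_inner_eq_zero x _ (hR.adjoint_mem f y hy)

end ORep

namespace AMod

section Images

universe w'

variable {M : AMod.{u, w} Λ} {N : AMod.{u, w'} Λ}

/-- The image of a finite-dimensional irreducible submodule under a morphism is zero or
irreducible. -/
theorem IsSimpleSubmodule.map_eq_bot_or {S : Submodule ℂ M} [FiniteDimensional ℂ S]
    (hS : M.IsSimpleSubmodule S) (θ : M →L[ℂ] N)
    (hθ : ∀ (a b : Λ.Vertex) (f : a ⟶ b) (ξ : M), θ (M.op f ξ) = N.op f (θ ξ)) :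
    S.map (θ : M →ₗ[ℂ] N) = ⊥ ∨ N.IsSimpleSubmodule (S.map (θ : M →ₗ[ℂ] N)) := by
  refine or_iff_not_imp_left.2 fun hne => ⟨isSubmodule_of_finiteDimensional ?_, hne, ?_⟩
  · rintro a b f _ ⟨ξ, hξ, rfl⟩
    exact ⟨_, hS.isSubmodule.op_mem f ξ hξ, hθ _ _ f ξ⟩
  · intro T hT hTS
    have hcomap : M.IsSubmodule (T.comap (θ : M →ₗ[ℂ] N)) := by
      refine ⟨hT.isClosed.preimage θ.continuous, fun f ξ hξ => ?_⟩
      change θ (M.op f ξ) ∈ T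
      rw [hθ]
      exact hT.op_mem f _ hξ
    rcases hS.eq_bot_or_eq _ (hS.isSubmodule.inf hcomap) inf_le_left with h | h
    · refine Or.inl (eq_bot_iff.2 fun y hy => ?_)
      obtain ⟨ξ, hξ, rfl⟩ := hTS hy
      have : ξ ∈ S ⊓ T.comap (θ : M →ₗ[ℂ] N) := ⟨hξ, hy⟩
      rw [h, Submodule.mem_bot] at this
      rw [this, map_zero]
      exact zero_mem _
    · exact Or.inr (le_antisymm hTS (Submodule.map_le_iff_le_comap.2 (inf_eq_left.1 h)))

/-- The image is zero or again simple and finite-dimensional. Applied to summands, this is why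
morphisms respect smallest complete submodules. -/
theorem IsComplete.map_le_of_isSimpleSubmodule {S : Submodule ℂ M} [FiniteDimensional ℂ S]
    (hS : M.IsSimpleSubmodule S) (θ : M →L[ℂ] N)
    (hθ : ∀ (a b : Λ.Vertex) (f : a ⟶ b) (ξ : M), θ (M.op f ξ) = N.op f (θ ξ))
    {T : Submodule ℂ N} (hT : N.IsComplete T) : S.map (θ : M →ₗ[ℂ] N) ≤ T := by
  rcases hS.map_eq_bot_or θ hθ with h | h
  · rw [h]
    exact bot_le
  · exact hT.le_of_isSimpleSubmodule h (Or.inl inferInstance)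

/-- Isomorphisms preserve completeness. -/
theorem IsComplete.map_equiv {S : Submodule ℂ M} (hS : M.IsComplete S) (θ : M ≃L[ℂ] N)
    (hθ : ∀ (a b : Λ.Vertex) (f : a ⟶ b) (ξ : M), θ (M.op f ξ) = N.op f (θ ξ)) :
    N.IsComplete (S.map (θ : M →ₗ[ℂ] N)) := by
  refine ⟨⟨?_, ?_⟩, fun ε hε v η hη => ?_⟩
  · rw [Submodule.map_coe]
    exact θ.toHomeomorph.isClosedMap _ hS.isSubmodule.isClosed
  · rintro a b f _ ⟨ξ, hξ, rfl⟩
    exact ⟨_, hS.isSubmodule.op_mem f ξ hξ, hθ _ _ f ξ⟩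
  · obtain ⟨ξ, rfl⟩ := θ.surjective η
    have hξ : M.op (𝟙 v) ξ = ξ := θ.injective (by rw [hθ]; exact hη)
    -- The `1` keeps `C` positive when `θ` has norm zero.
    set C := ‖(θ : M →L[ℂ] N)‖ + 1 with hC
    have hCpos : 0 < C := by positivity
    obtain ⟨t, ht, ζ, hζ, hlt⟩ := hS.approx (ε / C) (by positivity) v ξ hξ
    refine ⟨t, ht, fun μ => θ (ζ μ), fun μ hμ => Submodule.mem_map_of_mem (hζ μ hμ), ?_⟩
    have hle : ∀ μ ∈ t, ‖N.op μ.2 (θ ξ) - θ (ζ μ)‖ ^ 2 ≤ C ^ 2 * ‖M.op μ.2 ξ - ζ μ‖ ^ 2 := by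
      intro μ _
      rw [← hθ, ← map_sub, ← mul_pow]
      refine pow_le_pow_left₀ (norm_nonneg _) ?_ 2
      refine ((θ : M →L[ℂ] N).le_opNorm _).trans ?_
      exact mul_le_mul_of_nonneg_right (by linarith) (norm_nonneg _)
    refine (Finset.sum_le_sum hle).trans_lt ?_
    rw [← Finset.mul_sum]
    rw [div_pow, lt_div_iff₀ (by positivity)] at hlt
    linarith

end Images

end AMod

namespace ORep

variable {L : ORep.{u, w} Λ}

/-- A representation that is generated by a finite-dimensional irreducible module is
irreducible. -/
theorem isIrreducible_of_isSimpleSubmodule {S : Submodule ℂ L.toAMod} [FiniteDimensional ℂ S]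
    (hS : L.toAMod.IsSimpleSubmodule S) (hc : L.toAMod.IsComplete S) : L.IsIrreducible := by
  obtain ⟨x, -, hx0⟩ := S.exists_mem_ne_zero_of_ne_bot hS.ne_bot
  refine ⟨⟨⟨x, 0, hx0⟩⟩, fun R hR => ?_⟩
  have : CompleteSpace R := hR.isClosed.completeSpace_coe
  -- The projection to a subrepresentation is an endomorphism of the module. It maps `S` into `S`,
  -- as `S` is complete, so by simplicity `P(S)` is zero or `S`. Accordingly `S` lies in `Rᗮ` or in
  -- `R`, and `S` generates `L`.
  let P : L.toAMod →L[ℂ] L.toAMod := R.starProjection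
  have hP : ∀ (a b : Λ.Vertex) (f : a ⟶ b) (ξ : L.toAMod),
      P (L.toAMod.op f ξ) = L.toAMod.op f (P ξ) := fun a b f ξ =>
    intertwines_adjoint (T := R.starProjection) (fun a b f x => hR.starProjection_op f x) f ξ
  have hle := hc.map_le_of_isSimpleSubmodule hS P hP
  rcases hS.map_eq_bot_or P hP with h | h
  · left
    rw [← Submodule.orthogonal_eq_top_iff]
    refine hR.orthogonal.eq_top hc fun x hx => ?_
    refine (Submodule.starProjection_apply_eq_zero_iff R).1 ?_
    have : P x ∈ S.map (P : L.toAMod →ₗ[ℂ] L.toAMod) := Submodule.mem_map_of_mem hx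
    rw [h] at this
    exact this
  · right
    rcases hS.eq_bot_or_eq _ h.isSubmodule hle with h' | h'
    · exact absurd h' h.ne_bot
    · refine hR.eq_top hc fun x hx => ?_
      rw [← h'] at hx
      obtain ⟨y, -, rfl⟩ := hx
      exact R.starProjection_apply_mem (y : L)

end ORep

end Representations

/-! ### The universal property of the dilation -/

section Lifts

variable {k : ℕ} {Λ : KGraph.{u} k} [Λ.RowFinite]

namespace AMod

universe w₁ w₂

variable {M : AMod.{u, w} Λ} {N : AMod.{u, w₁} Λ} {L : ORep.{u, w₂} Λ}

/-- Morphisms from a module to (the module of) a representation. -/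
def IsRepHom (θ : M →L[ℂ] L) : Prop :=
  ∀ (a b : Λ.Vertex) (f : a ⟶ b) (ξ : M),
    θ (M.op f ξ) = ContinuousLinearMap.adjoint (L.op f) (θ ξ)

theorem IsRepHom.op_id {θ : M →L[ℂ] L} (hθ : IsRepHom θ) (v : Λ.Vertex) (ξ : M) :
    L.op (𝟙 v) (θ ξ) = θ (M.op (𝟙 v) ξ) := by
  rw [hθ, ORep.adjoint_op_id]

/-- The map `(μ, ξ) ↦ X_μ θ(ξ)` on formal linear combinations. -/
noncomputable def formalLift (θ : M →L[ℂ] L) (v : Λ.Vertex) : M.Formal v →ₗ[ℂ] L :=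
  Finsupp.lsum ℂ (fun μ : Λ.In v => ((L.op μ.2 ∘L θ : M →L[ℂ] L) : M →ₗ[ℂ] L))

theorem formalLift_single (θ : M →L[ℂ] L) {v : Λ.Vertex} (μ : Λ.In v) (ξ : M) :
    formalLift θ v (Formal.single μ ξ) = L.op μ.2 (θ ξ) :=
  Finsupp.sum_single_index (map_zero _)

theorem formalLift_apply (θ : M →L[ℂ] L) {v : Λ.Vertex} (x : M.Formal v) :
    formalLift θ v x = ∑ μ ∈ (Formal.coeff x).support, L.op μ.2 (θ (Formal.coeff x μ)) := rfl

theorem hasSum_norm_op_id_sq (y : L) : HasSum (fun v => ‖L.op (𝟙 v) y‖ ^ 2) (‖y‖ ^ 2) := by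
  have h := L.toAMod.hasSum_norm_sq y
  have e : ∀ v, L.toAMod.op (𝟙 v) = L.op (𝟙 v) := fun v => ORep.adjoint_op_id v
  simp only [e] at h
  exact h

theorem _root_.ORep.op_op_of_ne {a b c d : Λ.Vertex} (f : a ⟶ b) (g : c ⟶ d) (h : a ≠ d) (x : L) :
    L.op f (L.op g x) = 0 := by
  have := DFunLike.congr_fun (L.op_orthogonal a d h) (L.op g x)
  simp only [ContinuousLinearMap.comp_apply, zero_apply] at this
  rw [← ORep.op_op_id f, ← ORep.op_id_op g, this, map_zero]

variable [Λ.LocallyConvex]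

/-- Insert the resolution of the source projection of `μ` along a cut and move the adjoints through
`θ`. Leaves `ν` that do not extend `μ` have zero transfer. -/
theorem IsRepHom.op_eq_sum_cut {θ : M →L[ℂ] L} (hθ : IsRepHom θ) {v : Λ.Vertex} (μ : Λ.In v)
    {m : Fin k → ℕ} (hm : Λ.deg μ.2 ≤ m) (ξ : M) :
    L.op μ.2 (θ ξ) = ∑ ν ∈ cut v m, L.op ν.2 (θ (M.transfer μ ν ξ)) := by
  classical
  obtain ⟨p, rfl⟩ := exists_add_of_le hm
  have hsub : (cut μ.1 p).image (ext μ) ⊆ cut v (Λ.deg μ.2 + p) := by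
    intro ν hν
    obtain ⟨α, hα, rfl⟩ := Finset.mem_image.1 hν
    exact ext_mem_cut.2 hα
  rw [← Finset.sum_subset hsub, Finset.sum_image fun α _ β _ h => ext_injective μ h]
  · rw [← ORep.op_op_id, ← ORep.sum_tree_op_adjoint (isTree_cut μ.1 p), map_sum]
    refine Finset.sum_congr rfl fun α _ => ?_
    rw [M.transfer_ext, hθ]
    exact (DFunLike.congr_fun (L.op_comp α.2 μ.2) _).symm
  · intro ν hν hn
    rw [M.transfer_eq_zero, zero_apply, map_zero, map_zero]
    rintro α rfl
    exact hn (Finset.mem_image_of_mem _ (ext_mem_cut.1 hν))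

theorem IsRepHom.formalLift_eq {θ : M →L[ℂ] L} (hθ : IsRepHom θ) {v : Λ.Vertex} {x : M.Formal v}
    {m : Fin k → ℕ} (hx : x.height ≤ m) :
    formalLift θ v x = ∑ ν ∈ cut v m, L.op ν.2 (θ (Formal.val ν x)) := by
  simp only [formalLift_apply, Formal.val_apply, map_sum]
  rw [Finset.sum_comm]
  exact Finset.sum_congr rfl fun μ hμ =>
    hθ.op_eq_sum_cut μ ((Formal.deg_le_height hμ).trans hx) _

/-- At a common level the ranges of distinct leaves are orthogonal, so only inner products of values
of `θ` and `τ` remain. Both the boundedness of lifts and their comparison rest on this. -/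
theorem IsRepHom.inner_formalLift {θ : M →L[ℂ] L} (hθ : IsRepHom θ) {τ : N →L[ℂ] L}
    (hτ : IsRepHom τ) {v : Λ.Vertex} {x : M.Formal v} {y : N.Formal v}
    {m : Fin k → ℕ} (hx : x.height ≤ m) (hy : y.height ≤ m) :
    ⟪formalLift θ v x, formalLift τ v y⟫_ℂ =
      ∑ ν ∈ cut v m, ⟪θ (Formal.val ν x), τ (Formal.val ν y)⟫_ℂ := by
  rw [hθ.formalLift_eq hx, hτ.formalLift_eq hy, ORep.inner_sum_tree (isTree_cut v m)]
  refine Finset.sum_congr rfl fun ν _ => ?_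
  rw [hτ.op_id, Formal.op_id_val]

theorem IsRepHom.norm_formalLift_le {θ : M →L[ℂ] L} (hθ : IsRepHom θ) {v : Λ.Vertex}
    (x : M.Formal v) : ‖formalLift θ v x‖ ≤ ‖θ‖ * ‖x‖ := by
  refine (sq_le_sq₀ (norm_nonneg _) (by positivity)).1 ?_
  rw [mul_pow, norm_sq_eq_re_inner (𝕜 := ℂ), norm_sq_eq_re_inner (𝕜 := ℂ) x,
    hθ.inner_formalLift hθ le_rfl le_rfl, Formal.inner_def, Formal.form_eq le_rfl le_rfl,
    Formal.levelForm, map_sum, map_sum, Finset.mul_sum]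
  refine Finset.sum_le_sum fun ν _ => ?_
  rw [← norm_sq_eq_re_inner, ← norm_sq_eq_re_inner, ← mul_pow]
  exact pow_le_pow_left₀ (norm_nonneg _) (θ.le_opNorm _) 2

theorem toComplₗᵢ_denseRange (v : Λ.Vertex) :
    DenseRange (UniformSpace.Completion.toComplₗᵢ (𝕜 := ℂ) (E := M.Formal v)).toLinearMap :=
  UniformSpace.Completion.denseRange_coe

/-- The map `[μ, ξ] ↦ X_μ θ(ξ)` on the closed span of the `[μ, ξ]` with `μ` of range `v`. -/
noncomputable def fiberLift (θ : M →L[ℂ] L) (v : Λ.Vertex) : M.Fiber v →L[ℂ] L :=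
  (formalLift θ v).extendOfNorm
    (UniformSpace.Completion.toComplₗᵢ (𝕜 := ℂ) (E := M.Formal v)).toLinearMap

theorem IsRepHom.fiberLift_coe {θ : M →L[ℂ] L} (hθ : IsRepHom θ) {v : Λ.Vertex}
    (x : M.Formal v) : fiberLift θ v (x : M.Fiber v) = formalLift θ v x := by
  refine LinearMap.extendOfNorm_eq (toComplₗᵢ_denseRange v) ⟨‖θ‖, fun y => ?_⟩ x
  refine (hθ.norm_formalLift_le y).trans_eq ?_
  rw [LinearIsometry.coe_toLinearMap, LinearIsometry.norm_map]

theorem IsRepHom.norm_fiberLift_le {θ : M →L[ℂ] L} (hθ : IsRepHom θ) (v : Λ.Vertex)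
    (x : M.Fiber v) : ‖fiberLift θ v x‖ ≤ ‖θ‖ * ‖x‖ := by
  refine LinearMap.norm_extendOfNorm_apply_le (toComplₗᵢ_denseRange v) _ (fun y => ?_) x
  refine (hθ.norm_formalLift_le y).trans_eq ?_
  rw [LinearIsometry.coe_toLinearMap, LinearIsometry.norm_map]

theorem IsRepHom.fiberLift_vec {θ : M →L[ℂ] L} (hθ : IsRepHom θ) {v : Λ.Vertex} (μ : Λ.In v)
    (ξ : M) : fiberLift θ v (vec μ ξ) = L.op μ.2 (θ ξ) :=
  (hθ.fiberLift_coe (Formal.single μ ξ)).trans (formalLift_single θ μ ξ)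

theorem IsRepHom.op_id_fiberLift {θ : M →L[ℂ] L} (hθ : IsRepHom θ) {v : Λ.Vertex}
    (x : M.Fiber v) : L.op (𝟙 v) (fiberLift θ v x) = fiberLift θ v x := by
  have h : L.op (𝟙 v) ∘L fiberLift θ v = fiberLift θ v := fiber_induction fun μ ξ => by
    rw [ContinuousLinearMap.comp_apply, hθ.fiberLift_vec, ORep.op_id_op]
  exact DFunLike.congr_fun h x

theorem IsRepHom.adjoint_fiberLift {θ : M →L[ℂ] L} (hθ : IsRepHom θ) (v : Λ.Vertex) (y : L) :
    ContinuousLinearMap.adjoint (fiberLift θ v) y =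
      ContinuousLinearMap.adjoint (fiberLift θ v) (L.op (𝟙 v) y) := by
  refine ext_inner_right ℂ fun x => ?_
  rw [ContinuousLinearMap.adjoint_inner_left, ContinuousLinearMap.adjoint_inner_left,
    ← ORep.adjoint_op_id, ContinuousLinearMap.adjoint_inner_left, hθ.op_id_fiberLift]

/-- The lift of the fibre at `v` takes values in the range of `X_v`, so its adjoint sees only `X_v
y`. The squares of these norms are summable over `v`, which makes the adjoint of the full lift the
easier map to construct. -/
theorem IsRepHom.norm_adjoint_fiberLift_le {θ : M →L[ℂ] L} (hθ : IsRepHom θ) (v : Λ.Vertex)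
    (y : L) : ‖ContinuousLinearMap.adjoint (fiberLift θ v) y‖ ≤ ‖θ‖ * ‖L.op (𝟙 v) y‖ := by
  rw [hθ.adjoint_fiberLift]
  refine (ContinuousLinearMap.le_opNorm _ _).trans
    (mul_le_mul_of_nonneg_right ?_ (norm_nonneg _))
  rw [LinearIsometryEquiv.norm_map]
  exact ContinuousLinearMap.opNorm_le_bound _ (norm_nonneg _) (hθ.norm_fiberLift_le v)

theorem IsRepHom.summable_adjoint_fiberLift {θ : M →L[ℂ] L} (hθ : IsRepHom θ) (y : L) :
    Summable fun v => ‖ContinuousLinearMap.adjoint (fiberLift θ v) y‖ ^ 2 := by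
  refine Summable.of_nonneg_of_le (fun v => sq_nonneg _) (fun v => ?_)
    ((hasSum_norm_op_id_sq y).summable.mul_left (‖θ‖ ^ 2))
  rw [← mul_pow]
  exact pow_le_pow_left₀ (norm_nonneg _) (hθ.norm_adjoint_fiberLift_le v y) 2

/-- The adjoint of the lift of a morphism to the dilation. -/
noncomputable def IsRepHom.colift {θ : M →L[ℂ] L} (hθ : IsRepHom θ) : L →L[ℂ] M.Dilation :=
  LinearMap.mkContinuous
    { toFun := fun y => ⟨fun v => ContinuousLinearMap.adjoint (fiberLift θ v) y, by
        refine memℓp_gen ?_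
        simpa using hθ.summable_adjoint_fiberLift y⟩
      map_add' := fun y z => lp.ext (funext fun v => map_add _ y z)
      map_smul' := fun c y => lp.ext (funext fun v => map_smul _ c y) }
    ‖θ‖ fun y => by
      refine (sq_le_sq₀ (norm_nonneg _) (by positivity)).1 ?_
      rw [mul_pow, ← (hasSum_norm_op_id_sq y).tsum_eq, ← tsum_mul_left]
      have h := lp.norm_rpow_eq_tsum (p := 2) (by simp)
        (⟨fun v => ContinuousLinearMap.adjoint (fiberLift θ v) y, by
          refine memℓp_gen ?_
          simpa using hθ.summable_adjoint_fiberLift y⟩ : M.Dilation)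
      simp only [ENNReal.toReal_ofNat, Real.rpow_ofNat] at h
      refine h.trans_le (Summable.tsum_le_tsum (fun v => ?_) (hθ.summable_adjoint_fiberLift y)
        ((hasSum_norm_op_id_sq y).summable.mul_left (‖θ‖ ^ 2)))
      rw [← mul_pow]
      exact pow_le_pow_left₀ (norm_nonneg _) (hθ.norm_adjoint_fiberLift_le v y) 2

/-- The lift of a morphism to the dilation: `[μ, ξ] ↦ X_μ θ(ξ)`. -/
noncomputable def IsRepHom.lift {θ : M →L[ℂ] L} (hθ : IsRepHom θ) : M.dilation →L[ℂ] L :=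
  ContinuousLinearMap.adjoint (E := L) (F := M.Dilation) hθ.colift

theorem IsRepHom.lift_incl {θ : M →L[ℂ] L} (hθ : IsRepHom θ) (v : Λ.Vertex) (x : M.Fiber v) :
    hθ.lift (M.incl v x) = fiberLift θ v x := by
  refine ext_inner_right ℂ fun y => ?_
  refine (ContinuousLinearMap.adjoint_inner_left (E := L) (F := M.Dilation) _ _ _).trans ?_
  rw [← M.adjoint_proj, ContinuousLinearMap.adjoint_inner_left]
  exact ContinuousLinearMap.adjoint_inner_right _ _ _

theorem IsRepHom.lift_dilVec {θ : M →L[ℂ] L} (hθ : IsRepHom θ) {v : Λ.Vertex} (μ : Λ.In v)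
    (ξ : M) : hθ.lift (M.dilVec μ ξ) = L.op μ.2 (θ ξ) := by
  rw [dilVec, hθ.lift_incl, hθ.fiberLift_vec]

/-- Bounded operators on the dilation are determined by their values on the `[μ, ξ]`. -/
theorem dilation_ext {E : Type*} [NormedAddCommGroup E] [NormedSpace ℂ E]
    {S T : M.dilation →L[ℂ] E}
    (h : ∀ (v : Λ.Vertex) (μ : Λ.In v) (ξ : M), S (M.dilVec μ ξ) = T (M.dilVec μ ξ)) : S = T := by
  ext x
  have hv : ∀ (v : Λ.Vertex) (y : M.Fiber v), S (M.incl v y) = T (M.incl v y) := by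
    intro v y
    have : (S : M.Dilation →L[ℂ] E) ∘L M.incl v = (T : M.Dilation →L[ℂ] E) ∘L M.incl v :=
      fiber_induction fun μ ξ => h v μ ξ
    exact DFunLike.congr_fun this y
  have hx := M.dilation.nondegenerate x
  have e : ∀ v, M.dilation.op (𝟙 v) x = M.incl v (M.proj v x) := fun v =>
    DFunLike.congr_fun (M.dilOp_id v) x
  simp only [e] at hx
  have h1 := hx.mapL S
  have h2 := hx.mapL T
  simp only [hv] at h1
  exact h1.unique h2

theorem dilVec_op_of_ne {a b v : Λ.Vertex} (f : a ⟶ b) (μ : Λ.In v) (h : a ≠ v) (ξ : M) :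
    M.dilation.op f (M.dilVec μ ξ) = 0 := by
  change M.incl b (fiberShift (⟨a, f⟩ : Λ.In b) (M.proj a (M.incl v (vec μ ξ)))) = 0
  rw [M.proj_incl_of_ne h, map_zero, map_zero]

theorem IsRepHom.lift_op {θ : M →L[ℂ] L} (hθ : IsRepHom θ) (a b : Λ.Vertex) (f : a ⟶ b)
    (x : M.dilation) : hθ.lift (M.dilation.op f x) = L.op f (hθ.lift x) := by
  have : hθ.lift ∘L M.dilation.op f = L.op f ∘L hθ.lift := by
    refine dilation_ext fun v μ ξ => ?_
    simp only [ContinuousLinearMap.comp_apply]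
    by_cases h : a = v
    · subst h
      rw [dilOp_dilVec, hθ.lift_dilVec, hθ.lift_dilVec]
      exact DFunLike.congr_fun (L.op_comp μ.2 f) _
    · rw [dilVec_op_of_ne f μ h, map_zero, hθ.lift_dilVec, ORep.op_op_of_ne f μ.2 h]
  exact DFunLike.congr_fun this x

/-! ### The canonical morphism to the dilation -/

/-- Moved up to the degree of `μ`, the vector `[v, ξ]` is the sum of the `[ν, A_ν ξ]`, and `[μ, η]`
pairs only with the leaf `μ`. -/
theorem inner_vec_root {v : Λ.Vertex} (μ : Λ.In v) (ξ η : M) :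
    ⟪vec (root v) ξ, vec μ η⟫_ℂ = ⟪M.op μ.2 ξ, η⟫_ℂ := by
  have h1 : Formal.height (Formal.single (root v) ξ) ≤ Λ.deg μ.2 :=
    (Formal.height_single_le _ _).trans ((deg_root v).trans_le bot_le)
  have h2 : Formal.height (Formal.single μ η) ≤ Λ.deg μ.2 := Formal.height_single_le _ _
  have h3 : ⟪vec (root v) ξ, vec μ η⟫_ℂ = Formal.form (Formal.single (root v) ξ)
    (Formal.single μ η) := UniformSpace.Completion.inner_coe _ _
  have hμ : μ ∈ cut v (Λ.deg μ.2) := mem_cut.2 ⟨le_rfl, fun i hi => absurd hi (lt_irrefl _)⟩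
  rw [h3, Formal.form_eq h1 h2, Formal.levelForm, Finset.sum_eq_single_of_mem μ hμ]
  · have e1 : M.transfer (root v) μ = M.op μ.2 := by
      have := M.transfer_ext (root v) μ
      rwa [show ext (root v) μ = μ from root_ext μ] at this
    have e2 : M.transfer μ μ = M.op (𝟙 μ.1) := by
      have := M.transfer_ext μ (root μ.1)
      rwa [show ext μ (root μ.1) = μ from ext_root μ] at this
    rw [Formal.val_single, Formal.val_single, e1, e2, ← M.inner_op_id, M.op_id_comp]
  · intro ν hν hne
    rw [Formal.val_single μ ν, M.transfer_eq_zero, zero_apply, inner_zero_right]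
    rintro α rfl
    refine hne ((isTree_cut v _).eq_of_ext_eq hμ hν rfl).symm

theorem inner_toDilation_dilVec {v : Λ.Vertex} (μ : Λ.In v) (ξ η : M) :
    ⟪M.toDilation ξ, M.dilVec μ η⟫_ℂ = ⟪M.op μ.2 ξ, η⟫_ℂ := by
  have h : ⟪M.toDilation ξ, M.dilVec μ η⟫_ℂ = ⟪M.proj v (M.rootVec ξ), vec μ η⟫_ℂ := by
    rw [← ContinuousLinearMap.adjoint_inner_right, M.adjoint_proj]
    rfl
  rw [h]
  exact inner_vec_root μ ξ η

/-- Tested on generators: `⟪J A_f ξ, [μ, η]⟫ = ⟪A_μ A_f ξ, η⟫ = ⟪J ξ, X_f [μ, η]⟫` for `μ` with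
range the source of `f`, and both sides vanish otherwise. -/
theorem isRepHom_toDilation (M : AMod.{u, w} Λ) :
    IsRepHom (L := M.dilation) M.toDilation.toContinuousLinearMap := by
  intro a b f ξ
  refine ext_inner_right ℂ fun y => ?_
  rw [ContinuousLinearMap.adjoint_inner_left]
  have : innerSL ℂ (M.toDilation (M.op f ξ)) = innerSL ℂ (M.toDilation ξ) ∘L M.dilation.op f := by
    refine dilation_ext fun v μ η => ?_
    simp only [ContinuousLinearMap.comp_apply, innerSL_apply_apply]
    by_cases h : a = v
    · subst h
      rw [dilOp_dilVec, inner_toDilation_dilVec, inner_toDilation_dilVec,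
        M.op_ext (⟨a, f⟩ : Λ.In b) μ]
    · rw [dilVec_op_of_ne f μ h, inner_zero_right, inner_toDilation_dilVec,
        op_op_of_ne _ _ (Ne.symm h), inner_zero_left]
  exact DFunLike.congr_fun this y

theorem isIsometricHom_toDilation (M : AMod.{u, w} Λ) :
    IsIsometricHom (M := M.dilation.toAMod) (N := M) M.toDilation :=
  isRepHom_toDilation M

/-- The decoration of `[μ, ξ]` matters only through its component at the source of `μ`, where `J`
has a single term. Hence the image of `J` generates the dilation. -/
theorem dilation_op_toDilation {v : Λ.Vertex} (μ : Λ.In v) (ξ : M) :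
    M.dilation.op μ.2 (M.toDilation ξ) = M.dilVec μ ξ := by
  have h := (isRepHom_toDilation M).op_id μ.1 ξ
  have h2 : vec μ (M.op (𝟙 μ.1) ξ) = vec μ ξ := by
    rw [← sub_eq_zero, ← map_sub, ← inner_self_eq_zero (𝕜 := ℂ)]
    have h3 := Formal.inner_single_single μ (M.op (𝟙 μ.1) ξ - ξ) (M.op (𝟙 μ.1) ξ - ξ)
    rw [map_sub (M.op (𝟙 μ.1)), M.op_id_comp, sub_self, inner_zero_left] at h3
    exact (UniformSpace.Completion.inner_coe _ _).trans h3
  rw [← ORep.op_op_id]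
  refine (congrArg (M.dilation.op μ.2) h).trans ?_
  refine (congrArg (M.dilation.op μ.2)
    (M.toDilation_apply μ.1 (M.op (𝟙 μ.1) ξ) (M.op_id_comp _ _))).trans ?_
  refine (M.dilOp_dilVec μ.2 (root μ.1) _).trans ?_
  rw [show ext (⟨μ.1, μ.2⟩ : Λ.In v) (root μ.1) = μ from ext_root μ, dilVec, h2, dilVec]

theorem lift_toDilation_eq_id (M : AMod.{u, w} Λ) :
    (isRepHom_toDilation M).lift = ContinuousLinearMap.id ℂ M.dilation := by
  refine dilation_ext fun v μ ξ => ?_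
  rw [IsRepHom.lift_dilVec]
  exact dilation_op_toDilation μ ξ

theorem norm_incl (v : Λ.Vertex) (x : M.Fiber v) : ‖M.incl v x‖ = ‖x‖ := by
  have h : ⟪M.incl v x, M.incl v x⟫_ℂ = ⟪x, x⟫_ℂ := by
    rw [← ContinuousLinearMap.adjoint_inner_right, M.adjoint_incl, M.proj_incl]
  rw [inner_self_eq_norm_sq_to_K, inner_self_eq_norm_sq_to_K] at h
  have h2 : ‖M.incl v x‖ ^ 2 = ‖x‖ ^ 2 := by exact_mod_cast h
  exact (sq_eq_sq₀ (norm_nonneg _) (norm_nonneg _)).1 h2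

/-- At the level of its height, `z` is the sum of the `X_κ J(val κ z)`, and `X_ν^*` selects one
leaf. So a single cut moves a formal combination into the image of `J`. -/
theorem adjoint_op_incl {v : Λ.Vertex} (z : M.Formal v) {ν : Λ.In v} (hν : ν ∈ cut v z.height) :
    ContinuousLinearMap.adjoint (M.dilation.op ν.2) (M.incl v (z : M.Fiber v)) =
      M.toDilation (Formal.val ν z) := by
  have hJ := isRepHom_toDilation M
  have h : M.incl v (z : M.Fiber v) =
      ∑ κ ∈ cut v z.height, M.dilation.op κ.2 (M.toDilation (Formal.val κ z)) := by
    refine Eq.trans ?_ (hJ.formalLift_eq (x := z) le_rfl)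
    rw [← hJ.fiberLift_coe, ← hJ.lift_incl, lift_toDilation_eq_id]
    rfl
  rw [h]
  refine (map_sum (ContinuousLinearMap.adjoint (M.dilation.op ν.2)) _ _).trans ?_
  rw [Finset.sum_eq_single_of_mem ν hν, ORep.adjoint_op_op]
  · refine (hJ.op_id ν.1 _).trans ?_
    rw [Formal.op_id_val]
    rfl
  · intro κ hκ hne
    exact ORep.adjoint_op_tree (isTree_cut v _) hκ hν hne.symm _

/-- Formal combinations are dense in the fibre, and Pythagoras controls the error `x - z` along the
cut on which `z` lands in the image of `J`. -/
theorem exists_formal_approx {v : Λ.Vertex} {x : M.Dilation} (hx : M.dilOp (𝟙 v) x = x) {ε : ℝ}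
    (hε : 0 < ε) : ∃ z : M.Formal v, ∑ ν ∈ cut v z.height,
      ‖ContinuousLinearMap.adjoint (M.dilOp ν.2) x - M.rootVec (Formal.val ν z)‖ ^ 2 < ε ^ 2 := by
  have hx' : M.incl v (M.proj v x) = x := by
    rwa [M.dilOp_id] at hx
  obtain ⟨z, hz⟩ : ∃ z : M.Formal v, ‖M.proj v x - (z : M.Fiber v)‖ < ε := by
    obtain ⟨_, ⟨z, rfl⟩, hz⟩ := Metric.mem_closure_iff.1
      (UniformSpace.Completion.denseRange_coe (α := M.Formal v) (M.proj v x)) ε hε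
    exact ⟨z, by rwa [dist_eq_norm] at hz⟩
  refine ⟨z, ?_⟩
  have h1 : ∑ ν ∈ cut v z.height, ‖ContinuousLinearMap.adjoint (M.dilOp ν.2)
      (M.incl v (M.proj v x - (z : M.Fiber v)))‖ ^ 2 =
      ‖ContinuousLinearMap.adjoint (M.dilOp (𝟙 v))
        (M.incl v (M.proj v x - (z : M.Fiber v)))‖ ^ 2 :=
    M.dilation.toAMod.sum_tree_norm_sq (isTree_cut v z.height)
      (M.incl v (M.proj v x - (z : M.Fiber v)))
  have h2 : ∀ ν ∈ cut v z.height, ContinuousLinearMap.adjoint (M.dilOp ν.2)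
      (M.incl v (M.proj v x - (z : M.Fiber v))) =
      ContinuousLinearMap.adjoint (M.dilOp ν.2) x - M.rootVec (Formal.val ν z) := by
    intro ν hν
    rw [map_sub, hx', map_sub]
    exact congrArg (ContinuousLinearMap.adjoint (M.dilOp ν.2) x - ·) (adjoint_op_incl z hν)
  rw [Finset.sum_congr rfl fun ν hν => by rw [h2 ν hν]] at h1
  refine h1.trans_lt (pow_lt_pow_left₀ ?_ (norm_nonneg _) two_ne_zero)
  refine lt_of_le_of_lt ?_ hz
  rw [← norm_incl]
  have h3 : ContinuousLinearMap.adjoint (M.dilOp (𝟙 v)) = M.dilOp (𝟙 v) :=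
    ORep.adjoint_op_id (L := M.dilation) v
  rw [h3]
  exact ORep.norm_op_le (L := M.dilation) (𝟙 v) _

theorem isComplete_range_toDilation (M : AMod.{u, w} Λ) :
    M.dilation.toAMod.IsComplete
      (LinearMap.range (M := M) (M₂ := M.dilation.toAMod) M.toDilation.toLinearMap) := by
  constructor
  · have h := (isIsometricHom_toDilation M).isSubmodule_map isSubmodule_top
    rwa [Submodule.map_top] at h
  · intro ε hε v x hx
    have hx' : M.dilOp (𝟙 v) x = x := by
      have h : ContinuousLinearMap.adjoint (M.dilation.op (𝟙 v)) x = x := hx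
      rw [ORep.adjoint_op_id] at h
      exact h
    obtain ⟨z, hz⟩ := exists_formal_approx hx' hε
    exact ⟨cut v z.height, isTree_cut v _, fun ν => M.toDilation (Formal.val ν z),
      fun ν _ => ⟨_, rfl⟩, hz⟩

/-! ### Lifts of isometries -/

theorem IsRepHom.lift_toDilation {θ : M →L[ℂ] L} (hθ : IsRepHom θ) (ξ : M) :
    hθ.lift (M.toDilation ξ) = θ ξ := by
  have h1 := (M.nondegenerate ξ).mapL (hθ.lift ∘L M.toDilation.toContinuousLinearMap)
  have h2 := (M.nondegenerate ξ).mapL θ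
  refine h1.unique ?_
  convert h2 using 2 with v
  change hθ.lift (M.toDilation (M.op (𝟙 v) ξ)) = _
  rw [M.toDilation_apply v _ (M.op_id_comp _ _), hθ.lift_dilVec, hθ.op_id, M.op_id_comp]

universe w₃

/-- On generators with the same range the pairing reduces, at a common level, to pairings of `θ` and
`τ`. Comparison with `J` makes lifts of isometries isometric; comparison with zero gives
orthogonality of lifts. -/
theorem inner_lift_congr {L' : ORep.{u, w₃} Λ} {θ : M →L[ℂ] L} (hθ : IsRepHom θ) {τ : N →L[ℂ] L}
    (hτ : IsRepHom τ) {θ' : M →L[ℂ] L'} (hθ' : IsRepHom θ') {τ' : N →L[ℂ] L'} (hτ' : IsRepHom τ')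
    (h : ∀ ξ η, ⟪θ ξ, τ η⟫_ℂ = ⟪θ' ξ, τ' η⟫_ℂ) (x : M.dilation) (y : N.dilation) :
    ⟪hθ.lift x, hτ.lift y⟫_ℂ = ⟪hθ'.lift x, hτ'.lift y⟫_ℂ := by
  have key : ∀ (v : Λ.Vertex) (μ : Λ.In v) (ξ : M) (v' : Λ.Vertex) (ν : Λ.In v') (η : N),
      ⟪L.op μ.2 (θ ξ), L.op ν.2 (τ η)⟫_ℂ = ⟪L'.op μ.2 (θ' ξ), L'.op ν.2 (τ' η)⟫_ℂ := by
    intro v μ ξ v' ν η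
    by_cases hv : v = v'
    · subst hv
      have e := fun m h1 h2 => hθ.inner_formalLift hτ (x := Formal.single μ ξ)
        (y := Formal.single ν η) (m := m) h1 h2
      have e' := fun m h1 h2 => hθ'.inner_formalLift hτ' (x := Formal.single μ ξ)
        (y := Formal.single ν η) (m := m) h1 h2
      simp only [formalLift_single] at e e'
      rw [e _ le_sup_left le_sup_right, e' _ le_sup_left le_sup_right]
      exact Finset.sum_congr rfl fun _ _ => h _ _
    · have z : ∀ {L : ORep.{u, _} Λ} (x y : L), ⟪L.op μ.2 x, L.op ν.2 y⟫_ℂ = 0 := by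
        intro L x y
        rw [← ORep.op_id_op, ← ORep.adjoint_op_id, ContinuousLinearMap.adjoint_inner_left,
          ORep.op_op_of_ne _ _ hv, inner_zero_right]
      have z' : ∀ {L : ORep.{u, _} Λ} (x y : L), ⟪L.op μ.2 x, L.op ν.2 y⟫_ℂ = 0 := by
        intro L x y
        rw [← ORep.op_id_op, ← ORep.adjoint_op_id, ContinuousLinearMap.adjoint_inner_left,
          ORep.op_op_of_ne _ _ hv, inner_zero_right]
      rw [z, z']
  have step : ∀ (v : Λ.Vertex) (μ : Λ.In v) (ξ : M) (y : N.dilation),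
      ⟪L.op μ.2 (θ ξ), hτ.lift y⟫_ℂ = ⟪L'.op μ.2 (θ' ξ), hτ'.lift y⟫_ℂ := by
    intro v μ ξ y
    have : innerSL ℂ (L.op μ.2 (θ ξ)) ∘L hτ.lift = innerSL ℂ (L'.op μ.2 (θ' ξ)) ∘L hτ'.lift := by
      refine dilation_ext fun v' ν η => ?_
      simp only [ContinuousLinearMap.comp_apply, innerSL_apply_apply, IsRepHom.lift_dilVec]
      exact key v μ ξ v' ν η
    exact DFunLike.congr_fun this y
  have : innerSL ℂ (hτ.lift y) ∘L hθ.lift = innerSL ℂ (hτ'.lift y) ∘L hθ'.lift := by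
    refine dilation_ext fun v μ ξ => ?_
    simp only [ContinuousLinearMap.comp_apply, innerSL_apply_apply, IsRepHom.lift_dilVec]
    rw [← inner_conj_symm, step, inner_conj_symm]
  have h2 : ⟪hτ.lift y, hθ.lift x⟫_ℂ = ⟪hτ'.lift y, hθ'.lift x⟫_ℂ := DFunLike.congr_fun this x
  rw [← inner_conj_symm, h2, inner_conj_symm]

theorem inner_lift_of_orthogonal {θ : M →L[ℂ] L} (hθ : IsRepHom θ) {τ : N →L[ℂ] L}
    (hτ : IsRepHom τ) (h : ∀ ξ η, ⟪θ ξ, τ η⟫_ℂ = 0) (x : M.dilation) (y : N.dilation) :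
    ⟪hθ.lift x, hτ.lift y⟫_ℂ = 0 := by
  have h0 : IsRepHom (0 : M →L[ℂ] L) := fun a b f ξ => by simp
  have h0' : IsRepHom (0 : N →L[ℂ] L) := fun a b f ξ => by simp
  rw [inner_lift_congr hθ hτ h0 h0' (fun ξ η => by rw [h]; simp)]
  have : h0.lift = 0 := dilation_ext fun v μ ξ => by rw [h0.lift_dilVec]; simp
  rw [this, zero_apply, inner_zero_left]

/-- The lift of an isometric morphism is isometric. -/
noncomputable def IsRepHom.liftIsometry {θ : M →ₗᵢ[ℂ] L}
    (hθ : IsRepHom θ.toContinuousLinearMap) : M.dilation →ₗᵢ[ℂ] L :=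
  (hθ.lift : M.dilation →ₗ[ℂ] L).isometryOfInner fun x y => by
    have h := inner_lift_congr hθ hθ (isRepHom_toDilation M) (isRepHom_toDilation M)
      (fun ξ η => (θ.inner_map_map ξ η).trans (M.toDilation.inner_map_map ξ η).symm) x y
    rw [lift_toDilation_eq_id] at h
    exact h

theorem IsRepHom.isSubrep_range_lift {θ : M →ₗᵢ[ℂ] L}
    (hθ : IsRepHom θ.toContinuousLinearMap) :
    L.IsSubrep (LinearMap.range hθ.liftIsometry.toLinearMap) :=
  ORep.isSubrep_range hθ.lift_op

theorem IsRepHom.mem_range_lift {θ : M →ₗᵢ[ℂ] L} (hθ : IsRepHom θ.toContinuousLinearMap) (ξ : M) :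
    θ ξ ∈ LinearMap.range hθ.liftIsometry.toLinearMap :=
  ⟨M.toDilation ξ, hθ.lift_toDilation ξ⟩

theorem isRepHom_toDilation_comp {j : N →ₗᵢ[ℂ] M} (hj : IsIsometricHom j) :
    IsRepHom (L := M.dilation) (M.toDilation.comp j).toContinuousLinearMap := by
  intro a b f ξ
  change M.toDilation (j (N.op f ξ)) = _
  rw [hj]
  exact isRepHom_toDilation M a b f (j ξ)

/-- The isomorphism need not be unitary, so both it and its inverse are lifted; the lifts are
mutually inverse on the generators `[μ, ξ]`. -/
theorem Iso.dilation_iso {M N : AMod.{u, w} Λ} : M.Iso N → M.dilation.Iso N.dilation := by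
  rintro ⟨θ, hθ⟩
  have h1 : IsRepHom (L := N.dilation) (N.toDilation.toContinuousLinearMap ∘L (θ : M →L[ℂ] N)) := by
    intro a b f ξ
    refine Eq.trans ?_ (isRepHom_toDilation N a b f (θ ξ))
    exact congrArg N.toDilation (hθ f ξ)
  have h2 : IsRepHom (L := M.dilation)
      (M.toDilation.toContinuousLinearMap ∘L (θ.symm : N →L[ℂ] M)) := by
    intro a b f ξ
    refine Eq.trans ?_ (isRepHom_toDilation M a b f (θ.symm ξ))
    refine congrArg M.toDilation ?_
    change θ.symm (N.op f ξ) = M.op f (θ.symm ξ)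
    rw [ContinuousLinearEquiv.symm_apply_eq]
    refine Eq.trans ?_ (hθ f (θ.symm ξ)).symm
    exact congrArg (N.op f) (θ.apply_symm_apply ξ).symm
  have e1 : ∀ (v : Λ.Vertex) (μ : Λ.In v) (ξ : M),
      h1.lift (M.dilVec μ ξ) = N.dilVec μ (θ ξ) := fun v μ ξ =>
    (h1.lift_dilVec μ ξ).trans (dilation_op_toDilation μ (θ ξ))
  have e2 : ∀ (v : Λ.Vertex) (μ : Λ.In v) (η : N),
      h2.lift (N.dilVec μ η) = M.dilVec μ (θ.symm η) := fun v μ η =>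
    (h2.lift_dilVec μ η).trans (dilation_op_toDilation μ (θ.symm η))
  have c1 : h2.lift ∘L h1.lift = ContinuousLinearMap.id ℂ M.dilation := by
    refine dilation_ext fun v μ ξ => ?_
    rw [ContinuousLinearMap.comp_apply, e1, e2, θ.symm_apply_apply]
    rfl
  have c2 : h1.lift ∘L h2.lift = ContinuousLinearMap.id ℂ N.dilation := by
    refine dilation_ext fun v μ ξ => ?_
    rw [ContinuousLinearMap.comp_apply, e2, e1, θ.apply_symm_apply]
    rfl
  exact ⟨ContinuousLinearEquiv.equivOfInverse h1.lift h2.lift (DFunLike.congr_fun c1)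
    (DFunLike.congr_fun c2), fun f x =>
      ⟨h1.lift_op _ _ f x, ORep.intertwines_adjoint h1.lift_op f x⟩⟩

/-- A complete submodule has the same dilation as the module. -/
theorem IsComplete.dilation_iso {S : Submodule ℂ M} (hS : M.IsComplete S) :
    (M.restrict S hS.isSubmodule).dilation.Iso M.dilation := by
  have hj := isIsometricHom_inclusion S hS.isSubmodule
  have hθ := isRepHom_toDilation_comp hj
  refine ORep.iso_of_isometry hθ.liftIsometry hθ.lift_op (LinearMap.range_eq_top.1 ?_)
  -- The range of the lift contains `J(S)`, which is complete in the dilation by transitivity.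
  refine hθ.isSubrep_range_lift.eq_top ((isIsometricHom_toDilation M).isComplete_map hS
    (isComplete_range_toDilation M)) ?_
  rintro _ ⟨ξ, hξ, rfl⟩
  obtain ⟨η, rfl⟩ := exists_inclusion_eq hS.isSubmodule hξ
  exact hθ.mem_range_lift η

/-- The dilation of a decomposable module is reducible. -/
theorem not_isDecomposable_of_isIrreducible (h : M.dilation.IsIrreducible) :
    ¬ M.IsDecomposable := by
  rintro ⟨S, T, hS, hT, hS0, hT0, hST⟩
  have h1 := isRepHom_toDilation_comp (isIsometricHom_inclusion S hS)
  have h2 := isRepHom_toDilation_comp (isIsometricHom_inclusion T hT)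
  -- By irreducibility the lift of each nonzero submodule is onto. Orthogonal submodules have
  -- orthogonal lifts, so two of them cannot both be onto.
  have htop : ∀ {S : Submodule ℂ M} (hS : M.IsSubmodule S), S ≠ ⊥ →
      LinearMap.range (isRepHom_toDilation_comp
        (isIsometricHom_inclusion S hS)).liftIsometry.toLinearMap = ⊤ := by
    intro S hS h0
    refine (h.2 _ (IsRepHom.isSubrep_range_lift _)).resolve_left fun hbot => ?_
    obtain ⟨ξ, hξ, hξ0⟩ := S.exists_mem_ne_zero_of_ne_bot h0
    obtain ⟨η, rfl⟩ := exists_inclusion_eq hS hξ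
    have hm := (isRepHom_toDilation_comp (isIsometricHom_inclusion S hS)).mem_range_lift η
    rw [hbot, Submodule.mem_bot] at hm
    exact hξ0 (M.toDilation.injective (hm.trans (map_zero _).symm))
  obtain ⟨x, hx0⟩ := @exists_ne _ h.1 (0 : M.dilation)
  obtain ⟨y, hy⟩ : x ∈ LinearMap.range h1.liftIsometry.toLinearMap := by rw [htop hS hS0]; trivial
  obtain ⟨z, hz⟩ : x ∈ LinearMap.range h2.liftIsometry.toLinearMap := by rw [htop hT hT0]; trivial
  have horth : ⟪h1.lift y, h2.lift z⟫_ℂ = 0 := by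
    refine inner_lift_of_orthogonal h1 h2 (fun ξ η => ?_) y z
    refine (M.toDilation.inner_map_map _ _).trans ?_
    exact Submodule.inner_right_of_mem_orthogonal (inclusion_mem hS ξ) (hST (inclusion_mem hT η))
  have hy' : h1.lift y = x := hy
  have hz' : h2.lift z = x := hz
  rw [hy', hz'] at horth
  exact hx0 (inner_self_eq_zero.1 horth)

end AMod

end Lifts

/-! ### Multiplicities of irreducible summands, via spaces of morphisms -/

section Multiplicities

variable {k : ℕ} {Λ : KGraph.{u} k} [Λ.RowFinite]

namespace AMod

universe w₁ w₂

theorem Iso.refl (M : AMod.{u, w} Λ) : M.Iso M := ⟨ContinuousLinearEquiv.refl ℂ M, fun _ _ => rfl⟩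

theorem Iso.symm {M N : AMod.{u, w} Λ} : M.Iso N → N.Iso M := by
  rintro ⟨θ, hθ⟩
  refine ⟨θ.symm, fun f ξ => ?_⟩
  change θ.symm (N.op f ξ) = M.op f (θ.symm ξ)
  rw [ContinuousLinearEquiv.symm_apply_eq]
  refine Eq.trans ?_ (hθ f (θ.symm ξ)).symm
  exact congrArg (N.op f) (θ.apply_symm_apply ξ).symm

theorem Iso.trans {M N P : AMod.{u, w} Λ} : M.Iso N → N.Iso P → M.Iso P := by
  rintro ⟨θ, hθ⟩ ⟨τ, hτ⟩
  exact ⟨θ.trans τ, fun f ξ => (congrArg τ (hθ f ξ)).trans (hτ f (θ ξ))⟩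

/-- Modules with isometric morphisms onto submodules that correspond under an isomorphism are
isomorphic. -/
theorem iso_of_range_le {A B : AMod.{u, w} Λ} {M N : AMod.{u, w₁} Λ} {j : A →ₗᵢ[ℂ] M}
    (hj : IsIsometricHom j) {l : B →ₗᵢ[ℂ] N} (hl : IsIsometricHom l) (θ : M ≃L[ℂ] N)
    (hθ : ∀ (a b : Λ.Vertex) (f : a ⟶ b) (ξ : M), θ (M.op f ξ) = N.op f (θ ξ))
    (h1 : ∀ ξ, θ (j ξ) ∈ LinearMap.range l.toLinearMap)
    (h2 : ∀ η, θ.symm (l η) ∈ LinearMap.range j.toLinearMap) : A.Iso B := by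
  let α : A →L[ℂ] B := (l.equivRange.symm : _ →L[ℂ] B) ∘L
    ((θ : M →L[ℂ] N) ∘L j.toContinuousLinearMap).codRestrict (LinearMap.range l.toLinearMap) h1
  let β : B →L[ℂ] A := (j.equivRange.symm : _ →L[ℂ] A) ∘L
    ((θ.symm : N →L[ℂ] M) ∘L l.toContinuousLinearMap).codRestrict
      (LinearMap.range j.toLinearMap) h2
  have hα : ∀ ξ, l (α ξ) = θ (j ξ) := fun ξ =>
    congrArg Subtype.val (l.equivRange.apply_symm_apply ⟨θ (j ξ), h1 ξ⟩)
  have hβ : ∀ η, j (β η) = θ.symm (l η) := fun η =>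
    congrArg Subtype.val (j.equivRange.apply_symm_apply ⟨θ.symm (l η), h2 η⟩)
  refine ⟨ContinuousLinearEquiv.equivOfInverse α β (fun ξ => j.injective ?_)
    (fun η => l.injective ?_), fun f ξ => ?_⟩
  · rw [hβ, hα, θ.symm_apply_apply]
  · rw [hα, hβ, θ.apply_symm_apply]
  · change α (A.op f ξ) = B.op f (α ξ)
    apply l.injective
    rw [hα, hj, hθ, hl, hα]

/-! ### Spaces of morphisms -/

/-- The space of morphisms from `W` to `M` with values in `S`. -/
def homSpace (W : AMod.{u, w} Λ) {M : AMod.{u, w₁} Λ} (S : Submodule ℂ M) :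
    Submodule ℂ (W →ₗ[ℂ] M) where
  carrier := {φ | (∀ (a b : Λ.Vertex) (f : a ⟶ b) (ξ : W), φ (W.op f ξ) = M.op f (φ ξ)) ∧
    ∀ ξ, φ ξ ∈ S}
  add_mem' := fun h1 h2 => ⟨fun a b f ξ => by simp [h1.1 a b f ξ, h2.1 a b f ξ],
    fun ξ => S.add_mem (h1.2 ξ) (h2.2 ξ)⟩
  zero_mem' := ⟨fun a b f ξ => by simp, fun ξ => S.zero_mem⟩
  smul_mem' := fun c φ h => ⟨fun a b f ξ => by simp [h.1 a b f ξ], fun ξ => S.smul_mem c (h.2 ξ)⟩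

variable {W : AMod.{u, w} Λ} {M : AMod.{u, w₁} Λ} {N : AMod.{u, w₂} Λ}

instance finiteDimensional_homSpace [FiniteDimensional ℂ W] (S : Submodule ℂ M)
    [FiniteDimensional ℂ S] : FiniteDimensional ℂ (homSpace W S) := by
  let F : homSpace W S →ₗ[ℂ] (W →ₗ[ℂ] S) :=
    { toFun := fun φ => φ.1.codRestrict S φ.2.2
      map_add' := fun φ ψ => rfl
      map_smul' := fun c φ => rfl }
  refine FiniteDimensional.of_injective F fun φ ψ h => Subtype.ext (LinearMap.ext fun ξ => ?_)
  exact congrArg Subtype.val (LinearMap.congr_fun h ξ)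

/-- Composition with `j` is a bijection between the two spaces. Since `j` need only be an injective
intertwiner, this covers both inclusions and isomorphisms. -/
theorem finrank_homSpace_map {j : N →ₗ[ℂ] M} (hinj : Function.Injective j)
    (hj : ∀ (a b : Λ.Vertex) (f : a ⟶ b) (ξ : N), j (N.op f ξ) = M.op f (j ξ))
    (S : Submodule ℂ N) :
    Module.finrank ℂ (homSpace W (S.map j)) = Module.finrank ℂ (homSpace W S) := by
  have hinj' : Function.Injective (LinearMap.compRight ℂ j : (W →ₗ[ℂ] N) →ₗ[ℂ] (W →ₗ[ℂ] M)) := by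
    intro φ ψ h
    exact LinearMap.ext fun ξ => hinj (LinearMap.congr_fun h ξ)
  have heq : homSpace W (S.map j) = (homSpace W S).map (LinearMap.compRight ℂ j) := by
    ext φ
    constructor
    · rintro ⟨h1, h2⟩
      let ψ : W →ₗ[ℂ] N := (LinearEquiv.ofInjective j hinj).symm.toLinearMap ∘ₗ
        φ.codRestrict (LinearMap.range j) fun ξ => LinearMap.map_le_range (h2 ξ)
      have hψ : ∀ ξ, j (ψ ξ) = φ ξ := fun ξ => congrArg Subtype.val
        ((LinearEquiv.ofInjective j hinj).apply_symm_apply ⟨φ ξ, LinearMap.map_le_range (h2 ξ)⟩)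
      refine ⟨ψ, ⟨fun a b f ξ => hinj ?_, fun ξ => ?_⟩, LinearMap.ext hψ⟩
      · rw [hψ, hj, hψ, h1]
      · obtain ⟨η, hη, h⟩ := h2 ξ
        rw [← hψ ξ] at h
        rwa [← hinj h]
    · rintro ⟨ψ, ⟨h1, h2⟩, rfl⟩
      exact ⟨fun a b f ξ => (congrArg j (h1 a b f ξ)).trans (hj a b f _),
        fun ξ => Submodule.mem_map_of_mem (h2 ξ)⟩
  rw [heq]
  exact (Submodule.equivMapOfInjective _ hinj' _).finrank_eq.symm

/-- A nonzero morphism from an irreducible module to an irreducible submodule is invertible. -/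
theorem iso_of_mem_homSpace {M : AMod.{u, w} Λ} [FiniteDimensional ℂ W] (hW : W.IsIrreducible)
    {S : Submodule ℂ M} (hS : M.IsSimpleSubmodule S) {φ : W →ₗ[ℂ] M} (hφ : φ ∈ homSpace W S)
    (h0 : φ ≠ 0) : W.Iso (M.restrict S hS.isSubmodule) := by
  have hker : LinearMap.ker φ = ⊥ := by
    refine (hW.2 _ (isSubmodule_of_finiteDimensional fun f ξ hξ => ?_)).resolve_right fun h =>
      h0 (LinearMap.ker_eq_top.1 h)
    rw [LinearMap.mem_ker] at hξ ⊢
    rw [hφ.1, hξ, map_zero]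
  have hrange : LinearMap.range φ = S := by
    refine (hS.eq_bot_or_eq _ (isSubmodule_of_finiteDimensional ?_) ?_).resolve_left fun h =>
      h0 (LinearMap.range_eq_bot.1 h)
    · rintro a b f _ ⟨ξ, rfl⟩
      exact ⟨_, hφ.1 a b f ξ⟩
    · rintro _ ⟨ξ, rfl⟩
      exact hφ.2 ξ
  let e : W ≃ₗ[ℂ] S := LinearEquiv.ofBijective (φ.codRestrict S hφ.2) (by
    constructor
    · intro ξ η h
      exact LinearMap.ker_eq_bot.1 hker (congrArg Subtype.val h)
    · rintro ⟨η, hη⟩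
      rw [← hrange] at hη
      obtain ⟨ξ, rfl⟩ := hη
      exact ⟨ξ, rfl⟩)
  exact ⟨e.toContinuousLinearEquiv, fun f ξ => Subtype.ext (hφ.1 _ _ f ξ)⟩

theorem finrank_homSpace_of_iso {W M : AMod.{u, w} Λ} {S : Submodule ℂ M}
    (hS : M.IsSubmodule S) (h : W.Iso (M.restrict S hS)) :
    Module.finrank ℂ (homSpace W S) = Module.finrank ℂ (homSpace W (⊤ : Submodule ℂ W)) := by
  obtain ⟨θ, hθ⟩ := h
  let j : W →ₗ[ℂ] M := (M.inclusion S hS).toLinearMap ∘ₗ (θ : W →ₗ[ℂ] M.restrict S hS)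
  have hmap : (⊤ : Submodule ℂ W).map j = S := by
    refine le_antisymm ?_ fun ξ hξ => ?_
    · rintro _ ⟨ξ, -, rfl⟩
      exact inclusion_mem hS _
    · obtain ⟨η, rfl⟩ := exists_inclusion_eq hS hξ
      exact ⟨θ.symm η, trivial, congrArg (M.inclusion S hS) (θ.apply_symm_apply η)⟩
  have := finrank_homSpace_map (W := W) (j := j)
    ((M.inclusion S hS).injective.comp θ.injective)
    (fun a b f ξ => congrArg (M.inclusion S hS) (hθ f ξ)) ⊤
  rwa [hmap] at this

/-- The identity is a nonzero endomorphism. Positivity suffices to cancel this factor when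
multiplicities are compared, so its value is irrelevant. -/
theorem finrank_homSpace_pos [FiniteDimensional ℂ W] [Nontrivial W] :
    0 < Module.finrank ℂ (homSpace W (⊤ : Submodule ℂ W)) := by
  refine Module.finrank_pos_iff_exists_ne_zero.2
    ⟨⟨LinearMap.id, fun _ _ _ _ => rfl, fun _ => trivial⟩, fun h => ?_⟩
  obtain ⟨ξ, hξ⟩ := exists_ne (0 : W)
  exact hξ (LinearMap.congr_fun (congrArg Subtype.val h) ξ)

namespace Decomposition

variable {n : ℕ} (D : M.Decomposition n) [∀ i, FiniteDimensional ℂ (D.summand i)]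

theorem starProjection_of_mem {i j : Fin n} {η : M} (hη : η ∈ D.summand j) :
    (D.summand i).starProjection η = if i = j then η else 0 := by
  split_ifs with h
  · subst h
    exact Submodule.starProjection_eq_self_iff.2 hη
  · exact (Submodule.starProjection_apply_eq_zero_iff _).2 (D.orthogonal j i (Ne.symm h) hη)

/-- The projection to a submodule need not commute with the action. It does on `D.sum`, because on
each invariant summand it is the identity or zero. -/
theorem starProjection_sum {η : M} (hη : η ∈ D.sum) :
    ∑ i, (D.summand i).starProjection η = η ∧ ∀ (i : Fin n) {a b : Λ.Vertex} (f : a ⟶ b),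
      (D.summand i).starProjection (M.op f η) = M.op f ((D.summand i).starProjection η) := by
  induction hη using Submodule.iSup_induction' with
  | mem j η hη =>
    refine ⟨by simp [D.starProjection_of_mem hη], fun i a b f => ?_⟩
    rw [D.starProjection_of_mem hη, D.starProjection_of_mem ((D.isSubmodule j).op_mem f η hη)]
    split_ifs <;> simp
  | zero => simp
  | add x y _ _ hx hy =>
    refine ⟨?_, fun i a b f => ?_⟩
    · simp only [map_add, Finset.sum_add_distrib, hx.1, hy.1]
    · simp only [map_add, hx.2 i f, hy.2 i f]

/-- A morphism into the orthogonal sum is the family of its components, which are morphisms by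
`starProjection_sum`. -/
theorem finrank_homSpace_sum [FiniteDimensional ℂ W] :
    Module.finrank ℂ (homSpace W D.sum) =
      ∑ i, Module.finrank ℂ (homSpace W (D.summand i)) := by
  rw [← Module.finrank_pi_fintype ℂ]
  symm
  let F : (∀ i, homSpace W (D.summand i)) →ₗ[ℂ] homSpace W D.sum :=
    LinearMap.codRestrict _
      (∑ i, (homSpace W (D.summand i)).subtype ∘ₗ LinearMap.proj i) (fun φ => by
        rw [LinearMap.sum_apply]
        refine Submodule.sum_mem _ fun i _ => ⟨(φ i).2.1, fun ξ => ?_⟩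
        exact Submodule.mem_iSup_of_mem i ((φ i).2.2 ξ))
  have hF : ∀ (φ : ∀ i, homSpace W (D.summand i)) (ξ : W), (F φ).1 ξ = ∑ i, (φ i).1 ξ := by
    intro φ ξ
    simp [F, LinearMap.sum_apply]
  refine (LinearEquiv.ofBijective F ⟨?_, ?_⟩).finrank_eq
  · refine LinearMap.ker_eq_bot.1 (LinearMap.ker_eq_bot'.2 fun φ hφ => ?_)
    refine funext fun i => Subtype.ext (LinearMap.ext fun ξ => ?_)
    have h := hF φ ξ
    rw [hφ] at h
    have h2 := congrArg (D.summand i).starProjection h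
    simp only [map_sum, D.starProjection_of_mem ((φ _).2.2 ξ)] at h2
    simpa using h2.symm
  · rintro ⟨ψ, hψ1, hψ2⟩
    refine ⟨fun i => ⟨((D.summand i).starProjection : M →ₗ[ℂ] M) ∘ₗ ψ, fun a b f ξ => ?_,
      fun ξ => (D.summand i).starProjection_apply_mem _⟩, ?_⟩
    · change (D.summand i).starProjection (ψ (W.op f ξ)) = _
      rw [hψ1, (D.starProjection_sum (hψ2 ξ)).2 i f]
      rfl
    · refine Subtype.ext (LinearMap.ext fun ξ => ?_)
      rw [hF]
      exact (D.starProjection_sum (hψ2 ξ)).1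

end Decomposition

open Classical in
/-- The dimension of the space of morphisms counts multiplicities. -/
theorem Decomposition.finrank_homSpace_sum_eq {W M : AMod.{u, w} Λ} {n : ℕ}
    (D : M.Decomposition n) [∀ i, FiniteDimensional ℂ (D.summand i)] [FiniteDimensional ℂ W]
    (hW : W.IsIrreducible) :
    Module.finrank ℂ (homSpace W D.sum) =
      (Finset.univ.filter fun i => W.Iso (D.mod i)).card *
        Module.finrank ℂ (homSpace W (⊤ : Submodule ℂ W)) := by
  rw [D.finrank_homSpace_sum, Finset.card_filter, Finset.sum_mul]
  refine Finset.sum_congr rfl fun i _ => ?_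
  split_ifs with h
  · rw [one_mul]
    exact finrank_homSpace_of_iso (D.isSubmodule i) h
  · rw [zero_mul]
    have : homSpace W (D.summand i) = ⊥ := by
      refine (Submodule.eq_bot_iff _).2 fun φ hφ => ?_
      by_contra h0
      exact h (iso_of_mem_homSpace hW (D.isSimpleSubmodule i) hφ h0)
    rw [this, finrank_bot]

end AMod

open Classical in
/-- Two finite families whose members occur with equal multiplicities up to an equivalence
relation differ by a bijection. -/
theorem exists_equiv_of_card_eq {X α β : Type*} [Fintype α] [Fintype β] (r : Setoid X)
    (A : α → X) (B : β → X)
    (h : ∀ x, (x ∈ Set.range A ∨ x ∈ Set.range B) →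
      (Finset.univ.filter fun i => r x (A i)).card = (Finset.univ.filter fun j => r x (B j)).card) :
    ∃ φ : α ≃ β, ∀ i, r (A i) (B (φ i)) := by
  let a : α → Quotient r := fun i => Quotient.mk r (A i)
  let b : β → Quotient r := fun j => Quotient.mk r (B j)
  have hq : ∀ q, Nonempty ({i // a i = q} ≃ {j // b j = q}) := by
    intro q
    by_cases hx : ∃ x, (x ∈ Set.range A ∨ x ∈ Set.range B) ∧ Quotient.mk r x = q
    · obtain ⟨x, hx, rfl⟩ := hx
      refine Fintype.card_eq.1 ?_
      rw [Fintype.card_subtype, Fintype.card_subtype]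
      convert h x hx using 4 with i _ j _
      · exact Quotient.eq.trans ⟨r.symm, r.symm⟩
      · exact Quotient.eq.trans ⟨r.symm, r.symm⟩
    -- A class that occurs in neither family has empty fibres on both sides.
    · push Not at hx
      have : IsEmpty {i // a i = q} := ⟨fun i => hx _ (Or.inl ⟨i.1, rfl⟩) i.2⟩
      have : IsEmpty {j // b j = q} := ⟨fun j => hx _ (Or.inr ⟨j.1, rfl⟩) j.2⟩
      exact ⟨Equiv.equivOfIsEmpty _ _⟩
  let e := fun q => (hq q).some
  let φ : α ≃ β := (Equiv.sigmaFiberEquiv a).symm.trans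
    ((Equiv.sigmaCongrRight e).trans (Equiv.sigmaFiberEquiv b))
  refine ⟨φ, fun i => Quotient.exact (?_ : a i = b (φ i))⟩
  exact (e (a i) ⟨i, rfl⟩).2.symm

end Multiplicities

/-! ### Uniqueness, and the smallest complete submodule of the dilation -/

section FinitePythagoreanDimension

variable {k : ℕ} {Λ : KGraph.{u} k} [Λ.RowFinite]

universe w₁

namespace ORep

/-- The sum of isometries with mutually orthogonal ranges. -/
noncomputable def sumIsometry {n : ℕ} {L : Fin n → ORep.{u, w} Λ} {L' : ORep.{u, w₁} Λ}
    (T : ∀ i, L i →ₗᵢ[ℂ] L')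
    (h : ∀ i j, i ≠ j → ∀ (x : L i) (y : L j), ⟪T i x, T j y⟫_ℂ = 0) :
    PiLp 2 (fun i => (L i).carrier) →ₗᵢ[ℂ] L' :=
  LinearMap.isometryOfInner
    (∑ i, (T i).toLinearMap ∘ₗ (PiLp.projₗ (𝕜 := ℂ) 2 (fun i => (L i).carrier) i)) fun x y => by
      simp only [LinearMap.sum_apply, LinearMap.comp_apply, PiLp.projₗ_apply,
        LinearIsometry.coe_toLinearMap, sum_inner, inner_sum, PiLp.inner_apply]
      refine Finset.sum_congr rfl fun i _ => ?_
      rw [Finset.sum_eq_single i (fun j _ hj => h j i hj _ _)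
        (fun h => absurd (Finset.mem_univ i) h), LinearIsometry.inner_map_map]

theorem sumIsometry_apply {n : ℕ} {L : Fin n → ORep.{u, w} Λ} {L' : ORep.{u, w₁} Λ}
    (T : ∀ i, L i →ₗᵢ[ℂ] L')
    (h : ∀ i j, i ≠ j → ∀ (x : L i) (y : L j), ⟪T i x, T j y⟫_ℂ = 0)
    (x : PiLp 2 (fun i => (L i).carrier)) : sumIsometry T h x = ∑ i, T i (x i) := by
  simp [sumIsometry, LinearMap.sum_apply]

/-- A representation that is generated by mutually orthogonal subrepresentations is their direct
sum. -/
theorem directSum_iso {n : ℕ} {L : Fin n → ORep.{u, w} Λ} {L' : ORep.{u, w} Λ}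
    (T : ∀ i, L i →ₗᵢ[ℂ] L')
    (hT : ∀ (i : Fin n) (a b : Λ.Vertex) (f : a ⟶ b) (x : L i),
      T i ((L i).op f x) = L'.op f (T i x))
    (h : ∀ i j, i ≠ j → ∀ (x : L i) (y : L j), ⟪T i x, T j y⟫_ℂ = 0)
    {S : Submodule ℂ L'.toAMod} (hS : L'.toAMod.IsComplete S)
    (hle : ∀ x : L', (x : L'.toAMod) ∈ S →
      x ∈ ⨆ i, LinearMap.range (T i).toLinearMap) :
    (ORep.directSum L).Iso L' := by
  let Φ : ORep.directSum L →ₗᵢ[ℂ] L' := sumIsometry T h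
  have hΦ : ∀ (a b : Λ.Vertex) (f : a ⟶ b) (x : ORep.directSum L),
      Φ ((ORep.directSum L).op f x) = L'.op f (Φ x) := by
    intro a b f x
    refine (sumIsometry_apply T h _).trans ?_
    refine Eq.trans ?_ (congrArg (L'.op f) (sumIsometry_apply T h x)).symm
    rw [map_sum]
    exact Finset.sum_congr rfl fun i _ => hT i a b f _
  refine iso_of_isometry Φ hΦ (LinearMap.range_eq_top.1 ?_)
  refine (isSubrep_range hΦ).eq_top hS fun x hx => ?_
  have hsup : ⨆ i, LinearMap.range (T i).toLinearMap ≤ LinearMap.range Φ.toLinearMap := by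
    refine iSup_le fun i => ?_
    rintro _ ⟨y, rfl⟩
    classical
    refine ⟨(WithLp.toLp 2 (Pi.single i y) : PiLp 2 (fun i => (L i).carrier)), ?_⟩
    refine (sumIsometry_apply T h _).trans ?_
    rw [Finset.sum_eq_single i]
    · simp
    · intro j _ hj
      simp [hj]
    · simp
  exact hsup (hle x hx)

end ORep

namespace AMod

variable {M : AMod.{u, w} Λ}

theorem IsIsometricHom.finiteDimensional_map {N : AMod.{u, w₁} Λ} {j : N →ₗᵢ[ℂ] M}
    (_ : IsIsometricHom j) (S : Submodule ℂ N) [FiniteDimensional ℂ S] :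
    FiniteDimensional ℂ (S.map j.toLinearMap) := inferInstance

theorem finiteDimensional_map_equiv {N : AMod.{u, w₁} Λ} (θ : M ≃L[ℂ] N) (S : Submodule ℂ M)
    [FiniteDimensional ℂ S] : FiniteDimensional ℂ (S.map (θ : M →ₗ[ℂ] N)) := inferInstance

theorem IsIsometricHom.finiteDimensional_comap {N : AMod.{u, w₁} Λ} {j : N →ₗᵢ[ℂ] M}
    (_ : IsIsometricHom j) (S : Submodule ℂ M) [FiniteDimensional ℂ S] :
    FiniteDimensional ℂ (S.comap j.toLinearMap) :=
  FiniteDimensional.of_injective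
    (j.toLinearMap.restrict (p := S.comap j.toLinearMap) (q := S) fun _ h => h)
    fun _ _ h => Subtype.ext (j.injective (congrArg Subtype.val h))

theorem IsIsometricHom.finiteDimensional_range {N : AMod.{u, w₁} Λ} {j : N →ₗᵢ[ℂ] M}
    (_ : IsIsometricHom j) [FiniteDimensional ℂ N] :
    FiniteDimensional ℂ (LinearMap.range j.toLinearMap) := inferInstance

theorem Decomposition.finiteDimensional_sum {M : AMod.{u, w} Λ} {n : ℕ} (D : M.Decomposition n)
    [∀ i, FiniteDimensional ℂ (D.summand i)] : FiniteDimensional ℂ D.sum :=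
  inferInstanceAs (FiniteDimensional ℂ (⨆ i, D.summand i : Submodule ℂ M))

/-- Modules whose images in isomorphic dilations are the smallest complete submodules are
isomorphic. -/
theorem iso_of_isSmallestComplete {A B : AMod.{u, w} Λ} {L L' : ORep.{u, w₁} Λ}
    {j : A →ₗᵢ[ℂ] L.toAMod} (hj : IsIsometricHom j) {l : B →ₗᵢ[ℂ] L'.toAMod}
    (hl : IsIsometricHom l)
    (h1 : L.toAMod.IsSmallestComplete (LinearMap.range j.toLinearMap))
    (h2 : L'.toAMod.IsSmallestComplete (LinearMap.range l.toLinearMap)) (h : L.Iso L') :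
    A.Iso B := by
  obtain ⟨θ, hθ⟩ := h
  let τ : L.toAMod ≃L[ℂ] L'.toAMod := θ
  have hτ : ∀ (a b : Λ.Vertex) (f : a ⟶ b) (ξ : L.toAMod),
      τ (L.toAMod.op f ξ) = L'.toAMod.op f (τ ξ) := fun a b f ξ => (hθ f ξ).2
  have hτ' : ∀ (a b : Λ.Vertex) (f : a ⟶ b) (ξ : L'.toAMod),
      τ.symm (L'.toAMod.op f ξ) = L.toAMod.op f (τ.symm ξ) := by
    intro a b f ξ
    rw [ContinuousLinearEquiv.symm_apply_eq, hτ, τ.apply_symm_apply]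
  -- Completeness is transported in both directions, so minimality on each side gives one of the two
  -- inclusions between the ranges.
  have e1 := h2.2 (h1.1.map_equiv τ hτ)
  have e2 := h1.2 (h2.1.map_equiv τ.symm hτ')
  refine iso_of_range_le hj hl τ hτ (fun ξ => ?_) fun η => ?_
  · obtain ⟨x, hx, hx2⟩ := e2 ⟨ξ, rfl⟩
    have : τ (j ξ) = x := by
      have hx3 : τ.symm x = j ξ := hx2
      rw [← hx3, τ.apply_symm_apply]
    rw [this]
    exact hx
  · obtain ⟨x, hx, hx2⟩ := e1 ⟨η, rfl⟩
    have : τ.symm (l η) = x := by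
      have hx3 : τ x = l η := hx2
      rw [← hx3, τ.symm_apply_apply]
    rw [this]
    exact hx

theorem Decomposition.isDecomposable {n : ℕ} (D : M.Decomposition n) (hn : 1 < n) :
    M.IsDecomposable := by
  have hne : (⟨0, by omega⟩ : Fin n) ≠ ⟨1, hn⟩ := by simp
  exact ⟨_, _, D.isSubmodule ⟨0, by omega⟩, D.isSubmodule ⟨1, hn⟩,
    (D.isSimpleSubmodule _).ne_bot, (D.isSimpleSubmodule _).ne_bot,
    D.orthogonal _ _ hne.symm⟩

/-- By minimality the isomorphism carries `D.sum` onto `E.sum`. For irreducible `W` both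
multiplicities, times the dimension of the endomorphisms of `W`, then give the dimension of the same
space of morphisms. -/
theorem Decomposition.unique {N : AMod.{u, w} Λ} {n m : ℕ} (D : M.Decomposition n)
    (E : N.Decomposition m) {F : Submodule ℂ M} [FiniteDimensional ℂ F] (hF : M.IsComplete F)
    (h : M.Iso N) : n = m ∧ ∃ φ : Fin n ≃ Fin m, ∀ i, (D.mod i).Iso (E.mod (φ i)) := by
  classical
  obtain ⟨θ, hθ⟩ := h
  have hθ1 : ∀ (a b : Λ.Vertex) (f : a ⟶ b) (ξ : M), θ (M.op f ξ) = N.op f (θ ξ) :=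
    fun a b f ξ => hθ f ξ
  have hθ2 : ∀ (a b : Λ.Vertex) (f : a ⟶ b) (η : N),
      θ.symm (N.op f η) = M.op f (θ.symm η) := by
    intro a b f ξ
    rw [ContinuousLinearEquiv.symm_apply_eq, hθ1, θ.apply_symm_apply]
  have hF' := hF.map_equiv θ hθ1
  have hD := D.finiteDimensional_summand hF
  have hE := E.finiteDimensional_summand hF'
  have hDs := D.isSmallestComplete_sum hF
  have hEs := E.isSmallestComplete_sum hF'
  have hmap : E.sum = D.sum.map ((θ : M ≃ₗ[ℂ] N) : M →ₗ[ℂ] N) := by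
    refine le_antisymm (hEs.2 (hDs.1.map_equiv θ hθ1)) ?_
    have h2 := hDs.2 (hEs.1.map_equiv θ.symm hθ2)
    rintro _ ⟨ξ, hξ, rfl⟩
    obtain ⟨η, hη, rfl⟩ := h2 hξ
    change θ (θ.symm η) ∈ E.sum
    rwa [θ.apply_symm_apply]
  have hcount : ∀ W : AMod.{u, w} Λ, FiniteDimensional ℂ W → W.IsIrreducible →
      (Finset.univ.filter fun i => W.Iso (D.mod i)).card =
        (Finset.univ.filter fun j => W.Iso (E.mod j)).card := by
    intro W hW hWi
    have h1 := D.finrank_homSpace_sum_eq hWi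
    have h2 := E.finrank_homSpace_sum_eq hWi
    rw [hmap, finrank_homSpace_map θ.injective hθ1, h1] at h2
    have := hWi.1
    exact Nat.eq_of_mul_eq_mul_right finrank_homSpace_pos h2
  let r : Setoid (AMod.{u, w} Λ) := ⟨AMod.Iso, Iso.refl, Iso.symm, Iso.trans⟩
  obtain ⟨φ, hφ⟩ := exists_equiv_of_card_eq r D.mod E.mod (by
    rintro _ (⟨i, rfl⟩ | ⟨j, rfl⟩)
    · exact hcount _ (hD i) (D.isIrreducible i)
    · exact hcount _ (hE j) (E.isIrreducible j))
  exact ⟨by simpa using Fintype.card_congr φ, φ, hφ⟩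

variable [Λ.LocallyConvex]

/-- A module of finite Pythagorean dimension has a finite-dimensional complete submodule. -/
theorem FinitePDim.exists_isComplete (h : M.FinitePDim) :
    ∃ F : Submodule ℂ M, FiniteDimensional ℂ F ∧ M.IsComplete F := by
  obtain ⟨K, hK, hiso⟩ := h
  obtain ⟨θ, hθ⟩ := hiso.symm
  let τ : K.dilation.toAMod ≃L[ℂ] M.dilation.toAMod := θ
  have hc := (isComplete_range_toDilation K).map_equiv τ fun a b f ξ => (hθ f ξ).2
  have := (isIsometricHom_toDilation K).finiteDimensional_range
  have := finiteDimensional_map_equiv τ (LinearMap.range (M := K) (M₂ := K.dilation.toAMod)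
    K.toDilation.toLinearMap)
  -- The transported image of `K` need not lie in `J(M)`. The smallest complete submodule does, as
  -- `J(M)` is complete, and it can be pulled back.
  obtain ⟨n, ⟨D⟩⟩ := exists_decomposition hc
  have hfd' := D.finiteDimensional_summand hc
  have hs := D.isSmallestComplete_sum hc
  have := D.finiteDimensional_sum
  have hle := hs.2 (isComplete_range_toDilation M)
  have hJ := isIsometricHom_toDilation M
  exact ⟨_, hJ.finiteDimensional_comap D.sum, hJ.isComplete_comap hs.1 hle⟩

/-- Each `J(D.summand i)` is simple and finite-dimensional, hence in every complete submodule of the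
dilation, whether or not that submodule lies in the image of `J`. -/
theorem Decomposition.isSmallestComplete_map {n : ℕ} (D : M.Decomposition n)
    [∀ i, FiniteDimensional ℂ (D.summand i)] (hs : M.IsComplete D.sum) :
    M.dilation.toAMod.IsSmallestComplete (D.sum.map M.toDilation.toLinearMap) := by
  have hJ := isIsometricHom_toDilation M
  refine ⟨hJ.isComplete_map hs (isComplete_range_toDilation M), fun T hT => ?_⟩
  refine Submodule.map_le_iff_le_comap.2 (iSup_le fun i => ?_)
  refine Submodule.map_le_iff_le_comap.1 ?_
  exact IsComplete.le_of_isSimpleSubmodule hT (hJ.isSimpleSubmodule_map_iff.2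
    (D.isSimpleSubmodule i)) (Or.inl (hJ.finiteDimensional_map _))

theorem isSmallestComplete_range_toDilation [FiniteDimensional ℂ M] (hM : M.IsIrreducible) :
    M.dilation.toAMod.IsSmallestComplete
      (LinearMap.range (M := M) (M₂ := M.dilation.toAMod) M.toDilation.toLinearMap) := by
  refine ⟨isComplete_range_toDilation M, fun T hT => ?_⟩
  have h := (isIsometricHom_toDilation M).isSimpleSubmodule_map_iff.2 (isIrreducible_iff.1 hM)
  rw [Submodule.map_top] at h
  exact IsComplete.le_of_isSimpleSubmodule hT h
    (Or.inl (isIsometricHom_toDilation M).finiteDimensional_range)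

theorem dilation_isIrreducible [FiniteDimensional ℂ M] (hM : M.IsIrreducible) :
    M.dilation.IsIrreducible := by
  have h := (isIsometricHom_toDilation M).isSimpleSubmodule_map_iff.2 (isIrreducible_iff.1 hM)
  rw [Submodule.map_top] at h
  have := (isIsometricHom_toDilation M).finiteDimensional_range
  exact ORep.isIrreducible_of_isSimpleSubmodule h (isComplete_range_toDilation M)

/-- The smallest complete submodule is determined by the dilation. -/
theorem restrict_iso_of_dilation_iso {N : AMod.{u, w} Λ} {S : Submodule ℂ M}
    {T : Submodule ℂ N} (hS : M.IsSubmodule S) (hT : N.IsSubmodule T)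
    (h1 : M.dilation.toAMod.IsSmallestComplete (S.map M.toDilation.toLinearMap))
    (h2 : N.dilation.toAMod.IsSmallestComplete (T.map N.toDilation.toLinearMap))
    (h : M.dilation.Iso N.dilation) : (M.restrict S hS).Iso (N.restrict T hT) := by
  -- The image of `S` is rewritten as the range of an isometric morphism from the restricted module.
  have key : ∀ {M : AMod.{u, w} Λ} {S : Submodule ℂ M} (hS : M.IsSubmodule S),
      M.dilation.toAMod.IsSmallestComplete (S.map M.toDilation.toLinearMap) →
      M.dilation.toAMod.IsSmallestComplete (LinearMap.range (M := M.restrict S hS)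
        (M₂ := M.dilation.toAMod) (M.toDilation.comp (M.inclusion S hS)).toLinearMap) := by
    intro M S hS h
    convert h using 1
    refine (LinearMap.range_comp (M.inclusion S hS).toLinearMap M.toDilation.toLinearMap).trans ?_
    rw [range_inclusion]
    rfl
  exact iso_of_isSmallestComplete (L := M.dilation) (L' := N.dilation)
    (j := M.toDilation.comp (M.inclusion S hS)) (l := N.toDilation.comp (N.inclusion T hT))
    (isRepHom_toDilation_comp (isIsometricHom_inclusion S hS))
    (isRepHom_toDilation_comp (isIsometricHom_inclusion T hT)) (key hS h1) (key hT h2) h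

/-- Orthogonal summands have lifts with orthogonal ranges, and the sum of these ranges contains the
complete submodule `J(D.sum)`. -/
theorem Decomposition.directSum_iso {n : ℕ} (D : M.Decomposition n) (hs : M.IsComplete D.sum) :
    (ORep.directSum fun i => (D.mod i).dilation).Iso M.dilation := by
  have hJ := isIsometricHom_toDilation M
  have hθ := fun i => isRepHom_toDilation_comp
    (isIsometricHom_inclusion (D.summand i) (D.isSubmodule i))
  refine ORep.directSum_iso (L := fun i => (D.mod i).dilation) (fun i => (hθ i).liftIsometry)
    (fun i a b f x => (hθ i).lift_op a b f x) (fun i j hij x y => ?_)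
    (hJ.isComplete_map hs (isComplete_range_toDilation M)) ?_
  · refine inner_lift_of_orthogonal (hθ i) (hθ j) (fun ξ η => ?_) x y
    refine (M.toDilation.inner_map_map _ _).trans ?_
    exact (D.orthogonal i j hij).inner_eq (inclusion_mem _ ξ) (inclusion_mem _ η)
  · rintro _ ⟨ξ, hξ, rfl⟩
    have hle : D.sum ≤ (⨆ i, LinearMap.range (hθ i).liftIsometry.toLinearMap).comap
        M.toDilation.toLinearMap := by
      refine iSup_le fun i ξ hξ => ?_
      obtain ⟨η, rfl⟩ := exists_inclusion_eq (D.isSubmodule i) hξ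
      exact Submodule.mem_iSup_of_mem i ((hθ i).mem_range_lift η)
    exact hle hξ

theorem Decomposition.dilation_isIrreducible (D : M.Decomposition 1)
    [∀ i, FiniteDimensional ℂ (D.summand i)] (hs : M.IsComplete D.sum) :
    M.dilation.IsIrreducible := by
  have hJ := isIsometricHom_toDilation M
  have hD : D.sum = D.summand 0 := iSup_unique _
  have h1 := hJ.isSimpleSubmodule_map_iff.2 (D.isSimpleSubmodule 0)
  rw [hD] at hs
  have := hJ.finiteDimensional_map (D.summand 0)
  exact ORep.isIrreducible_of_isSimpleSubmodule h1
    (hJ.isComplete_map hs (isComplete_range_toDilation M))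

end AMod

end FinitePythagoreanDimension

/-! ### The theorem -/

theorem mainTheorem3 {k : ℕ} (hk : 1 ≤ k) (Λ : KGraph.{u} k) [Λ.RowFinite] [Λ.LocallyConvex]
    (H : AMod.{u, w} Λ) [Nontrivial H] (hH : H.FinitePDim) :
    -- existence of the decomposition
    (∃ (n : ℕ) (D : H.Decomposition n), 1 ≤ n ∧ (∀ i, FiniteDimensional ℂ (D.summand i)) ∧
      H.IsComplete D.sum) ∧
    -- irreducibility of the dilation
    (H.dilation.IsIrreducible ↔ Nonempty (H.Decomposition 1)) ∧
    (H.dilation.IsIrreducible ↔ ¬ H.IsDecomposable) ∧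
    -- properties of every decomposition
    ∀ (n : ℕ) (D : H.Decomposition n),
      1 ≤ n ∧ (∀ i, FiniteDimensional ℂ (D.summand i)) ∧
      -- uniqueness up to isomorphism and permutation
      (∀ (K : AMod.{u, w} Λ) (m : ℕ) (E : K.Decomposition m), H.Iso K →
        n = m ∧ ∃ φ : Fin n ≃ Fin m, ∀ i, (D.mod i).Iso (E.mod (φ i))) ∧
      -- the sum of the irreducible summands is the smallest complete submodule
      (∃ hs : H.IsSmallestComplete D.sum,
        ∀ K : AMod.{u, w} Λ, K.FinitePDim →
          ∃ (Ks : Submodule ℂ K) (hKs : K.IsSmallestComplete Ks),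
            -- it is preserved by morphisms
            (∀ θ : H →L[ℂ] K, AMod.IsHom θ → ∀ ξ ∈ D.sum, θ ξ ∈ Ks) ∧
            -- it determines the dilation
            (H.dilation.Iso K.dilation ↔
              (H.restrict D.sum hs.1.isSubmodule).Iso (K.restrict Ks hKs.1.isSubmodule))) ∧
      -- it is also the smallest complete submodule of the dilation
      H.dilation.toAMod.IsSmallestComplete (D.sum.map H.toDilation.toLinearMap) ∧
      (H.dilation.IsIrreducible ↔ n = 1) ∧
      -- decomposition of the dilation
      H.dilation.Iso (ORep.directSum fun i => (D.mod i).dilation) ∧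
      (∀ i, (D.mod i).dilation.IsIrreducible) ∧
      (∀ i j, (D.mod i).dilation.Iso (D.mod j).dilation ↔ (D.mod i).Iso (D.mod j)) := by
  obtain ⟨F, hFfd, hF⟩ := hH.exists_isComplete
  obtain ⟨n₀, ⟨D₀⟩⟩ := AMod.exists_decomposition hF
  have hfd : ∀ {n : ℕ} (D : H.Decomposition n) (i : Fin n), FiniteDimensional ℂ (D.summand i) :=
    fun D => D.finiteDimensional_summand hF
  have hs : ∀ {n : ℕ} (D : H.Decomposition n), H.IsSmallestComplete D.sum :=
    fun D => D.isSmallestComplete_sum hF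
  -- One cycle yields all the irreducibility criteria: an irreducible dilation forces
  -- indecomposability, this forces a single summand in any decomposition, and a single summand
  -- generates an irreducible dilation.
  have hone : ∀ {n : ℕ}, H.Decomposition n → ¬ H.IsDecomposable → n = 1 := fun D hD =>
    le_antisymm (not_lt.1 fun hn => hD (D.isDecomposable hn)) D.one_le
  have hirr : ∀ {n : ℕ}, H.Decomposition n → n = 1 → H.dilation.IsIrreducible := by
    rintro n D rfl
    have := hfd D
    exact D.dilation_isIrreducible (hs D).1
  refine ⟨⟨n₀, D₀, D₀.one_le, hfd D₀, (hs D₀).1⟩, ⟨fun h => ?_, fun ⟨D⟩ => hirr D rfl⟩,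
    ⟨AMod.not_isDecomposable_of_isIrreducible, fun h => hirr D₀ (hone D₀ h)⟩, fun n D => ?_⟩
  · obtain rfl := hone D₀ (AMod.not_isDecomposable_of_isIrreducible h)
    exact ⟨D₀⟩
  have hfdD := hfd D
  have hmod : ∀ i, FiniteDimensional ℂ (D.mod i) := hfdD
  refine ⟨D.one_le, hfd D, fun K m E h => D.unique E hF h, ⟨hs D, fun K hK => ?_⟩,
    D.isSmallestComplete_map (hs D).1,
    ⟨fun h => hone D (AMod.not_isDecomposable_of_isIrreducible h), hirr D⟩,
    (D.directSum_iso (hs D).1).symm, fun i => AMod.dilation_isIrreducible (D.isIrreducible i),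
    fun i j => ⟨fun h => ?_, AMod.Iso.dilation_iso⟩⟩
  · obtain ⟨F', hF'fd, hF'⟩ := hK.exists_isComplete
    obtain ⟨m, ⟨E⟩⟩ := AMod.exists_decomposition hF'
    have hE := E.finiteDimensional_summand hF'
    have hEs := E.isSmallestComplete_sum hF'
    refine ⟨E.sum, hEs, fun θ hθ ξ hξ => ?_, fun h => ?_, fun h => ?_⟩
    · have hle : D.sum ≤ E.sum.comap (θ : H →ₗ[ℂ] K) := iSup_le fun i =>
        Submodule.map_le_iff_le_comap.1 (hEs.1.map_le_of_isSimpleSubmodule (D.isSimpleSubmodule i)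
          θ fun a b f ξ => hθ f ξ)
      exact hle hξ
    · exact AMod.restrict_iso_of_dilation_iso _ _ (D.isSmallestComplete_map (hs D).1)
        (E.isSmallestComplete_map hEs.1) h
    -- Each module has the same dilation as its smallest complete submodule.
    · exact (hs D).1.dilation_iso.symm.trans (h.dilation_iso.trans hEs.1.dilation_iso)
  · exact AMod.iso_of_isSmallestComplete (AMod.isIsometricHom_toDilation _)
      (AMod.isIsometricHom_toDilation _)
      (AMod.isSmallestComplete_range_toDilation (D.isIrreducible i))
      (AMod.isSmallestComplete_range_toDilation (D.isIrreducible j)) h
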